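/- **Setting.** Let $L>0$, $s>0$, and write $\langle\cdot,\cdot\rangle$ for the inner product of $L^2_{per}([0,L])\times L^2_{per}([0,L])$ (real, $L$-periodic functions) and $X=H^{s/2}_{per}([0,L])\times H^{s/2}_{per}([0,L])$, with norm $\|u\|_X^2=\sum_{\kappa\in\mathbb Z}(1+\kappa^2)^{s/2}|\widehat u(\kappa)|^2$, where $\widehat u(\kappa)=\frac1L\int_0^L u(x)e^{-2\pi i\kappa x/L}\,dx$. Consider the system $$\partial_t u+\partial_x\big(\nabla R(u)-\mathcal M u\big)=0,\qquad u=(u_1,u_2),\tag{1}$$ where $R:\mathbb R^2\to\mathbb R$ is of class $C^2$ and $\widehat{\mathcal M u}(\kappa)=m(\kappa)\widehat u(\kappa)$, $\kappa\in\mathbb Z$, with real symmetric $2\times2$ matrices $m(\kappa)$ such that $m(-\kappa)=m(\kappa)$ and, for some $c_1,c_2>0$, $c_1|\kappa|^s\le\langle m(\kappa)w,w\rangle_{\mathbb R^2}\le c_2|\kappa|^s$ for all $\kappa\in\mathbb Z$ and all unit vectors $w\in\mathbb R^2$. If $s\le1$, assume moreover that $R(u)$ is integrable over a period for every $u\in X$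 and that $u\mapsto\int_0^LR(u)\,dx$ is of class $C^2$ near the function $\phi$ below, as a functional on $X$ (if $s>1$ this is automatic). Let $E(u)=\int_0^L\{\frac12\langle\mathcal Mu,u\rangle_{\mathbb R^2}-R(u)\}\,dx$ (with $\int_0^L\langle\mathcal Mu,u\rangle_{\mathbb R^2}dx$ understood as the quadratic form of $\mathcal M$ on $X$) and $F(u)=\frac12\int_0^L\langle u,u\rangle_{\mathbb R^2}\,dx$. Assume that (1) is globally well-posed in $X$. Of this, only the following is used: to every $u_0\in X$ there is assigned a global solution $u(t)=S(t)u_0$, $u\in C([0,\infty);X)$, $u(0)=u_0$, for which $\nabla R(u(t))$ is integrable over a period for every $t\ge0$ and, for all smooth $L$-periodic $\eta:\mathbb R\to\mathbb R^2$ and all $t\ge0$, $\langle u(t),\eta\rangle-\langle u_0,\eta\rangle=\int_0^t\langle\nabla R(u(\tau))-\mathcal Mu(\tau),\eta'\rangle\,d\tau$ (the integrand being integrable on $[0,t]$). Assume that $E$ and $F$ are conserved. A functional $Q:X\to\mathbb R$ is called conserved if $Q(S(t)u_0)=Q(u_0)$ for all $u_0\in X$ and $t\ge0$. **Assumptions.**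 $(H_1)$ $\phi=(\phi_1,\phi_2)\in C^\infty_{per}([0,L])\times C^\infty_{per}([0,L])$ has minimal period $L$ and satisfies $\mathcal M\phi+c\phi-\nabla R(\phi)+A=0$ for some $c\in\mathbb R$ and $A\in\mathbb R^2$. The self-adjoint operator $$\mathcal L=\mathcal M+c\,\mathrm{Id}_2-\mathrm{Hess}\,R(\phi)$$ in $L^2_{per}\times L^2_{per}$ with domain $H^s_{per}\times H^s_{per}$ has exactly one negative eigenvalue, which is simple, and zero is a simple eigenvalue with eigenfunction $\phi'$. $(H_2)$ There is $\Phi\in X$ with $\langle\mathcal L\Phi,\Phi\rangle<0$ and $\langle\mathcal L\Phi,\phi'\rangle=0$ (where $\langle\mathcal L\cdot,\cdot\rangle$ is the bilinear form of $\mathcal L$ on $X$), and there is a conserved functional $Q:X\to\mathbb R$, invariant under translations, $Q(u(\cdot+y))=Q(u)$ for all $y\in\mathbb R$ and $u\in X$, that is Fréchet differentiable at $\phi$ with $Q'(\phi)=\mathcal L\Phi$, that is, $Q'(\phi)v=\langle\mathcal L\Phi,v\rangle$ for all $v\in X$. **Theorem.** Under these assumptions $\phi$ is orbitally stable in $X$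 by the flow of (1): for every $\varepsilon>0$ there is $\delta>0$ such that for every $u_0\in X$ with $\|u_0-\phi\|_X<\delta$ the solution $u(t)=S(t)u_0$ exists globally and satisfies $$\rho(u(t),\phi):=\inf_{y\in\mathbb R}\|u(t)-\phi(\cdot+y)\|_X<\varepsilon\qquad\text{for all }t\ge0.$$ -/

import Mathlib

open MeasureTheory Set Filter Topology
open scoped ContDiff

noncomputable section

namespace DispersiveSystem

/-- The plane `ℝ²` with its Euclidean inner product; the systems below are for `ℝ²`-valued
unknowns. -/
abbrev Plane := EuclideanSpace ℝ (Fin 2)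

/-! ### Fourier coefficients of `L`-periodic `ℝ²`-valued functions

`L`-periodic functions of a real variable are functions on `AddCircle L = ℝ/Lℤ`. Integrals over
`AddCircle L` are integrals over one period (total mass `L`). -/

section Fourier

variable {L : ℝ} [Fact (0 < L)]

/-- The Fourier coefficient `(1/L) ∫₀ᴸ fᵢ(x) e^{-2πiκx/L} dx` of the `i`-th component of `f`. -/
def fcoef (f : AddCircle L → Plane) (κ : ℤ) (i : Fin 2) : ℂ :=
  fourierCoeff (fun x => ((f x i : ℝ) : ℂ)) κ

lemma integrable_haar {f : AddCircle L → Plane} (hf : Integrable f) (i : Fin 2) :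
    Integrable (fun x => ((f x i : ℝ) : ℂ)) AddCircle.haarAddCircle := by
  have h1 : Integrable (fun x => ((f x i : ℝ) : ℂ)) :=
    ((EuclideanSpace.proj (𝕜 := ℝ) i).integrable_comp hf).ofReal
  rw [← memLp_one_iff_integrable] at h1 ⊢
  exact memLp_haarAddCircle_iff.2 h1

lemma ae_haar {p : AddCircle L → Prop} (h : ∀ᵐ x, p x) :
    ∀ᵐ x ∂(AddCircle.haarAddCircle : Measure (AddCircle L)), p x := by
  rw [AddCircle.volume_eq_smul_haarAddCircle] at h
  have hL : (0 : ℝ) < L := Fact.out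
  rwa [Measure.ae_ennreal_smul_measure_eq (by simpa using hL)] at h

lemma fcoef_congr {f g : AddCircle L → Plane} (h : f =ᵐ[volume] g) : fcoef f = fcoef g := by
  funext κ i
  refine congrFun (fourierCoeff_congr_ae ?_) κ
  filter_upwards [ae_haar h] with x hx
  simp [hx]

lemma fcoef_add {f g : AddCircle L → Plane} (hf : Integrable f) (hg : Integrable g) (κ : ℤ)
    (i : Fin 2) : fcoef (f + g) κ i = fcoef f κ i + fcoef g κ i := by
  have h := congrFun (fourierCoeff.add (integrable_haar hf i) (integrable_haar hg i)) κ
  rw [Pi.add_apply] at h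
  rw [fcoef, fcoef, fcoef, ← h]
  congr 1
  funext x
  simp

lemma fcoef_smul (a : ℝ) (f : AddCircle L → Plane) (κ : ℤ) (i : Fin 2) :
    fcoef (a • f) κ i = a * fcoef f κ i := by
  rw [fcoef, fcoef, ← fourierCoeff.const_mul]
  congr 1
  funext x
  simp

lemma fcoef_translate (f : AddCircle L → Plane) (y : AddCircle L) (κ : ℤ) (i : Fin 2) :
    fcoef (fun x => f (x + y)) κ i = fourier κ y * fcoef f κ i := by
  unfold fcoef fourierCoeff
  rw [← integral_const_mul, ← integral_add_right_eq_self (μ := AddCircle.haarAddCircle)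
    (fun t => fourier κ y * (fourier (-κ) t • ((f t i : ℝ) : ℂ))) y]
  congr 1
  funext x
  have h : fourier κ y * fourier (-κ) (x + y) = fourier (-κ) x := by
    rw [fourier_apply, fourier_apply, fourier_apply, ← Circle.coe_mul, ← AddCircle.toCircle_add]
    congr 2
    module
  rw [smul_eq_mul, smul_eq_mul, ← mul_assoc, h]

end Fourier

/-! ### The Sobolev spaces `H^r_per([0,L]) × H^r_per([0,L])` -/

section Sobolev

variable (L : ℝ) [Fact (0 < L)] (r : ℝ)

/-- `L²_per([0,L]) × L²_per([0,L])`. -/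
abbrev L2per := Lp Plane 2 (volume : Measure (AddCircle L))

variable {L}

lemma integrable_L2 (f : L2per L) : Integrable (f : AddCircle L → Plane) :=
  (Lp.memLp f).integrable (by norm_num)

/-- Membership of `f` in `H^r × H^r`, for a square integrable `f`:
`∑_κ (1 + κ²)^r |f̂(κ)|² < ∞`. -/
def InSobolev (f : AddCircle L → Plane) : Prop :=
  Summable fun κ : ℤ => (1 + (κ : ℝ) ^ 2) ^ r * ∑ i, ‖fcoef f κ i‖ ^ 2

/-- The weighted Fourier coefficients `(1 + κ²)^{r/2} f̂(κ) ∈ ℂ²`. -/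
def wcoef (f : AddCircle L → Plane) (κ : ℤ) : EuclideanSpace ℂ (Fin 2) :=
  ((1 + (κ : ℝ) ^ 2) ^ (r / 2) : ℝ) • WithLp.toLp 2 (fcoef f κ)

lemma norm_wcoef_sq (f : AddCircle L → Plane) (κ : ℤ) :
    ‖wcoef r f κ‖ ^ 2 = (1 + (κ : ℝ) ^ 2) ^ r * ∑ i, ‖fcoef f κ i‖ ^ 2 := by
  have h0 : (0 : ℝ) ≤ 1 + (κ : ℝ) ^ 2 := by positivity
  rw [wcoef, norm_smul, mul_pow, EuclideanSpace.norm_sq_eq, Real.norm_eq_abs, sq_abs,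
    ← Real.rpow_natCast, ← Real.rpow_mul h0]
  norm_num

lemma inSobolev_iff (f : AddCircle L → Plane) :
    InSobolev r f ↔ Memℓp (wcoef r f) 2 := by
  rw [memℓp_gen_iff (by norm_num)]
  simp only [ENNReal.toReal_ofNat, Real.rpow_ofNat, norm_wcoef_sq]
  rfl

lemma wcoef_add (f g : L2per L) : wcoef r (f + g : L2per L) = wcoef r f + wcoef r g := by
  funext κ
  have h : fcoef (f + g : L2per L) κ = fcoef f κ + fcoef g κ := by
    rw [fcoef_congr (Lp.coeFn_add f g)]
    exact funext (fcoef_add (integrable_L2 f) (integrable_L2 g) κ)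
  rw [wcoef, h, Pi.add_apply, wcoef, wcoef, WithLp.toLp_add, smul_add]

lemma wcoef_smul (a : ℝ) (f : L2per L) : wcoef r (a • f : L2per L) = a • wcoef r f := by
  funext κ
  have h : fcoef (a • f : L2per L) κ = a • fcoef f κ := by
    rw [fcoef_congr (Lp.coeFn_smul a f)]
    funext i
    simpa using fcoef_smul a f κ i
  rw [wcoef, h, Pi.smul_apply, wcoef, WithLp.toLp_smul, smul_comm]

variable (L)

/-- `H^r × H^r` as a subspace of `L² × L²`. -/
def sobolevSubmodule : Submodule ℝ (L2per L) where
  carrier := {f | InSobolev r (f : AddCircle L → Plane)}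
  add_mem' {f g} hf hg := by
    simp only [mem_ofPred_eq, inSobolev_iff] at *
    rw [wcoef_add]
    exact hf.add hg
  zero_mem' := by
    simp only [mem_ofPred_eq, inSobolev_iff]
    have h := wcoef_smul r (0 : ℝ) (0 : L2per L)
    rw [smul_zero, zero_smul] at h
    rw [h]
    exact zero_memℓp
  smul_mem' a f hf := by
    simp only [mem_ofPred_eq, inSobolev_iff] at *
    rw [wcoef_smul]
    exact hf.const_smul a

/-- The Sobolev space `H^r_per([0,L]) × H^r_per([0,L])` of real functions, with norm
`‖u‖² = ∑_κ (1 + κ²)^r |û(κ)|²` (see `Hper.norm_sq`). -/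
def Hper : Type := sobolevSubmodule L r

instance : AddCommGroup (Hper L r) := inferInstanceAs (AddCommGroup (sobolevSubmodule L r))

instance : Module ℝ (Hper L r) := inferInstanceAs (Module ℝ (sobolevSubmodule L r))

variable {L r}

/-- The underlying `L²` function. -/
def Hper.toL2 (u : Hper L r) : L2per L := Subtype.val (p := (· ∈ sobolevSubmodule L r)) u

instance : CoeFun (Hper L r) (fun _ => AddCircle L → Plane) := ⟨fun u => (u.toL2 : _ → Plane)⟩

variable (L r)

/-- `u ↦ ((1 + κ²)^{r/2} û(κ))_κ`, a linear map into `ℓ²(ℤ, ℂ²)`. -/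
def Hper.toEll2 : Hper L r →ₗ[ℝ] lp (fun _ : ℤ => EuclideanSpace ℂ (Fin 2)) 2 where
  toFun u := ⟨wcoef r u, (inSobolev_iff r u).1 u.2⟩
  map_add' u v := Subtype.ext (wcoef_add r u.toL2 v.toL2)
  map_smul' a u := Subtype.ext (wcoef_smul r a u.toL2)

variable {L}

/-- An `L²` function all of whose Fourier coefficients vanish is zero. -/
lemma eq_zero_of_fcoef (f : L2per L) (h : ∀ κ i, fcoef f κ i = 0) : f = 0 := by
  have key : ∀ i : Fin 2, ∀ᵐ x, (f x i : ℝ) = 0 := by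
    intro i
    have hm : MemLp (fun x => ((f x i : ℝ) : ℂ)) 2 (volume : Measure (AddCircle L)) :=
      ((EuclideanSpace.proj (𝕜 := ℝ) i).comp_memLp' (Lp.memLp f)).ofReal
    have hm' := memLp_haarAddCircle_iff.2 hm
    have hz : hm'.toLp _ = 0 := by
      apply fourierBasis.repr.injective
      rw [map_zero]
      ext κ
      rw [fourierBasis_repr, fourierCoeff_congr_ae hm'.coeFn_toLp]
      exact h κ i
    have h0 := (Lp.eq_zero_iff_ae_eq_zero).1 hz
    have h1 : ∀ᵐ x ∂(AddCircle.haarAddCircle : Measure (AddCircle L)), (f x i : ℝ) = 0 := by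
      filter_upwards [h0, hm'.coeFn_toLp] with x hx hx'
      rw [hx'] at hx
      simpa using hx
    exact Measure.ae_smul_measure h1 (ENNReal.ofReal L)
  rw [Lp.eq_zero_iff_ae_eq_zero]
  filter_upwards [key 0, key 1] with x h0 h1
  ext i
  fin_cases i
  · simpa using h0
  · simpa using h1

variable (L)

lemma Hper.toEll2_injective : Function.Injective (Hper.toEll2 L r) := by
  rw [← LinearMap.ker_eq_bot, LinearMap.ker_eq_bot']
  intro u hu
  refine Subtype.ext (eq_zero_of_fcoef u.toL2 fun κ i => ?_)
  have h1 : wcoef r u κ = 0 := congrFun (congrArg Subtype.val hu) κ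
  have h0 : (0 : ℝ) < (1 + (κ : ℝ) ^ 2) ^ (r / 2) := by positivity
  rw [wcoef, smul_eq_zero_iff_right h0.ne'] at h1
  simpa using congrArg (fun w : EuclideanSpace ℂ (Fin 2) => w i) h1

instance : NormedAddCommGroup (Hper L r) :=
  NormedAddCommGroup.induced (Hper L r) _ (Hper.toEll2 L r) (Hper.toEll2_injective L r)

instance : NormedSpace ℝ (Hper L r) := NormedSpace.induced ℝ (Hper L r) _ (Hper.toEll2 L r)

variable {L r}

lemma Hper.norm_sq (u : Hper L r) :
    ‖u‖ ^ 2 = ∑' κ : ℤ, (1 + (κ : ℝ) ^ 2) ^ r * ∑ i, ‖fcoef u κ i‖ ^ 2 := by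
  have h := lp.norm_rpow_eq_tsum (p := 2) (by norm_num) (Hper.toEll2 L r u)
  simp only [ENNReal.toReal_ofNat, Real.rpow_ofNat] at h
  change ‖Hper.toEll2 L r u‖ ^ 2 = _
  rw [h]
  exact tsum_congr fun κ => norm_wcoef_sq r u κ

/-- The translate `u(· + y)` of an element of `L² × L²`. -/
def translateL2 (y : ℝ) (f : L2per L) : L2per L :=
  Lp.compMeasurePreserving (fun x => x + (y : AddCircle L))
    (measurePreserving_add_right volume (y : AddCircle L)) f

/-- The translate `u(· + y)` of an element of `H^r × H^r`. -/
def translate (y : ℝ) (u : Hper L r) : Hper L r :=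
  ⟨translateL2 y u.toL2, by
    have h1 : InSobolev r (u : AddCircle L → Plane) := u.2
    change InSobolev r (translateL2 y u.toL2 : AddCircle L → Plane)
    have h2 := fcoef_congr (Lp.coeFn_compMeasurePreserving u.toL2
      (measurePreserving_add_right volume (y : AddCircle L)))
    unfold InSobolev at h1 ⊢
    rw [translateL2, h2]
    convert h1 using 5 with κ i
    change ‖fcoef (fun x => u (x + (y : AddCircle L))) κ _‖ = _
    rw [fcoef_translate, norm_mul, fourier_apply, Circle.norm_coe, one_mul]⟩

/-- `ρ(u,v) = inf_{y ∈ ℝ} ‖u - v(· + y)‖`. -/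
def rho (u v : Hper L r) : ℝ := ⨅ y : ℝ, ‖u - translate y v‖

end Sobolev

/-! ### Smooth periodic functions -/

section Smooth

/-- `C^∞` functions `ℝ → ℝ²` of period `L`, as functions on `ℝ/Lℤ`. -/
structure SmoothPer (L : ℝ) where
  toFun : AddCircle L → Plane
  smooth : ContDiff ℝ ∞ fun x : ℝ => toFun (x : AddCircle L)

instance (L : ℝ) : CoeFun (SmoothPer L) (fun _ => AddCircle L → Plane) := ⟨SmoothPer.toFun⟩

variable {L : ℝ}

lemma SmoothPer.deriv_aux (f : SmoothPer L) (a : ℝ) :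
    deriv (fun t : ℝ => f ((a : AddCircle L) + (t : AddCircle L))) 0 =
      deriv (fun t : ℝ => f (t : AddCircle L)) a := by
  have h := deriv_comp_const_add (f := fun t : ℝ => f (t : AddCircle L)) a 0
  rw [add_zero] at h
  rw [← h]
  rfl

/-- The derivative `f'`. -/
def SmoothPer.deriv (f : SmoothPer L) : SmoothPer L where
  toFun x := _root_.deriv (fun t : ℝ => f (x + (t : AddCircle L))) 0
  smooth := by
    simp only [SmoothPer.deriv_aux]
    exact (contDiff_infty_iff_deriv.1 f.smooth).2

lemma SmoothPer.hasDerivAt (f : SmoothPer L) (a : ℝ) :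
    HasDerivAt (fun t : ℝ => f (t : AddCircle L)) (f.deriv (a : AddCircle L)) a := by
  have h : f.deriv (a : AddCircle L) = _ := f.deriv_aux a
  rw [h]
  exact (f.smooth.differentiable (by simp) a).hasDerivAt

lemma SmoothPer.continuous (f : SmoothPer L) : Continuous (f : AddCircle L → Plane) :=
  (QuotientAddGroup.isQuotientMap_mk (N := AddSubgroup.zmultiples L)).continuous_iff.2
    f.smooth.continuous

variable [Fact (0 < L)]

lemma SmoothPer.fcoef_deriv (f : SmoothPer L) {κ : ℤ} (hκ : κ ≠ 0) (i : Fin 2) :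
    ‖fcoef f κ i‖ = L / (2 * Real.pi * |(κ : ℝ)|) * ‖fcoef f.deriv κ i‖ := by
  have hL : (0 : ℝ) < L := Fact.out
  have hlift : ∀ g : SmoothPer L, fcoef g κ i =
      fourierCoeffOn (lt_add_of_pos_right (0 : ℝ) hL)
        (fun x : ℝ => ((g (x : AddCircle L) i : ℝ) : ℂ)) κ := by
    intro g
    rw [← fourierCoeff_liftIoc_eq, fcoef]
    congr 1
    funext x
    obtain ⟨a, ha, rfl⟩ : ∃ a ∈ Ioc (0 : ℝ) (0 + L), (a : AddCircle L) = x :=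
      ⟨_, ((AddCircle.equivIoc L 0) x).2, (AddCircle.equivIoc L 0).symm_apply_apply x⟩
    rw [AddCircle.liftIoc_coe_apply ha]
  have hd : ∀ x : ℝ, HasDerivAt (fun x : ℝ => ((f (x : AddCircle L) i : ℝ) : ℂ))
      ((f.deriv (x : AddCircle L) i : ℝ) : ℂ) x := fun x =>
    ((EuclideanSpace.proj (𝕜 := ℝ) i).hasFDerivAt.comp_hasDerivAt x (f.hasDerivAt x)).ofReal_comp
  have hc : Continuous fun x : ℝ => ((f.deriv (x : AddCircle L) i : ℝ) : ℂ) :=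
    Complex.continuous_ofReal.comp
      ((EuclideanSpace.proj (𝕜 := ℝ) i).continuous.comp f.deriv.smooth.continuous)
  have h := fourierCoeffOn_of_hasDerivAt (lt_add_of_pos_right (0 : ℝ) hL) hκ
    (fun x _ => hd x) (hc.intervalIntegrable _ _)
  have hp : ((0 + L : ℝ) : AddCircle L) = ((0 : ℝ) : AddCircle L) := by
    rw [zero_add, AddCircle.coe_period, QuotientAddGroup.mk_zero]
  rw [hlift f, h, hlift f.deriv]
  simp only [hp, sub_self, mul_zero, zero_sub, norm_mul, norm_neg, norm_div, norm_one,
    Complex.norm_real, Complex.norm_I, Complex.norm_intCast, Complex.norm_ofNat]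
  have e : ‖((0 + L : ℝ) : ℂ) - ((0 : ℝ) : ℂ)‖ = L := by
    rw [zero_add, Complex.ofReal_zero, sub_zero, Complex.norm_real, Real.norm_of_nonneg hL.le]
  rw [e, Real.norm_of_nonneg Real.pi_pos.le]
  field_simp

lemma SmoothPer.fcoef_bound (f : SmoothPer L) : ∃ C : ℝ, ∀ κ i, ‖fcoef f κ i‖ ≤ C := by
  obtain ⟨C, hC⟩ := isCompact_univ.exists_bound_of_continuousOn f.continuous.continuousOn
  refine ⟨C, fun κ i => ?_⟩
  have h := norm_integral_le_of_norm_le_const (μ := (AddCircle.haarAddCircle : Measure (AddCircle L)))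
    (f := fun t : AddCircle L => fourier (-κ) t • ((f t i : ℝ) : ℂ)) (C := C)
    (Eventually.of_forall fun x => by
      rw [norm_smul, fourier_apply, Circle.norm_coe, one_mul, Complex.norm_real]
      exact (PiLp.norm_apply_le (f x) i).trans (hC x (mem_univ x)))
  simpa [fcoef, fourierCoeff] using h

lemma SmoothPer.fcoef_decay (n : ℕ) : ∀ f : SmoothPer L,
    ∃ C : ℝ, ∀ κ : ℤ, κ ≠ 0 → ∀ i, ‖fcoef f κ i‖ ≤ C / |(κ : ℝ)| ^ n := by
  have hL : (0 : ℝ) < L := Fact.out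
  induction n with
  | zero =>
    intro f
    obtain ⟨C, hC⟩ := f.fcoef_bound
    exact ⟨C, fun κ _ i => by simpa using hC κ i⟩
  | succ n ih =>
    intro f
    obtain ⟨C, hC⟩ := ih f.deriv
    refine ⟨L / (2 * Real.pi) * C, fun κ hκ i => ?_⟩
    have h0 : (0 : ℝ) < |(κ : ℝ)| := by positivity
    rw [f.fcoef_deriv hκ i]
    calc L / (2 * Real.pi * |(κ : ℝ)|) * ‖fcoef f.deriv κ i‖
        ≤ L / (2 * Real.pi * |(κ : ℝ)|) * (C / |(κ : ℝ)| ^ n) := by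
          gcongr
          exact hC κ hκ i
      _ = L / (2 * Real.pi) * C / |(κ : ℝ)| ^ (n + 1) := by
          rw [pow_succ]
          field_simp

lemma SmoothPer.inSobolev (f : SmoothPer L) (r : ℝ) : InSobolev r (f : AddCircle L → Plane) := by
  obtain ⟨k, hk⟩ := exists_nat_ge |r|
  obtain ⟨C, hC⟩ := SmoothPer.fcoef_decay (k + 1) f
  have hs : Summable fun κ : ℤ => 2 ^ k * (2 * C ^ 2) * (1 / (κ : ℝ) ^ 2) :=
    (Real.summable_one_div_int_pow.2 (by norm_num)).mul_left _
  refine Summable.of_norm_bounded_eventually hs ?_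
  have hf : ∀ᶠ κ : ℤ in cofinite, κ ≠ 0 := by
    rw [eventually_cofinite]
    simp
  filter_upwards [hf] with κ hκ
  have h1 : (1 : ℝ) ≤ (κ : ℝ) ^ 2 := by
    have : (1 : ℤ) ≤ κ ^ 2 := by
      have := sq_nonneg κ
      have h2 : κ ^ 2 ≠ 0 := pow_ne_zero 2 hκ
      omega
    exact_mod_cast this
  have hpos : (0 : ℝ) ≤ 1 + (κ : ℝ) ^ 2 := by positivity
  have hw : (1 + (κ : ℝ) ^ 2) ^ r ≤ 2 ^ k * ((κ : ℝ) ^ 2) ^ k := by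
    calc (1 + (κ : ℝ) ^ 2) ^ r ≤ (1 + (κ : ℝ) ^ 2) ^ (k : ℝ) :=
          Real.rpow_le_rpow_of_exponent_le (by linarith) ((le_abs_self r).trans hk)
      _ = (1 + (κ : ℝ) ^ 2) ^ k := Real.rpow_natCast _ _
      _ ≤ (2 * (κ : ℝ) ^ 2) ^ k := by gcongr; linarith
      _ = 2 ^ k * ((κ : ℝ) ^ 2) ^ k := mul_pow _ _ _
  have hc : ∑ i, ‖fcoef f κ i‖ ^ 2 ≤ 2 * C ^ 2 / ((κ : ℝ) ^ 2) ^ (k + 1) := by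
    have hi : ∀ i, ‖fcoef f κ i‖ ^ 2 ≤ C ^ 2 / ((κ : ℝ) ^ 2) ^ (k + 1) := by
      intro i
      calc ‖fcoef f κ i‖ ^ 2 ≤ (C / |(κ : ℝ)| ^ (k + 1)) ^ 2 := by
            gcongr
            exact hC κ hκ i
        _ = C ^ 2 / ((κ : ℝ) ^ 2) ^ (k + 1) := by
            rw [div_pow, ← pow_mul, mul_comm (k + 1) 2, pow_mul, sq_abs]
    rw [Fin.sum_univ_two]
    have := hi 0
    have := hi 1
    linarith [show 2 * C ^ 2 / ((κ : ℝ) ^ 2) ^ (k + 1) = C ^ 2 / ((κ : ℝ) ^ 2) ^ (k + 1)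
      + C ^ 2 / ((κ : ℝ) ^ 2) ^ (k + 1) by ring]
  have hk0 : (0 : ℝ) < (κ : ℝ) ^ 2 := by linarith
  rw [Real.norm_of_nonneg (by positivity)]
  calc (1 + (κ : ℝ) ^ 2) ^ r * ∑ i, ‖fcoef f κ i‖ ^ 2
      ≤ (2 ^ k * ((κ : ℝ) ^ 2) ^ k) * (2 * C ^ 2 / ((κ : ℝ) ^ 2) ^ (k + 1)) := by gcongr
    _ = 2 ^ k * (2 * C ^ 2) * (1 / (κ : ℝ) ^ 2) := by
        rw [pow_succ]
        field_simp
        ring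

lemma SmoothPer.memLp (f : SmoothPer L) :
    MemLp (f : AddCircle L → Plane) 2 (volume : Measure (AddCircle L)) := by
  obtain ⟨C, hC⟩ := isCompact_univ.exists_bound_of_continuousOn f.continuous.continuousOn
  exact MemLp.of_bound f.continuous.aestronglyMeasurable C
    (Eventually.of_forall fun x => hC x (mem_univ x))

/-- A smooth periodic function as an element of `L² × L²`. -/
def SmoothPer.toL2 (f : SmoothPer L) : L2per L := f.memLp.toLp f

/-- A smooth periodic function as an element of `H^r × H^r`. -/
def SmoothPer.toHper (r : ℝ) (f : SmoothPer L) : Hper L r :=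
  ⟨f.toL2, by
    change InSobolev r (f.toL2 : AddCircle L → Plane)
    have h := f.inSobolev r
    unfold InSobolev at h ⊢
    rwa [SmoothPer.toL2, fcoef_congr f.memLp.coeFn_toLp]⟩

end Smooth

/-! ### The dispersion operator, the energy and the linearized operator -/

section Operators

/-- The conditions on the symbol `m` of the dispersion operator: `m(κ)` is a real symmetric
matrix, even in `κ`, and `c₁|κ|^s ≤ ⟨m(κ)w,w⟩ ≤ c₂|κ|^s` for all unit vectors `w`. -/
structure IsSymbol (m : ℤ → Matrix (Fin 2) (Fin 2) ℝ) (s : ℝ) : Prop where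
  symm : ∀ κ, (m κ).IsSymm
  even : ∀ κ, m (-κ) = m κ
  elliptic : ∃ c₁ c₂ : ℝ, 0 < c₁ ∧ 0 < c₂ ∧ ∀ (κ : ℤ) (w : Plane), ‖w‖ = 1 →
    c₁ * |(κ : ℝ)| ^ s ≤ ∑ i, ∑ j, m κ i j * w j * w i ∧
      ∑ i, ∑ j, m κ i j * w j * w i ≤ c₂ * |(κ : ℝ)| ^ s

variable {L : ℝ} [Fact (0 < L)]

/-- `𝓜 f = g`, where `𝓜` is the matrix Fourier multiplier with symbol `m`:
`ĝᵢ(κ) = ∑ⱼ mᵢⱼ(κ) f̂ⱼ(κ)` for all `κ ∈ ℤ`. -/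
def IsDispersion (m : ℤ → Matrix (Fin 2) (Fin 2) ℝ) (f g : AddCircle L → Plane) : Prop :=
  ∀ (κ : ℤ) (i : Fin 2), fcoef g κ i = ∑ j, (m κ i j : ℂ) * fcoef f κ j

/-- The bilinear form `⟨𝓜f, g⟩ = ∫₀ᴸ ⟨𝓜f, g⟩ dx` on the energy space, written through Parseval's
identity: `L ∑_κ Re ⟨m(κ) f̂(κ), ĝ(κ)⟩`. -/
def dispersionForm (m : ℤ → Matrix (Fin 2) (Fin 2) ℝ) (f g : AddCircle L → Plane) : ℝ :=
  L * ∑' κ : ℤ, ∑ i, ∑ j, m κ i j * (fcoef f κ j * starRingEnd ℂ (fcoef g κ i)).re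

/-- The energy `E(u) = ∫₀ᴸ (½⟨𝓜u,u⟩ - R(u)) dx`. -/
def energy (R : Plane → ℝ) (m : ℤ → Matrix (Fin 2) (Fin 2) ℝ) (u : AddCircle L → Plane) : ℝ :=
  1 / 2 * dispersionForm m u u - ∫ x, R (u x)

/-- The momentum `F(u) = ½ ∫₀ᴸ ⟨u,u⟩ dx`. -/
def momentum (u : AddCircle L → Plane) : ℝ := 1 / 2 * ∫ x, inner ℝ (u x) (u x)

/-- The Hessian of `R` at `p`, as a linear map of `ℝ²`. -/
def hessian (R : Plane → ℝ) (p : Plane) : Plane →L[ℝ] Plane := fderiv ℝ (gradient R) p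

/-- `𝓜φ + cφ - ∇R(φ) + A = 0`. -/
def IsTravellingWave (R : Plane → ℝ) (m : ℤ → Matrix (Fin 2) (Fin 2) ℝ) (c : ℝ) (A : Plane)
    (φ : SmoothPer L) : Prop :=
  IsDispersion m φ fun x => gradient R (φ x) - c • φ x - A

/-- `f` lies in the domain `H^s × H^s` of `𝓛 = 𝓜 + c Id - Hess R(φ)` and `𝓛 f = μ f`. -/
def SatisfiesEigen (R : Plane → ℝ) (m : ℤ → Matrix (Fin 2) (Fin 2) ℝ) (s c : ℝ) (φ : SmoothPer L)
    (μ : ℝ) (f : L2per L) : Prop :=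
  InSobolev s (f : AddCircle L → Plane) ∧
    IsDispersion m f fun x => μ • f x - c • f x + hessian R (φ x) (f x)

/-- `μ` is a simple eigenvalue of `𝓛` with eigenfunction `χ`. -/
def IsSimpleEigen (R : Plane → ℝ) (m : ℤ → Matrix (Fin 2) (Fin 2) ℝ) (s c : ℝ) (φ : SmoothPer L)
    (μ : ℝ) (χ : L2per L) : Prop :=
  χ ≠ 0 ∧ SatisfiesEigen R m s c φ μ χ ∧
    ∀ f, SatisfiesEigen R m s c φ μ f → ∃ a : ℝ, f = a • χ

/-- `𝓛` has exactly one negative eigenvalue, which is simple, and zero is a simple eigenvalue with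
eigenfunction `φ'`. -/
def SpectralCondition (R : Plane → ℝ) (m : ℤ → Matrix (Fin 2) (Fin 2) ℝ) (s c : ℝ)
    (φ : SmoothPer L) : Prop :=
  (∃ μ₀ : ℝ, μ₀ < 0 ∧ (∃ χ, IsSimpleEigen R m s c φ μ₀ χ) ∧
    ∀ μ : ℝ, μ < 0 → ∀ f, f ≠ 0 → SatisfiesEigen R m s c φ μ f → μ = μ₀) ∧
  IsSimpleEigen R m s c φ 0 φ.deriv.toL2

/-- The form `⟨𝓛f, g⟩` of the linearized operator `𝓛 = 𝓜 + c Id - Hess R(φ)` on the energy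
space. -/
def linForm (R : Plane → ℝ) (m : ℤ → Matrix (Fin 2) (Fin 2) ℝ) (c : ℝ) (φ : SmoothPer L)
    (f g : AddCircle L → Plane) : ℝ :=
  dispersionForm m f g + c * (∫ x, inner ℝ (f x) (g x))
    - ∫ x, inner ℝ (hessian R (φ x) (f x)) (g x)

end Operators

/-! ### The flow and orbital stability -/

section Flow

variable {L : ℝ} [Fact (0 < L)]

/-- `u ∈ C([0,∞); H^{s/2} × H^{s/2})` is a global solution of `∂ₜu + ∂ₓ(∇R(u) - 𝓜u) = 0`, in the
weak form
`⟨u(t),η⟩ - ⟨u(0),η⟩ = ∫₀ᵗ ⟨∇R(u(τ)) - 𝓜u(τ), η'⟩ dτ` for all `t ≥ 0` and smooth periodic `η`. -/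
structure IsGlobalSolution (R : Plane → ℝ) (m : ℤ → Matrix (Fin 2) (Fin 2) ℝ) {s : ℝ}
    (u : ℝ → Hper L (s / 2)) : Prop where
  continuousOn : ContinuousOn u (Ici 0)
  integrable : ∀ t, 0 ≤ t → Integrable fun x => gradient R (u t x)
  intervalIntegrable : ∀ (η : SmoothPer L) (t : ℝ), 0 ≤ t → IntervalIntegrable
    (fun τ => (∫ x, inner ℝ (gradient R (u τ x)) (η.deriv x)) - dispersionForm m (u τ) η.deriv)
    volume 0 t
  weak : ∀ (η : SmoothPer L) (t : ℝ), 0 ≤ t →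
    (∫ x, inner ℝ (u t x) (η x)) - (∫ x, inner ℝ (u 0 x) (η x)) =
      ∫ τ in (0 : ℝ)..t,
        ((∫ x, inner ℝ (gradient R (u τ x)) (η.deriv x)) - dispersionForm m (u τ) η.deriv)

/-- A flow of the Cauchy problem on the energy space: it assigns to every initial datum `u₀` a
global solution `t ↦ S t u₀`. When the Cauchy problem is globally well-posed, `S t u₀` is the
value at time `t` of the solution with initial datum `u₀`. -/
structure GlobalFlow (R : Plane → ℝ) (m : ℤ → Matrix (Fin 2) (Fin 2) ℝ) (L : ℝ) [Fact (0 < L)]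
    (s : ℝ) where
  toFun : ℝ → Hper L (s / 2) → Hper L (s / 2)
  initial : ∀ u₀, toFun 0 u₀ = u₀
  solution : ∀ u₀, IsGlobalSolution R m fun t => toFun t u₀

variable {R : Plane → ℝ} {m : ℤ → Matrix (Fin 2) (Fin 2) ℝ} {s : ℝ}

/-- The functional `Q` is constant along the flow. -/
def GlobalFlow.Conserves (S : GlobalFlow R m L s) (Q : Hper L (s / 2) → ℝ) : Prop :=
  ∀ u₀ t, 0 ≤ t → Q (S.toFun t u₀) = Q u₀

/-- Orbital stability of `φ` in the energy space by the flow: for data close to `φ` the solution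
exists globally and stays close to the orbit of `φ` under translations. -/
def GlobalFlow.OrbitallyStable (S : GlobalFlow R m L s) (φ : Hper L (s / 2)) : Prop :=
  ∀ ε > 0, ∃ δ > 0, ∀ u₀ : Hper L (s / 2), ‖u₀ - φ‖ < δ →
    IsGlobalSolution R m (fun t => S.toFun t u₀) ∧ S.toFun 0 u₀ = u₀ ∧
      ∀ t, 0 ≤ t → rho (S.toFun t u₀) φ < ε

end Flow

end DispersiveSystem

end

noncomputable section

/-! The proof is a Lyapunov argument. Testing the weak equation with constants shows that means are
conserved, so the action G = E + cF + ∫⟨u,A⟩ is conserved; it is translation invariant, has φ as a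
critical point, and its second variation there is the form B of 𝓛. This form has one negative
direction, so G alone does not control the distance to the orbit. The conserved functional Q
supplies the missing constraint: V = G + (N/2)(Q - Q(φ))² has second variation B(v,v) + N B(Φ,v)² at
φ, and only first order differentiability of Q is needed for this.

Since B has a single negative direction and B(Φ,Φ) < 0, B is nonnegative on {v : B(Φ,v) = 0};
otherwise B would be negative definite on a plane, which meets the orthogonal complement of the
ground state (`nonneg_of_orthogonal_ground_state`). A large enough N then makes the penalized form
nonnegative with kernel spanned by φ', and Gårding's inequality modulo finitely many Fourier modes
upgrades positivity off φ' to coercivity in X (`coercive_of_nonneg`, `exists_coercive_penalization`,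
`linearizedForm_garding`).

Hence V - V(φ) dominates the squared distance to φ on small perturbations orthogonal to φ'
(`HasCriticalExpansion.exists_quadratic_lower_bound`). A translate of u(t) chosen to realise the
distance to the orbit differs from φ by such a perturbation (`SmoothPer.exists_rho_eq`). As V is
conserved and continuous at φ, and the distance to the orbit is continuous in time, the distance
cannot reach ε when it starts small (`GlobalFlow.orbitallyStable_of_lyapunov`).

The delicate point is the expansion of ∫R(u). For s > 1 the space X embeds in L^∞ and pointwise
Taylor suffices; for s ≤ 1 the functional is C² by hypothesis and its derivatives are identified on
the dense subspace of bounded functions (`exists_taylor_nonlinearity`). -/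

namespace DispersiveSystem

/-! ### Symmetric forms with one negative direction: coercivity after penalization -/

section Abstract

variable {X : Type*} [NormedAddCommGroup X] [NormedSpace ℝ X]

/-- The equality case of Cauchy–Schwarz: P(tv + w, tv + w) is affine in t and bounded below, so its
slope vanishes. -/
lemma form_eq_zero_of_nonneg (P : X →L[ℝ] X →L[ℝ] ℝ) (hsymm : ∀ u v, P u v = P v u)
    (Y : Submodule ℝ X) (hnn : ∀ v ∈ Y, 0 ≤ P v v) {v : X} (hv : v ∈ Y) (h0 : P v v = 0) :
    ∀ w ∈ Y, P v w = 0 := by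
  intro w hw
  have key : ∀ t : ℝ, 0 ≤ 2 * t * P v w + P w w := by
    intro t
    have h := hnn (t • v + w) (Y.add_mem (Y.smul_mem t hv) hw)
    simp only [map_add, map_smul, add_apply, smul_apply, smul_eq_mul, h0] at h
    rw [hsymm w v] at h
    linarith
  by_contra hne
  -- This t brings the affine function down to -1.
  have h := key (-(P w w + 1) / (2 * P v w))
  have e : 2 * (-(P w w + 1) / (2 * P v w)) * P v w = -(P w w + 1) := by
    field_simp
  rw [e] at h
  linarith

/-- A nonnegative form with a Gårding inequality and trivial kernel is coercive. -/
lemma coercive_of_nonneg [CompleteSpace X] {W : Type*} [NormedAddCommGroup W] [NormedSpace ℝ W]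
    [FiniteDimensional ℝ W] (P : X →L[ℝ] X →L[ℝ] ℝ) (hsymm : ∀ u v, P u v = P v u)
    (Y : Submodule ℝ X) (hY : IsClosed (Y : Set X)) (π : X →L[ℝ] W) {α C : ℝ} (hα : 0 < α)
    (hC : 0 ≤ C)
    (hG : ∀ v, α * ‖v‖ ^ 2 - C * ‖π v‖ ^ 2 ≤ P v v) (hnn : ∀ v ∈ Y, 0 ≤ P v v)
    (hker : ∀ v ∈ Y, (∀ w ∈ Y, P v w = 0) → v = 0) :
    ∃ δ > 0, ∀ v ∈ Y, δ * ‖v‖ ^ 2 ≤ P v v := by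
  by_contra! hcon
  have hseq : ∀ n : ℕ, ∃ v ∈ Y, ‖v‖ = 1 ∧ P v v < 1 / ((n : ℝ) + 1) := by
    intro n
    obtain ⟨v, hv, hlt⟩ := hcon (1 / ((n : ℝ) + 1)) (by positivity)
    have hv0 : v ≠ 0 := by
      rintro rfl
      simp at hlt
    have hn : 0 < ‖v‖ := norm_pos_iff.2 hv0
    refine ⟨‖v‖⁻¹ • v, Y.smul_mem _ hv, by rw [norm_smul, norm_inv, norm_norm, inv_mul_cancel₀ hn.ne'], ?_⟩
    simp only [map_smul, smul_apply, smul_eq_mul]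
    rw [← mul_assoc, ← pow_two, inv_pow, inv_mul_lt_iff₀ (by positivity)]
    linarith
  choose x hxY hx1 hxP using hseq
  have hbd : ∀ n, π (x n) ∈ Metric.closedBall (0 : W) ‖π‖ := fun n => by
    have := π.le_opNorm (x n)
    rw [hx1, mul_one] at this
    simpa using this
  have : ProperSpace W := FiniteDimensional.proper ℝ W
  -- `W` is finite dimensional, so the defect term in Gårding's inequality is compact: π(x_n)
  -- converges along a subsequence.
  obtain ⟨a, -, σ, hσ, hlim⟩ := (isCompact_closedBall (0 : W) ‖π‖).tendsto_subseq hbd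
  have hP0 : Tendsto (fun n => P (x (σ n)) (x (σ n))) atTop (𝓝 0) := by
    refine squeeze_zero (fun n => hnn _ (hxY _)) (fun n => (hxP (σ n)).le) ?_
    exact tendsto_one_div_add_atTop_nhds_zero_nat.comp hσ.tendsto_atTop
  have hcau : CauchySeq (fun n => x (σ n)) := by
    have hπ := hlim.cauchySeq
    rw [Metric.cauchySeq_iff] at hπ ⊢
    intro ε hε
    have hη : 0 < α * ε ^ 2 / 8 := by positivity
    obtain ⟨N1, hN1⟩ := eventually_atTop.1 (hP0.eventually_lt_const hη)
    set θ := Real.sqrt (α * ε ^ 2 / (4 * (C + 1))) with hθ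
    have hθ0 : 0 < θ := Real.sqrt_pos.2 (by positivity)
    have hθ2 : θ ^ 2 = α * ε ^ 2 / (4 * (C + 1)) := Real.sq_sqrt (by positivity)
    obtain ⟨N2, hN2⟩ := hπ θ hθ0
    refine ⟨max N1 N2, fun p hp q hq => ?_⟩
    have hp1 := hN1 p (le_trans (le_max_left _ _) hp)
    have hq1 := hN1 q (le_trans (le_max_left _ _) hq)
    have h2 := hN2 p (le_trans (le_max_right _ _) hp) q (le_trans (le_max_right _ _) hq)
    rw [dist_eq_norm] at h2 ⊢
    simp only [Function.comp] at h2
    rw [← map_sub] at h2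
    set y := x (σ p)
    set z := x (σ q)
    -- Parallelogram law: P(y+z) ≥ 0 gives P(y-z) ≤ 2P(y) + 2P(z) < αε²/2. With the defect at most
    -- αε²/4 this leaves α‖y-z‖² < αε², so the minimizing sequence converges strongly.
    have hsum := hnn (y + z) (Y.add_mem (hxY _) (hxY _))
    have hdiff := hG (y - z)
    have hC1 : C * ‖π (y - z)‖ ^ 2 ≤ α * ε ^ 2 / 4 := by
      have : ‖π (y - z)‖ ^ 2 ≤ θ ^ 2 := by gcongr
      calc C * ‖π (y - z)‖ ^ 2 ≤ (C + 1) * θ ^ 2 := by gcongr; linarith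
        _ = α * ε ^ 2 / 4 := by rw [hθ2]; field_simp
    simp only [map_add, map_sub, add_apply, sub_apply] at hsum hdiff hp1 hq1 hC1
    rw [hsymm z y] at hsum hdiff
    have : α * ‖y - z‖ ^ 2 < α * ε ^ 2 := by nlinarith [mul_pos hα (pow_pos hε 2)]
    exact lt_of_pow_lt_pow_left₀ 2 hε.le (lt_of_mul_lt_mul_left this hα.le)
  obtain ⟨v, hv⟩ := cauchySeq_tendsto_of_complete hcau
  have hvY : v ∈ Y := hY.mem_of_tendsto hv (Eventually.of_forall fun n => hxY _)
  have hv1 : ‖v‖ = 1 := tendsto_nhds_unique hv.norm (by simp [hx1])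
  have hPc : Continuous fun v => P v v := P.continuous.clm_apply continuous_id
  have hv0 : P v v = 0 := tendsto_nhds_unique ((hPc.tendsto v).comp hv) hP0
  have := hker v hvY (form_eq_zero_of_nonneg P hsymm Y hnn hvY hv0)
  rw [this] at hv1
  simp at hv1

/-- If a symmetric form `B` has exactly one negative eigenvalue relative to `J`, and it is simple, then `B` is
nonnegative on the `J`-orthogonal complement of the corresponding eigenvector. -/
lemma nonneg_of_orthogonal_ground_state [CompleteSpace X] {W : Type*} [NormedAddCommGroup W]
    [NormedSpace ℝ W] [FiniteDimensional ℝ W] (B J : X →L[ℝ] X →L[ℝ] ℝ)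
    (hB : ∀ u v, B u v = B v u) (hJ : ∀ u v, J u v = J v u) (hJpos : ∀ v, v ≠ 0 → 0 < J v v)
    (π : X →L[ℝ] W) {α C K : ℝ} (hα : 0 < α) (hC : 0 ≤ C)
    (hG : ∀ v, α * ‖v‖ ^ 2 - C * ‖π v‖ ^ 2 ≤ B v v) (hK : ∀ v, -K * J v v ≤ B v v)
    {μ₀ : ℝ} {χ : X} (hχ0 : χ ≠ 0) (hχ : ∀ w, B χ w = μ₀ * J χ w)
    (huniq : ∀ μ < 0, ∀ v, v ≠ 0 → (∀ w, B v w = μ * J v w) → ∃ a : ℝ, v = a • χ)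
    {v : X} (hv : J χ v = 0) : 0 ≤ B v v := by
  have hJnn : ∀ v, 0 ≤ J v v := fun v => by
    rcases eq_or_ne v 0 with rfl | h
    · simp
    · exact (hJpos v h).le
  by_contra! hneg
  -- Rayleigh quotients are minimised on the J-orthogonal complement of χ. A negative infimum `l`
  -- would be a second negative eigenvalue or a second eigenvector.
  set Y : Submodule ℝ X := LinearMap.ker (J χ : X →ₗ[ℝ] ℝ) with hYdef
  have hmem : ∀ w, w ∈ Y ↔ J χ w = 0 := fun w => LinearMap.mem_ker
  have hYc : IsClosed (Y : Set X) := (J χ).isClosed_ker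
  set s : Set ℝ := {q | ∃ w ∈ Y, w ≠ 0 ∧ q = B w w / J w w}
  have hv0 : v ≠ 0 := by
    rintro rfl
    simp at hneg
  have hvs : B v v / J v v ∈ s := ⟨v, (hmem v).2 hv, hv0, rfl⟩
  have hsb : BddBelow s := by
    refine ⟨-K, ?_⟩
    rintro q ⟨w, -, hw, rfl⟩
    rw [le_div_iff₀ (hJpos w hw)]
    exact hK w
  set l := sInf s
  have hl : l < 0 := (csInf_le hsb hvs).trans_lt (div_neg_of_neg_of_pos hneg (hJpos v hv0))
  have hlle : ∀ w ∈ Y, l * J w w ≤ B w w := by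
    intro w hw
    rcases eq_or_ne w 0 with rfl | hw0
    · simp
    rw [← le_div_iff₀ (hJpos w hw0)]
    exact csInf_le hsb ⟨w, hw, hw0, rfl⟩
  set P : X →L[ℝ] X →L[ℝ] ℝ := B - l • J
  have hPa : ∀ u w, P u w = B u w - l * J u w := fun u w => rfl
  -- P = B - lJ is nonnegative on Y. Without kernel it is coercive there, so the infimum `l` could
  -- be raised; with kernel, `l` is attained by an eigenvector.
  by_cases hker : ∀ v ∈ Y, (∀ w ∈ Y, P v w = 0) → v = 0
  · obtain ⟨δ, hδ, hco⟩ := coercive_of_nonneg P (fun u v => by rw [hPa, hPa, hB, hJ]) Y hYc π hα hC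
      -- Since l < 0, the term -lJ is nonnegative and Gårding's inequality for B passes to P.
      (fun w => by
        rw [hPa]
        nlinarith [hG w, hJnn w])
      (fun w hw => by
        rw [hPa]
        linarith [hlle w hw]) hker
    have hJb : ∀ w, J w w ≤ (‖J‖ + 1) * ‖w‖ ^ 2 := fun w => by
      have := (le_abs_self _).trans (J.le_opNorm₂ w w)
      nlinarith [sq_nonneg ‖w‖]
    have hlow : l + δ / (‖J‖ + 1) ≤ l := by
      refine le_csInf ⟨_, hvs⟩ ?_
      rintro q ⟨w, hw, hw0, rfl⟩
      rw [le_div_iff₀ (hJpos w hw0)]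
      have h1 := hco w hw
      rw [hPa] at h1
      have h2 : δ / (‖J‖ + 1) * J w w ≤ δ * ‖w‖ ^ 2 := by
        calc δ / (‖J‖ + 1) * J w w ≤ δ / (‖J‖ + 1) * ((‖J‖ + 1) * ‖w‖ ^ 2) := by
              gcongr
              exact hJb w
          _ = δ * ‖w‖ ^ 2 := by field_simp
      linarith
    have : 0 < δ / (‖J‖ + 1) := by positivity
    linarith
  · push Not at hker
    obtain ⟨z, hzY, hz, hz0⟩ := hker
    have hJχ := hJpos χ hχ0
    have hzχ := (hmem z).1 hzY
    -- The relation is known only against Y. It extends to Y ⊕ ℝχ = X because B(z,χ) = μ₀J(z,χ) = 0.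
    have hweak : ∀ w, B z w = l * J z w := by
      intro w
      set t := J χ w / J χ χ
      have h1 : w - t • χ ∈ Y := by
        rw [hmem, map_sub, map_smul, smul_eq_mul, div_mul_cancel₀ _ hJχ.ne', sub_self]
      have h2 := hz _ h1
      have h3 : B z χ = 0 := by rw [hB, hχ, hzχ, mul_zero]
      have h4 : J z χ = 0 := by rw [hJ, hzχ]
      rw [hPa, map_sub, map_sub, map_smul, map_smul, h3, h4] at h2
      simp only [smul_zero, sub_zero] at h2
      linarith
    obtain ⟨a, rfl⟩ := huniq l hl z hz0 hweak
    rw [map_smul, smul_eq_mul] at hzχ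
    rcases mul_eq_zero.1 hzχ with h | h
    · simp [h] at hz0
    · exact hJχ.ne' h

/-- Coercivity of `B + N B(Φ,·)²` transversally to the kernel of `B`. -/
lemma exists_coercive_penalization [CompleteSpace X] {W : Type*} [NormedAddCommGroup W]
    [NormedSpace ℝ W] [FiniteDimensional ℝ W] (B J : X →L[ℝ] X →L[ℝ] ℝ)
    (hB : ∀ u v, B u v = B v u) (hJ : ∀ u v, J u v = J v u) (hJpos : ∀ v, v ≠ 0 → 0 < J v v)
    (π : X →L[ℝ] W) {α C K : ℝ} (hα : 0 < α) (hC : 0 ≤ C)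
    (hG : ∀ v, α * ‖v‖ ^ 2 - C * ‖π v‖ ^ 2 ≤ B v v) (hK : ∀ v, -K * J v v ≤ B v v)
    {μ₀ : ℝ} {χ : X} (hχ0 : χ ≠ 0) (hχ : ∀ w, B χ w = μ₀ * J χ w)
    (huniq : ∀ μ < 0, ∀ v, v ≠ 0 → (∀ w, B v w = μ * J v w) → ∃ a : ℝ, v = a • χ)
    {ψ : X} (hker : ∀ v, (∀ w, B v w = 0) → ∃ a : ℝ, v = a • ψ)
    {Φ : X} (hΦ : B Φ Φ < 0) (l : X →L[ℝ] ℝ) (hl : l ψ ≠ 0) :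
    ∃ N δ : ℝ, 0 < δ ∧ ∀ v, l v = 0 → δ * ‖v‖ ^ 2 ≤ B v v + N * (B Φ v) ^ 2 := by
  -- If B(w,w) < 0, then v = w - tΦ with t chosen so that J(χ,v) = 0 has B(v,v) = B(w,w) + t²B(Φ,Φ)
  -- < 0, contradicting nonnegativity on the complement of χ.
  have hnn1 : ∀ w, B Φ w = 0 → 0 ≤ B w w := by
    intro w hw
    by_contra! hneg
    have hJΦ : J χ Φ ≠ 0 := fun h => (nonneg_of_orthogonal_ground_state B J hB hJ hJpos π hα hC hG
      hK hχ0 hχ huniq h).not_gt hΦ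
    have h := nonneg_of_orthogonal_ground_state B J hB hJ hJpos π hα hC hG hK hχ0 hχ huniq
      (v := w - (J χ w / J χ Φ) • Φ) (by
        rw [map_sub, map_smul, smul_eq_mul, div_mul_cancel₀ _ hJΦ, sub_self])
    simp only [map_sub, map_smul, sub_apply, smul_apply, smul_eq_mul, hw, hB w Φ] at h
    nlinarith [sq_nonneg (J χ w / J χ Φ)]
  set d := -B Φ Φ with hd
  have hd0 : 0 < d := by linarith
  -- Split off the B-orthogonal projection of v onto Φ; the remainder has nonnegative energy.
  have hlow : ∀ v, -((B Φ v) ^ 2 / d) ≤ B v v := by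
    intro v
    have h := hnn1 (v - (B Φ v / B Φ Φ) • Φ) (by
      rw [map_sub, map_smul, smul_eq_mul, div_mul_cancel₀ _ hΦ.ne, sub_self])
    simp only [map_sub, map_smul, sub_apply, smul_apply, smul_eq_mul, hB v Φ] at h
    have e : B Φ v / B Φ Φ * B Φ Φ = B Φ v := div_mul_cancel₀ _ hΦ.ne
    rw [e] at h
    have e2 : (B Φ v) ^ 2 / d = -(B Φ v / B Φ Φ * B Φ v) := by
      rw [hd]
      field_simp
    rw [e2]
    linarith
  -- The weight 1/d would only restore nonnegativity. Doubling it leaves a surplus B(Φ,v)²/d, which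
  -- forces B(Φ,v) = 0 on null vectors.
  set P : X →L[ℝ] X →L[ℝ] ℝ := B + (2 / d) • (B Φ).smulRight (B Φ)
  have hPa : ∀ u w, P u w = B u w + 2 / d * (B Φ u * B Φ w) := fun u w => rfl
  have hPlow : ∀ v, (B Φ v) ^ 2 / d ≤ P v v := by
    intro v
    have e : 2 / d * (B Φ v * B Φ v) = 2 * ((B Φ v) ^ 2 / d) := by ring
    rw [hPa, e]
    linarith [hlow v]
  have hsymm : ∀ u v, P u v = P v u := fun u v => by rw [hPa, hPa, hB u v]; ring
  have hPnn : ∀ v, 0 ≤ P v v := fun v => le_trans (by positivity) (hPlow v)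
  obtain ⟨δ, hδ, hco⟩ := coercive_of_nonneg P hsymm (LinearMap.ker (l : X →ₗ[ℝ] ℝ)) l.isClosed_ker π
    hα hC (fun v => by
      have : 0 ≤ 2 / d * (B Φ v * B Φ v) := mul_nonneg (by positivity) (mul_self_nonneg _)
      rw [hPa]
      linarith [hG v]) (fun v _ => hPnn v) (by
      intro v hv hPv
      have hv' : l v = 0 := hv
      have hvv := hPv v hv
      -- P is nonnegative on the whole space, so a null vector pairs to zero with every w, not only
      -- those in ker l. Hence v lies in the kernel of B.
      have hall : ∀ w, P v w = 0 := fun w =>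
        form_eq_zero_of_nonneg P hsymm ⊤ (fun v _ => hPnn v) (by trivial) hvv w (by trivial)
      have hΦv : B Φ v = 0 := by
        have h := hPlow v
        rw [hvv, div_le_iff₀ hd0, zero_mul] at h
        exact pow_eq_zero_iff (two_ne_zero) |>.1 (le_antisymm h (sq_nonneg _))
      obtain ⟨a, rfl⟩ := hker v (fun w => by
        have := hall w
        rw [hPa, hΦv] at this
        simpa using this)
      rw [map_smul, smul_eq_mul] at hv'
      rcases mul_eq_zero.1 hv' with h | h
      · simp [h]
      · exact absurd h hl)
  refine ⟨2 / d, δ, hδ, fun v hv => ?_⟩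
  have := hco v hv
  rw [hPa] at this
  rw [pow_two]
  linarith

end Abstract

/-! ### Second order Taylor estimates, pointwise and uniform -/

section Taylor

variable {E : Type*} [NormedAddCommGroup E] [NormedSpace ℝ E]

/-- Second order Taylor estimate, from a first order estimate for the derivative. -/
lemma taylor_two_of_fderiv {f : E → ℝ} {f' : E → E →L[ℝ] ℝ} {H : E →L[ℝ] E →L[ℝ] ℝ}
    {p : E} {δ ε : ℝ}
    (hf : ∀ w, ‖w‖ < δ → HasFDerivAt f (f' (p + w)) (p + w))
    (hf' : ∀ w, ‖w‖ < δ → ‖f' (p + w) - f' p - H w‖ ≤ ε * ‖w‖) {w : E} (hw : ‖w‖ < δ) :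
    |f (p + w) - f p - f' p w - 1 / 2 * H w w| ≤ ε * ‖w‖ ^ 2 := by
  have hlt : ∀ t ∈ Icc (0 : ℝ) 1, ‖t • w‖ < δ := fun t ht => by
    rw [norm_smul, Real.norm_of_nonneg ht.1]
    exact (mul_le_of_le_one_left (norm_nonneg _) ht.2).trans_lt hw
  -- The mean value inequality on [0,1] is applied to the Taylor remainder along the segment.
  have hd : ∀ t ∈ Icc (0 : ℝ) 1, HasDerivWithinAt
      (fun t : ℝ => f (p + t • w) - t * f' p w - t ^ 2 * (1 / 2 * H w w))
      ((f' (p + t • w) - f' p - H (t • w)) w) (Icc 0 1) t := by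
    intro t ht
    have h1 : HasDerivAt (fun t : ℝ => p + t • w) w t := by
      simpa using ((hasDerivAt_id t).smul_const w).const_add p
    have h2 := (hf _ (hlt t ht)).comp_hasDerivAt t h1
    have h3 := (h2.sub ((hasDerivAt_id t).mul_const (f' p w))).sub
      (((hasDerivAt_id t).pow 2).mul_const (1 / 2 * H w w))
    refine (h3.congr_deriv ?_).hasDerivWithinAt
    simp
    ring
  have hb : ∀ t ∈ Icc (0 : ℝ) 1, ‖(f' (p + t • w) - f' p - H (t • w)) w‖ ≤ ε * ‖w‖ ^ 2 := by
    intro t ht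
    have h0 : ‖f' (p + t • w) - f' p - H (t • w)‖ ≤ ε * ‖w‖ := by
      refine (hf' _ (hlt t ht)).trans ?_
      have hε : 0 ≤ ε * ‖w‖ := (norm_nonneg _).trans (hf' w hw)
      rw [norm_smul, Real.norm_of_nonneg ht.1]
      nlinarith [ht.2, ht.1]
    calc _ ≤ ‖f' (p + t • w) - f' p - H (t • w)‖ * ‖w‖ := ContinuousLinearMap.le_opNorm _ _
      _ ≤ ε * ‖w‖ * ‖w‖ := by gcongr
      _ = _ := by ring
  have h := (convex_Icc (0 : ℝ) 1).norm_image_sub_le_of_norm_hasDerivWithin_le hd hb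
    (left_mem_Icc.2 zero_le_one) (right_mem_Icc.2 zero_le_one)
  simp only [one_smul, zero_smul, add_zero, sub_zero, norm_one, mul_one, Real.norm_eq_abs] at h
  convert h using 2
  ring

lemma ContDiffAt.taylor_two {f : E → ℝ} {p : E} (hf : ContDiffAt ℝ 2 f p) {ε : ℝ} (hε : 0 < ε) :
    ∃ δ > 0, ∀ w, ‖w‖ < δ →
      |f (p + w) - f p - fderiv ℝ f p w - 1 / 2 * fderiv ℝ (fderiv ℝ f) p w w| ≤ ε * ‖w‖ ^ 2 := by
  have h1 : ∀ᶠ x in 𝓝 p, DifferentiableAt ℝ f x := by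
    filter_upwards [hf.eventually (by simp)] with x hx
    exact hx.differentiableAt (by simp)
  have h2 : DifferentiableAt ℝ (fderiv ℝ f) p :=
    (hf.fderiv_right (m := 1) (by norm_num)).differentiableAt (by simp)
  have h3 := h2.hasFDerivAt.isLittleO.def hε
  obtain ⟨δ, hδ, hb⟩ := Metric.eventually_nhds_iff.1 (h1.and h3)
  have hin : ∀ w : E, ‖w‖ < δ → dist (p + w) p < δ := fun w hw => by simpa [dist_eq_norm] using hw
  refine ⟨δ, hδ, fun w hw => taylor_two_of_fderiv
    (fun w hw => (hb (hin w hw)).1.hasFDerivAt) (fun w hw => ?_) hw⟩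
  simpa using (hb (hin w hw)).2

/-- Second order Taylor expansion of a `C²` function, uniform over a compact set of base points. -/
lemma ContDiff.taylor_two_uniform [ProperSpace E] {f : E → ℝ} (hf : ContDiff ℝ 2 f) {K : Set E}
    (hK : IsCompact K) {ε : ℝ} (hε : 0 < ε) :
    ∃ δ > 0, ∀ p ∈ K, ∀ w, ‖w‖ < δ →
      |f (p + w) - f p - fderiv ℝ f p w - 1 / 2 * fderiv ℝ (fderiv ℝ f) p w w| ≤ ε * ‖w‖ ^ 2 := by
  have hd1 : ContDiff ℝ 1 (fderiv ℝ f) := hf.fderiv_right (by norm_num)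
  have hd2 : Continuous (fderiv ℝ (fderiv ℝ f)) := hd1.continuous_fderiv (by simp)
  -- The closed 1-thickening is still compact, so the second derivative is uniformly continuous near
  -- K and not only on it.
  have hK' : IsCompact (Metric.cthickening 1 K) := hK.cthickening
  have huc := hK'.uniformContinuousOn_of_continuous hd2.continuousOn
  obtain ⟨δ, hδ, hb⟩ : ∃ δ > 0, ∀ x ∈ Metric.cthickening 1 K, ∀ y ∈ Metric.cthickening 1 K,
      dist x y < δ → dist (fderiv ℝ (fderiv ℝ f) x) (fderiv ℝ (fderiv ℝ f) y) < ε := by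
    refine (@Metric.uniformContinuousOn_iff E (E →L[ℝ] E →L[ℝ] ℝ) _ _ _ _).1 ?_ ε hε
    exact huc
  refine ⟨min δ 1, by positivity, fun p hp w hw => ?_⟩
  refine taylor_two_of_fderiv (f' := fderiv ℝ f) (H := fderiv ℝ (fderiv ℝ f) p)
    (fun w _ => (hf.differentiable (by simp) _).hasFDerivAt) (fun w hw => ?_) hw
  have hball : ∀ x ∈ Metric.ball p (min δ 1), ‖fderiv ℝ (fderiv ℝ f) x - fderiv ℝ (fderiv ℝ f) p‖ ≤ ε := by
    intro x hx
    refine (dist_eq_norm (fderiv ℝ (fderiv ℝ f) x) (fderiv ℝ (fderiv ℝ f) p)).symm.le.trans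
      (hb x (Metric.mem_cthickening_of_dist_le x p 1 K hp ?_) p
      (Metric.self_subset_cthickening K hp) ?_).le
    · exact (lt_of_lt_of_le hx (min_le_right _ _)).le
    · exact lt_of_lt_of_le hx (min_le_left _ _)
  have h := (convex_ball p (min δ 1)).norm_image_sub_le_of_norm_hasFDerivWithin_le'
    (f := fderiv ℝ f) (φ := fderiv ℝ (fderiv ℝ f) p)
    (fun x _ => ((hd1.differentiable (by simp)) x).hasFDerivAt.hasFDerivWithinAt) hball
    (x := p) (y := p + w) (Metric.mem_ball_self (by positivity)) (by simpa [dist_eq_norm] using hw)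
  simpa using h

end Taylor

/-! ### Real trigonometric monomials as test functions -/

section Mode

variable {L : ℝ}

/-- The real trigonometric monomial `x ↦ Re (b e^{2πiκx/L})`. -/
def mode (L : ℝ) (κ : ℤ) (b : Fin 2 → ℂ) : SmoothPer L where
  toFun x := WithLp.toLp 2 fun i => (b i * fourier κ x).re
  smooth := by
    rw [contDiff_euclidean]
    intro i
    have h : ContDiff ℝ ∞ fun x : ℝ => b i * fourier κ (x : AddCircle L) := by
      simp only [fourier_coe_apply]
      refine contDiff_const.mul (Complex.contDiff_exp.comp ?_)
      exact (contDiff_const.mul Complex.ofRealCLM.contDiff).div_const _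
    exact Complex.reCLM.contDiff.comp h

lemma mode_apply (κ : ℤ) (b : Fin 2 → ℂ) (x : AddCircle L) (i : Fin 2) :
    mode L κ b x i = (b i * fourier κ x).re := rfl

end Mode

/-! ### Parseval's identity and testing with trigonometric monomials -/

section FourierSide

variable {L : ℝ} [Fact (0 < L)]

lemma fcoef_neg_index (f : AddCircle L → Plane) (κ : ℤ) (i : Fin 2) :
    fcoef f (-κ) i = starRingEnd ℂ (fcoef f κ i) := by
  unfold fcoef fourierCoeff
  rw [← integral_conj]
  congr 1
  funext x
  rw [smul_eq_mul, smul_eq_mul, map_mul, ← fourier_neg, Complex.conj_ofReal]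

/-- Parseval's identity. -/
lemma hasSum_fcoef_mul_conj {f g : AddCircle L → Plane} (hf : MemLp f 2) (hg : MemLp g 2) :
    HasSum (fun κ : ℤ => ∑ i, (fcoef f κ i * starRingEnd ℂ (fcoef g κ i)).re)
      (L⁻¹ * ∫ x, inner ℝ (f x) (g x)) := by
  have hcomp : ∀ {f : AddCircle L → Plane}, MemLp f 2 → ∀ i : Fin 2,
      MemLp (fun x => ((f x i : ℝ) : ℂ)) 2 AddCircle.haarAddCircle := fun hf i =>
    memLp_haarAddCircle_iff.2 ((EuclideanSpace.proj (𝕜 := ℝ) i).comp_memLp' hf).ofReal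
  have hi : ∀ i, HasSum (fun κ : ℤ => (fcoef f κ i * starRingEnd ℂ (fcoef g κ i)).re)
      (L⁻¹ * ∫ x, f x i * g x i) := by
    intro i
    have h := fourierBasis.hasSum_inner_mul_inner ((hcomp hg i).toLp _) ((hcomp hf i).toLp _)
    rw [L2.inner_def] at h
    have hint : ∫ x, inner ℂ ((hcomp hg i).toLp _ x) ((hcomp hf i).toLp _ x)
        ∂AddCircle.haarAddCircle = ((L⁻¹ * ∫ x, f x i * g x i : ℝ) : ℂ) := by
      rw [Complex.ofReal_mul, ← integral_complex_ofReal, ← Complex.real_smul,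
        ← AddCircle.integral_haarAddCircle]
      refine integral_congr_ae ?_
      filter_upwards [(hcomp hg i).coeFn_toLp, (hcomp hf i).coeFn_toLp] with x h1 h2
      rw [h1, h2]
      simp
    rw [hint] at h
    have h2 := Complex.hasSum_re h
    rw [Complex.ofReal_re] at h2
    convert h2 using 2 with κ
    rw [← fourierBasis.repr_apply_apply, fourierBasis_repr, ← inner_conj_symm,
      ← fourierBasis.repr_apply_apply, fourierBasis_repr,
      fourierCoeff_congr_ae (hcomp hg i).coeFn_toLp, fourierCoeff_congr_ae (hcomp hf i).coeFn_toLp,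
      mul_comm]
    rfl
  have h := hasSum_sum (s := Finset.univ) fun i _ => hi i
  rw [← Finset.mul_sum] at h
  convert h using 2
  rw [← integral_finsetSum]
  · congr 1
    funext x
    simp only [PiLp.inner_apply, RCLike.inner_apply, conj_trivial]
    exact Finset.sum_congr rfl fun i _ => mul_comm _ _
  · intro i _
    exact ((EuclideanSpace.proj (𝕜 := ℝ) i).comp_memLp' hf).integrable_mul
      ((EuclideanSpace.proj (𝕜 := ℝ) i).comp_memLp' hg)

lemma hasSum_norm_fcoef_sq {f : AddCircle L → Plane} (hf : MemLp f 2) :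
    HasSum (fun κ : ℤ => ∑ i, ‖fcoef f κ i‖ ^ 2) (L⁻¹ * ∫ x, inner ℝ (f x) (f x)) := by
  convert hasSum_fcoef_mul_conj hf hf using 4 with κ i
  rw [Complex.mul_conj, Complex.ofReal_re, Complex.normSq_eq_norm_sq]

/-- The two contributions are added rather than separated by cases, so κ₀ = 0, where both occur and
sum to Re b, needs no special treatment. -/
lemma fcoef_mode (κ₀ : ℤ) (b : Fin 2 → ℂ) (κ : ℤ) (i : Fin 2) :
    fcoef (mode L κ₀ b) κ i = (if κ = κ₀ then b i / 2 else 0) +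
      (if κ = -κ₀ then starRingEnd ℂ (b i) / 2 else 0) := by
  have h : (fun x : AddCircle L => ((mode L κ₀ b x i : ℝ) : ℂ)) =
      (fun x => b i / 2 * fourier κ₀ x) + fun x => starRingEnd ℂ (b i) / 2 * fourier (-κ₀) x := by
    funext x
    rw [mode_apply, Pi.add_apply, fourier_neg, Complex.re_eq_add_conj, map_mul]
    ring
  have hint : ∀ (n : ℤ) (z : ℂ), Integrable (fun x : AddCircle L => z * fourier n x)
      AddCircle.haarAddCircle := fun n z =>
    (continuous_const.mul (fourier n).continuous).integrable_of_hasCompactSupport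
      (HasCompactSupport.of_compactSpace _)
  rw [fcoef, h, fourierCoeff.add (hint _ _) (hint _ _), Pi.add_apply, fourierCoeff.const_mul,
    fourierCoeff.const_mul, fourierCoeff_fourier, fourierCoeff_fourier, Pi.single_apply,
    Pi.single_apply]
  simp

/-- The `κ`-th term of the quadratic form with matrix symbol `a`. -/
def symbolTerm (a : ℤ → Matrix (Fin 2) (Fin 2) ℝ) (f g : AddCircle L → Plane) (κ : ℤ) : ℝ :=
  ∑ i, ∑ j, a κ i j * (fcoef f κ j * starRingEnd ℂ (fcoef g κ i)).re

/-- The frequencies κ₀ and -κ₀ contribute conjugate quantities, since f is real and the symbol is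
even; each carries half of the sum. -/
lemma hasSum_symbolTerm_mode {a : ℤ → Matrix (Fin 2) (Fin 2) ℝ} (ha : ∀ κ, a (-κ) = a κ)
    (f : AddCircle L → Plane) (κ₀ : ℤ) (b : Fin 2 → ℂ) :
    HasSum (symbolTerm a f (mode L κ₀ b))
      (∑ i, ∑ j, a κ₀ i j * (fcoef f κ₀ j * starRingEnd ℂ (b i)).re) := by
  have h1 := (hasSum_ite_eq κ₀ (∑ i, ∑ j, a κ₀ i j * (fcoef f κ₀ j * starRingEnd ℂ (b i)).re / 2)).add
    (hasSum_ite_eq (-κ₀) (∑ i, ∑ j, a κ₀ i j * (fcoef f κ₀ j * starRingEnd ℂ (b i)).re / 2))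
  convert h1 using 1
  · funext κ
    have hs1 : ∀ i j, κ = κ₀ → a κ i j * (fcoef f κ j * starRingEnd ℂ (b i / 2)).re =
        a κ₀ i j * (fcoef f κ₀ j * starRingEnd ℂ (b i)).re / 2 := by
      rintro i j rfl
      rw [map_div₀, ← mul_div_assoc, Complex.conj_ofNat, Complex.div_ofNat_re, mul_div_assoc]
    have hs2 : ∀ i j, κ = -κ₀ →
        a κ i j * (fcoef f κ j * starRingEnd ℂ (starRingEnd ℂ (b i) / 2)).re =
        a κ₀ i j * (fcoef f κ₀ j * starRingEnd ℂ (b i)).re / 2 := by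
      rintro i j rfl
      rw [ha, fcoef_neg_index, ← map_mul, Complex.conj_re, ← mul_div_assoc, Complex.div_ofNat_re,
        mul_div_assoc, ← Complex.conj_re (fcoef f κ₀ j * _), map_mul, Complex.conj_conj,
        ← Complex.conj_re, map_mul, Complex.conj_conj]
    unfold symbolTerm
    simp only [fcoef_mode, map_add, mul_add, Complex.add_re, Finset.sum_add_distrib]
    congr 1
    · split_ifs with h
      · exact Finset.sum_congr rfl fun i _ => Finset.sum_congr rfl fun j _ => hs1 i j h
      · simp
    · split_ifs with h
      · exact Finset.sum_congr rfl fun i _ => Finset.sum_congr rfl fun j _ => hs2 i j h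
      · simp
  · rw [← Finset.sum_add_distrib]
    refine Finset.sum_congr rfl fun i _ => ?_
    rw [← Finset.sum_add_distrib]
    exact Finset.sum_congr rfl fun j _ => (add_halves _).symm

end FourierSide

/-! ### Bounded forms given by matrix symbols, and the Hilbert structure of H^r -/

section SobolevSpace

variable {L : ℝ} [Fact (0 < L)] {r : ℝ}

namespace Hper

lemma memLp (u : Hper L r) : MemLp (u : AddCircle L → Plane) 2 := Lp.memLp u.toL2

lemma coeFn_add (u v : Hper L r) : ((u + v : Hper L r) : AddCircle L → Plane) =ᵐ[volume] u + v :=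
  Lp.coeFn_add u.toL2 v.toL2

lemma coeFn_smul (t : ℝ) (u : Hper L r) :
    ((t • u : Hper L r) : AddCircle L → Plane) =ᵐ[volume] t • (u : AddCircle L → Plane) :=
  Lp.coeFn_smul t u.toL2

lemma fcoef_add (u v : Hper L r) (κ : ℤ) (i : Fin 2) :
    fcoef (u + v : Hper L r) κ i = fcoef u κ i + fcoef v κ i := by
  rw [fcoef_congr (coeFn_add u v)]
  exact DispersiveSystem.fcoef_add (integrable_L2 _) (integrable_L2 _) κ i

lemma fcoef_smul (t : ℝ) (u : Hper L r) (κ : ℤ) (i : Fin 2) :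
    fcoef (t • u : Hper L r) κ i = t * fcoef u κ i := by
  rw [fcoef_congr (coeFn_smul t u)]
  exact DispersiveSystem.fcoef_smul t _ κ i

lemma fcoef_sub (u v : Hper L r) (κ : ℤ) (i : Fin 2) :
    fcoef (u - v : Hper L r) κ i = fcoef u κ i - fcoef v κ i := by
  rw [eq_sub_iff_add_eq, ← fcoef_add, sub_add_cancel]

lemma ext_fcoef {u v : Hper L r} (h : ∀ κ i, fcoef u κ i = fcoef v κ i) : u = v := by
  rw [← sub_eq_zero]
  refine Subtype.ext (eq_zero_of_fcoef (u - v).toL2 fun κ i => ?_)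
  have := fcoef_sub u v κ i
  rw [h, sub_self] at this
  exact this

lemma toEll2_apply (u : Hper L r) (κ : ℤ) (i : Fin 2) :
    toEll2 L r u κ i = ((1 + (κ : ℝ) ^ 2) ^ (r / 2) : ℝ) * fcoef u κ i := by
  change wcoef r u κ i = _
  simp [wcoef]

lemma weight_mul_norm_fcoef_le (u : Hper L r) (κ : ℤ) (i : Fin 2) :
    (1 + (κ : ℝ) ^ 2) ^ (r / 2) * ‖fcoef u κ i‖ ≤ ‖toEll2 L r u κ‖ := by
  have h := PiLp.norm_apply_le (toEll2 L r u κ) i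
  rw [toEll2_apply, norm_mul, Complex.norm_real, Real.norm_of_nonneg (by positivity)] at h
  exact h

lemma summable_norm_sq (u : Hper L r) :
    Summable fun κ : ℤ => (1 + (κ : ℝ) ^ 2) ^ r * ∑ i, ‖fcoef u κ i‖ ^ 2 := u.2

end Hper

/-- The entries of the matrix symbol `a` are `O((1 + κ²)^r)`. -/
def SymbolBound (r : ℝ) (a : ℤ → Matrix (Fin 2) (Fin 2) ℝ) (C : ℝ) : Prop :=
  ∀ κ i j, |a κ i j| ≤ C * (1 + (κ : ℝ) ^ 2) ^ r

variable {a : ℤ → Matrix (Fin 2) (Fin 2) ℝ} {C : ℝ}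

lemma SymbolBound.nonneg (ha : SymbolBound r a C) : 0 ≤ C := by
  have h := (abs_nonneg _).trans (ha 0 0 0)
  simpa using h

/-- The weight is shared equally between u and v; the 4 counts the matrix entries. Cauchy–Schwarz in
ℓ² then bounds the whole form. -/
lemma SymbolBound.norm_symbolTerm_le (ha : SymbolBound r a C) (u v : Hper L r) (κ : ℤ) :
    ‖symbolTerm a u v κ‖ ≤ 4 * C * (‖Hper.toEll2 L r u κ‖ * ‖Hper.toEll2 L r v κ‖) := by
  have hC := ha.nonneg
  have hw : (1 + (κ : ℝ) ^ 2) ^ r = (1 + (κ : ℝ) ^ 2) ^ (r / 2) * (1 + (κ : ℝ) ^ 2) ^ (r / 2) := by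
    rw [← Real.rpow_add (by positivity), add_halves]
  have h : ∀ i j, ‖a κ i j * (fcoef u κ j * starRingEnd ℂ (fcoef v κ i)).re‖ ≤
      C * (‖Hper.toEll2 L r u κ‖ * ‖Hper.toEll2 L r v κ‖) := by
    intro i j
    rw [norm_mul, Real.norm_eq_abs, Real.norm_eq_abs]
    have h1 : |(fcoef u κ j * starRingEnd ℂ (fcoef v κ i)).re| ≤ ‖fcoef u κ j‖ * ‖fcoef v κ i‖ := by
      refine (Complex.abs_re_le_norm _).trans ?_
      rw [norm_mul, RCLike.norm_conj]
    calc _ ≤ (C * (1 + (κ : ℝ) ^ 2) ^ r) * (‖fcoef u κ j‖ * ‖fcoef v κ i‖) := by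
          gcongr
          exact ha κ i j
      _ = C * (((1 + (κ : ℝ) ^ 2) ^ (r / 2) * ‖fcoef u κ j‖) *
          ((1 + (κ : ℝ) ^ 2) ^ (r / 2) * ‖fcoef v κ i‖)) := by rw [hw]; ring
      _ ≤ _ := by
          gcongr
          · exact u.weight_mul_norm_fcoef_le κ j
          · exact v.weight_mul_norm_fcoef_le κ i
  unfold symbolTerm
  simp only [Fin.sum_univ_two]
  refine (norm_add_le _ _).trans ?_
  have := (norm_add_le (a κ 0 0 * (fcoef u κ 0 * starRingEnd ℂ (fcoef v κ 0)).re)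
    (a κ 0 1 * (fcoef u κ 1 * starRingEnd ℂ (fcoef v κ 0)).re))
  have := (norm_add_le (a κ 1 0 * (fcoef u κ 0 * starRingEnd ℂ (fcoef v κ 1)).re)
    (a κ 1 1 * (fcoef u κ 1 * starRingEnd ℂ (fcoef v κ 1)).re))
  linarith [h 0 0, h 0 1, h 1 0, h 1 1]

lemma SymbolBound.summable_symbolTerm (ha : SymbolBound r a C) (u v : Hper L r) :
    Summable (symbolTerm a u v) :=
  Summable.of_norm_bounded ((lp.tsum_mul_le_mul_norm (by norm_num; exact .two_two)
    (Hper.toEll2 L r u) (Hper.toEll2 L r v)).1.mul_left _) (ha.norm_symbolTerm_le u v)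

lemma SymbolBound.abs_tsum_symbolTerm_le (ha : SymbolBound r a C) (u v : Hper L r) :
    |∑' κ, symbolTerm a u v κ| ≤ 4 * C * (‖u‖ * ‖v‖) := by
  have h := lp.tsum_mul_le_mul_norm (by norm_num; exact .two_two)
    (Hper.toEll2 L r u) (Hper.toEll2 L r v)
  refine (tsum_of_norm_bounded (h.1.mul_left (4 * C)).hasSum (ha.norm_symbolTerm_le u v)).trans ?_
  rw [tsum_mul_left]
  have := ha.nonneg
  gcongr
  exact h.2

lemma symbolTerm_add_left (a : ℤ → Matrix (Fin 2) (Fin 2) ℝ) (u u' v : Hper L r) (κ : ℤ) :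
    symbolTerm a (u + u' : Hper L r) v κ = symbolTerm a u v κ + symbolTerm a u' v κ := by
  simp only [symbolTerm, Hper.fcoef_add, add_mul, Complex.add_re, mul_add, Finset.sum_add_distrib]

lemma symbolTerm_add_right (a : ℤ → Matrix (Fin 2) (Fin 2) ℝ) (u v v' : Hper L r) (κ : ℤ) :
    symbolTerm a u (v + v' : Hper L r) κ = symbolTerm a u v κ + symbolTerm a u v' κ := by
  simp only [symbolTerm, Hper.fcoef_add, map_add, Complex.add_re, mul_add, Finset.sum_add_distrib]

lemma symbolTerm_smul_left (a : ℤ → Matrix (Fin 2) (Fin 2) ℝ) (t : ℝ) (u v : Hper L r) (κ : ℤ) :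
    symbolTerm a (t • u : Hper L r) v κ = t * symbolTerm a u v κ := by
  simp only [symbolTerm, Hper.fcoef_smul, mul_assoc, Complex.re_ofReal_mul, Finset.mul_sum]
  exact Finset.sum_congr rfl fun i _ => Finset.sum_congr rfl fun j _ => by ring

lemma symbolTerm_smul_right (a : ℤ → Matrix (Fin 2) (Fin 2) ℝ) (t : ℝ) (u v : Hper L r) (κ : ℤ) :
    symbolTerm a u (t • v : Hper L r) κ = t * symbolTerm a u v κ := by
  simp only [symbolTerm, Hper.fcoef_smul, map_mul, Complex.conj_ofReal, Finset.mul_sum]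
  refine Finset.sum_congr rfl fun i _ => Finset.sum_congr rfl fun j _ => ?_
  rw [mul_left_comm, Complex.re_ofReal_mul]
  ring

/-- The bounded bilinear form `(u,v) ↦ ∑_κ Re ⟨a(κ) û(κ), v̂(κ)⟩` on `H^r × H^r`. -/
def symbolForm (L : ℝ) [Fact (0 < L)] (ha : SymbolBound r a C) :
    Hper L r →L[ℝ] Hper L r →L[ℝ] ℝ :=
  LinearMap.mkContinuous₂ (LinearMap.mk₂ ℝ (fun u v => ∑' κ, symbolTerm a u v κ)
    (fun u u' v => by
      simp only [symbolTerm_add_left]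
      exact (ha.summable_symbolTerm u v).tsum_add (ha.summable_symbolTerm u' v))
    (fun t u v => by simp only [symbolTerm_smul_left, tsum_mul_left, smul_eq_mul])
    (fun u v v' => by
      simp only [symbolTerm_add_right]
      exact (ha.summable_symbolTerm u v).tsum_add (ha.summable_symbolTerm u v'))
    (fun t u v => by simp only [symbolTerm_smul_right, tsum_mul_left, smul_eq_mul]))
    (4 * C) (fun u v => by
      rw [mul_assoc]
      exact ha.abs_tsum_symbolTerm_le u v)

lemma symbolForm_apply (ha : SymbolBound r a C) (u v : Hper L r) :
    symbolForm L ha u v = ∑' κ, symbolTerm a u v κ := rfl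

lemma symbolTerm_comm (hs : ∀ κ, (a κ).IsSymm) (f g : AddCircle L → Plane) (κ : ℤ) :
    symbolTerm a f g κ = symbolTerm a g f κ := by
  unfold symbolTerm
  rw [Finset.sum_comm]
  refine Finset.sum_congr rfl fun i _ => Finset.sum_congr rfl fun j _ => ?_
  rw [(hs κ).apply, ← Complex.conj_re, map_mul, Complex.conj_conj, mul_comm (starRingEnd ℂ _)]

lemma symbolForm_comm (ha : SymbolBound r a C) (hs : ∀ κ, (a κ).IsSymm) (u v : Hper L r) :
    symbolForm L ha u v = symbolForm L ha v u := by
  simp only [symbolForm_apply, symbolTerm_comm hs u v]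

lemma SmoothPer.coeFn_toHper (r : ℝ) (f : SmoothPer L) :
    (f.toHper r : AddCircle L → Plane) =ᵐ[volume] f := f.memLp.coeFn_toLp

lemma symbolTerm_congr {f f' g g' : AddCircle L → Plane} (hf : f =ᵐ[volume] f')
    (hg : g =ᵐ[volume] g') (a : ℤ → Matrix (Fin 2) (Fin 2) ℝ) :
    symbolTerm a f g = symbolTerm a f' g' := by
  funext κ
  rw [symbolTerm, symbolTerm, fcoef_congr hf, fcoef_congr hg]

/-- Testing with a monomial isolates a single frequency, which is how weak identities are turned
into identities between Fourier coefficients. -/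
lemma symbolForm_mode (ha : SymbolBound r a C) (he : ∀ κ, a (-κ) = a κ) (u : Hper L r) (κ₀ : ℤ)
    (b : Fin 2 → ℂ) : symbolForm L ha u ((mode L κ₀ b).toHper r) =
      ∑ i, ∑ j, a κ₀ i j * (fcoef u κ₀ j * starRingEnd ℂ (b i)).re := by
  rw [symbolForm_apply, symbolTerm_congr EventuallyEq.rfl (SmoothPer.coeFn_toHper r _)]
  exact (hasSum_symbolTerm_mode he u κ₀ b).tsum_eq

/-! ### Hilbert space structure -/

/-- The inner product is pulled back along the isometry `Hper.toEll2`, so it induces the norm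
already in place; the real part reflects the real scalars. -/
instance : InnerProductSpace ℝ (Hper L r) where
  inner u v := (inner ℂ (Hper.toEll2 L r u) (Hper.toEll2 L r v)).re
  norm_sq_eq_re_inner u := by
    change ‖Hper.toEll2 L r u‖ ^ 2 = _
    rw [← inner_self_eq_norm_sq (𝕜 := ℂ)]
    rfl
  conj_inner_symm u v := by
    rw [conj_trivial, ← Complex.conj_re, inner_conj_symm]
  add_left u v w := by rw [map_add, inner_add_left, Complex.add_re]
  smul_left u v t := by
    rw [map_smul, conj_trivial, inner_smul_left_eq_smul, Complex.smul_re, smul_eq_mul]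

/-- The symbol `(1 + κ²)^ρ Id`. -/
def weight (ρ : ℝ) (κ : ℤ) : Matrix (Fin 2) (Fin 2) ℝ := (1 + (κ : ℝ) ^ 2) ^ ρ • 1

lemma weight_neg (ρ : ℝ) (κ : ℤ) : weight ρ (-κ) = weight ρ κ := by
  simp [weight]

/-- Two exponents matter: ρ = r gives the inner product of H^r, and ρ = 0 gives that of L² up to the
factor L. -/
lemma weight_symbolBound {ρ : ℝ} (h : ρ ≤ r) : SymbolBound r (weight ρ) 1 := by
  intro κ i j
  have h1 : (1 + (κ : ℝ) ^ 2) ^ ρ ≤ (1 + (κ : ℝ) ^ 2) ^ r :=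
    Real.rpow_le_rpow_of_exponent_le (by nlinarith [sq_nonneg (κ : ℝ)]) h
  have h2 : (0 : ℝ) ≤ (1 + (κ : ℝ) ^ 2) ^ ρ := by positivity
  rw [weight, Matrix.smul_apply, Matrix.one_apply, one_mul]
  split_ifs
  · simpa [abs_of_nonneg h2] using h1
  · simpa using h2.trans h1

lemma symbolTerm_weight (ρ : ℝ) (f g : AddCircle L → Plane) (κ : ℤ) :
    symbolTerm (weight ρ) f g κ =
      (1 + (κ : ℝ) ^ 2) ^ ρ * ∑ i, (fcoef f κ i * starRingEnd ℂ (fcoef g κ i)).re := by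
  simp [symbolTerm, weight, Matrix.one_apply, Fin.sum_univ_two]
  ring

lemma symbolTerm_weight_self (ρ : ℝ) (f : AddCircle L → Plane) (κ : ℤ) :
    symbolTerm (weight ρ) f f κ = (1 + (κ : ℝ) ^ 2) ^ ρ * ∑ i, ‖fcoef f κ i‖ ^ 2 := by
  rw [symbolTerm_weight]
  simp only [Complex.mul_conj, Complex.ofReal_re, Complex.normSq_eq_norm_sq]

lemma Hper.inner_eq (u v : Hper L r) :
    inner ℝ u v = symbolForm L (weight_symbolBound le_rfl) u v := by
  have h := Complex.hasSum_re (lp.hasSum_inner (𝕜 := ℂ) (Hper.toEll2 L r u) (Hper.toEll2 L r v))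
  refine h.tsum_eq.symm.trans (tsum_congr fun κ => ?_)
  have hw : (1 + (κ : ℝ) ^ 2) ^ r = (1 + (κ : ℝ) ^ 2) ^ (r / 2) * (1 + (κ : ℝ) ^ 2) ^ (r / 2) := by
    rw [← Real.rpow_add (by positivity), add_halves]
  rw [symbolTerm_weight, hw, PiLp.inner_apply, Complex.re_sum, Finset.mul_sum]
  refine Finset.sum_congr rfl fun i _ => ?_
  rw [RCLike.inner_apply, toEll2_apply, toEll2_apply, map_mul, Complex.conj_ofReal,
    mul_mul_mul_comm, ← Complex.ofReal_mul, Complex.re_ofReal_mul]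
  congr 1
  rw [← Complex.conj_re, map_mul, Complex.conj_conj, mul_comm]

lemma Hper.inner_toL2 (hr : 0 ≤ r) (u v : Hper L r) :
    inner ℝ u.toL2 v.toL2 = L * symbolForm L (weight_symbolBound hr) u v := by
  have hL : (0 : ℝ) < L := Fact.out
  have h := hasSum_fcoef_mul_conj u.memLp v.memLp
  rw [L2.inner_def, symbolForm_apply]
  simp only [symbolTerm_weight, Real.rpow_zero, one_mul]
  rw [h.tsum_eq, mul_inv_cancel_left₀ hL.ne']

/-- The inclusion `H^r × H^r → L² × L²` as a bounded operator. -/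
def Hper.toL2L (L : ℝ) [Fact (0 < L)] (hr : 0 ≤ r) : Hper L r →L[ℝ] L2per L :=
  LinearMap.mkContinuous
    { toFun := Hper.toL2
      map_add' := fun _ _ => rfl
      map_smul' := fun _ _ => rfl } (√ L) (fun u => by
    have hL : (0 : ℝ) < L := Fact.out
    have h := u.inner_toL2 hr u
    rw [real_inner_self_eq_norm_sq] at h
    have h2 : symbolForm L (weight_symbolBound hr) u u ≤ ‖u‖ ^ 2 := by
      rw [← real_inner_self_eq_norm_sq, Hper.inner_eq, symbolForm_apply, symbolForm_apply]
      refine Summable.tsum_le_tsum (fun κ => ?_) ((weight_symbolBound hr).summable_symbolTerm u u)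
        ((weight_symbolBound le_rfl).summable_symbolTerm u u)
      rw [symbolTerm_weight_self, symbolTerm_weight_self]
      gcongr
      nlinarith [sq_nonneg (κ : ℝ)]
    refine le_of_sq_le_sq ?_ (by positivity)
    rw [mul_pow, Real.sq_sqrt hL.le]
    change ‖u.toL2‖ ^ 2 ≤ _
    rw [h]
    gcongr)

lemma Hper.toL2L_apply (hr : 0 ≤ r) (u : Hper L r) : Hper.toL2L L hr u = u.toL2 := rfl

end SobolevSpace

/-! ### Completeness, density of bounded functions, Sobolev embedding -/

section SobolevSpace

variable {L : ℝ} [Fact (0 < L)] {r : ℝ}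

lemma norm_fcoef_le_L2 (f : L2per L) (κ : ℤ) (i : Fin 2) :
    ‖fcoef f κ i‖ ≤ √(L⁻¹) * ‖f‖ := by
  have hL : (0 : ℝ) < L := Fact.out
  have h := hasSum_norm_fcoef_sq (Lp.memLp f)
  have h2 := h.summable.le_tsum κ (fun _ _ => Finset.sum_nonneg fun _ _ => sq_nonneg _)
  rw [h.tsum_eq, ← L2.inner_def, real_inner_self_eq_norm_sq] at h2
  have h3 : ‖fcoef f κ i‖ ^ 2 ≤ L⁻¹ * ‖f‖ ^ 2 :=
    (Finset.single_le_sum (f := fun i => ‖fcoef f κ i‖ ^ 2) (fun _ _ => sq_nonneg _)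
      (Finset.mem_univ i)).trans h2
  refine le_of_sq_le_sq ?_ (by positivity)
  rwa [mul_pow, Real.sq_sqrt (by positivity)]

lemma fcoef_sub_L2 (f g : L2per L) (κ : ℤ) (i : Fin 2) :
    fcoef (f - g : L2per L) κ i = fcoef f κ i - fcoef g κ i := by
  rw [eq_sub_iff_add_eq, ← fcoef_add (integrable_L2 _) (integrable_L2 _),
    ← fcoef_congr (Lp.coeFn_add (f - g) g), sub_add_cancel]

lemma tendsto_fcoef {f : ℕ → L2per L} {g : L2per L} (h : Tendsto f atTop (𝓝 g)) (κ : ℤ)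
    (i : Fin 2) : Tendsto (fun n => fcoef (f n) κ i) atTop (𝓝 (fcoef g κ i)) := by
  rw [tendsto_iff_norm_sub_tendsto_zero] at h ⊢
  refine squeeze_zero (fun _ => norm_nonneg _) (fun n => ?_) 
    (by simpa only [mul_zero] using h.const_mul (√(L⁻¹)))
  rw [← fcoef_sub_L2 (f n) g κ i]
  exact norm_fcoef_le_L2 (f n - g) κ i

/-- A limit in ℓ² need not a priori come from a real function. The L² limit supplies the function,
and convergence of each Fourier coefficient identifies its weighted coefficients with the ℓ² limit.
-/
lemma Hper.completeSpace (hr : 0 ≤ r) : CompleteSpace (Hper L r) := by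
  refine Metric.complete_of_cauchySeq_tendsto fun u hu => ?_
  have hiso : ∀ v w : Hper L r, dist (Hper.toEll2 L r v) (Hper.toEll2 L r w) = dist v w := by
    intro v w
    rw [dist_eq_norm, dist_eq_norm, ← map_sub]
    rfl
  have hE : CauchySeq fun n => Hper.toEll2 L r (u n) := by
    rw [Metric.cauchySeq_iff] at hu ⊢
    simpa only [hiso] using hu
  obtain ⟨U, hU⟩ := cauchySeq_tendsto_of_complete hE
  obtain ⟨f, hf⟩ := cauchySeq_tendsto_of_complete
    ((Hper.toL2L L hr).uniformContinuous.comp_cauchySeq hu)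
  have hpt : wcoef r f = U := by
    funext κ
    ext i
    have h1 : Tendsto (fun n => Hper.toEll2 L r (u n) κ i) atTop (𝓝 (U κ i)) := by
      rw [tendsto_iff_norm_sub_tendsto_zero] at hU ⊢
      refine squeeze_zero (fun _ => norm_nonneg _) (fun n => ?_) hU
      exact (PiLp.norm_apply_le ((Hper.toEll2 L r (u n) - U) κ) i).trans
        (lp.norm_apply_le_norm (by norm_num) _ κ)
    have h2 : Tendsto (fun n => Hper.toEll2 L r (u n) κ i) atTop (𝓝 (wcoef r f κ i)) := by
      simp only [Hper.toEll2_apply]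
      have h3 : wcoef r f κ i = ((1 + (κ : ℝ) ^ 2) ^ (r / 2) : ℝ) * fcoef f κ i := by simp [wcoef]
      rw [h3]
      exact (tendsto_fcoef hf κ i).const_mul _
    exact tendsto_nhds_unique h2 h1
  have hmem : InSobolev r (f : AddCircle L → Plane) := by
    rw [inSobolev_iff, hpt]
    exact U.2
  let v : Hper L r := ⟨f, hmem⟩
  have hv : Hper.toEll2 L r v = U := Subtype.ext hpt
  refine ⟨v, ?_⟩
  rw [tendsto_iff_dist_tendsto_zero] at hU ⊢
  simpa only [← hv, hiso] using hU

/-- The essentially bounded elements of `H^r × H^r`. -/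
def essBounded (L : ℝ) [Fact (0 < L)] (r : ℝ) : Submodule ℝ (Hper L r) where
  carrier := {v | ∃ M : ℝ, ∀ᵐ x, ‖v x‖ ≤ M}
  zero_mem' := by
    refine ⟨0, ?_⟩
    filter_upwards [Lp.coeFn_zero Plane 2 (volume : Measure (AddCircle L))] with x hx
    change ‖((0 : L2per L) : AddCircle L → Plane) x‖ ≤ 0
    rw [hx]
    simp
  add_mem' := by
    rintro u v ⟨M, hM⟩ ⟨M', hM'⟩
    refine ⟨M + M', ?_⟩
    filter_upwards [hM, hM', Hper.coeFn_add u v] with x h1 h2 h3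
    rw [h3]
    exact norm_add_le_of_le h1 h2
  smul_mem' := by
    rintro t u ⟨M, hM⟩
    refine ⟨|t| * M, ?_⟩
    filter_upwards [hM, Hper.coeFn_smul t u] with x h1 h3
    rw [h3, Pi.smul_apply, norm_smul, Real.norm_eq_abs]
    gcongr

lemma SmoothPer.exists_bound (f : SmoothPer L) : ∃ M : ℝ, ∀ x, ‖f x‖ ≤ M := by
  obtain ⟨M, hM⟩ := isCompact_univ.exists_bound_of_continuousOn f.continuous.continuousOn
  exact ⟨M, fun x => hM x (mem_univ x)⟩

lemma SmoothPer.toHper_mem_essBounded (f : SmoothPer L) : f.toHper r ∈ essBounded L r := by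
  obtain ⟨M, hM⟩ := f.exists_bound
  refine ⟨M, ?_⟩
  filter_upwards [f.coeFn_toHper r] with x hx
  rw [hx]
  exact hM x

lemma Hper.eq_zero_of_inner_mode {u : Hper L r}
    (h : ∀ κ b, inner ℝ u ((mode L κ b).toHper r) = 0) : u = 0 := by
  have h0 : ∀ κ i, fcoef u κ i = 0 := by
    intro κ i
    -- With b = û(κ) the pairing is the κ-th term of ‖u‖².
    have h1 := h κ (fcoef u κ)
    rw [Hper.inner_eq, symbolForm_mode _ (weight_neg r)] at h1
    have h2 : symbolTerm (weight r) u u κ = 0 := h1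
    rw [symbolTerm_weight_self, mul_eq_zero_iff_left (by positivity),
      Finset.sum_eq_zero_iff_of_nonneg fun _ _ => sq_nonneg _] at h2
    simpa using h2 i (Finset.mem_univ i)
  refine Hper.ext_fcoef fun κ i => ?_
  have hz := Hper.fcoef_sub u u κ i
  rw [sub_self, sub_self] at hz
  rw [h0, hz]

/-- Trigonometric monomials are bounded and have trivial orthogonal complement. Density lets
identities checked on bounded directions pass to all of H^r. -/
lemma dense_essBounded (hr : 0 ≤ r) : Dense (essBounded L r : Set (Hper L r)) := by
  have := Hper.completeSpace (L := L) hr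
  rw [Submodule.dense_iff_topologicalClosure_eq_top, Submodule.topologicalClosure_eq_top_iff,
    Submodule.eq_bot_iff]
  intro u hu
  refine Hper.eq_zero_of_inner_mode fun κ b => ?_
  exact (Submodule.mem_orthogonal' _ _).1 hu _ (SmoothPer.toHper_mem_essBounded _)

lemma summable_weight_neg (hr : 1 < 2 * r) : Summable fun κ : ℤ => (1 + (κ : ℝ) ^ 2) ^ (-r) := by
  refine Summable.of_norm_bounded_eventually (Real.summable_abs_int_rpow hr) ?_
  have hf : ∀ᶠ κ : ℤ in cofinite, κ ≠ 0 := by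
    rw [eventually_cofinite]
    simp
  filter_upwards [hf] with κ hκ
  have h0 : (0 : ℝ) < |(κ : ℝ)| := by positivity
  rw [Real.norm_of_nonneg (by positivity)]
  have e : |(κ : ℝ)| ^ (-(2 * r)) = (|(κ : ℝ)| ^ 2) ^ (-r) := by
    rw [← Real.rpow_natCast, ← Real.rpow_mul h0.le]
    congr 1
    push_cast
    ring
  rw [e]
  refine Real.rpow_le_rpow_of_nonpos (by positivity) ?_ (by linarith)
  rw [sq_abs]
  linarith

/-- The Sobolev embedding `H^r ⊂ L^∞` for `r > 1/2`. -/
lemma exists_sup_norm_le (hr : 1 < 2 * r) :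
    ∃ M : ℝ, 0 ≤ M ∧ ∀ u : Hper L r, ∀ᵐ x, ‖u x‖ ≤ M * ‖u‖ := by
  have hn : ∀ κ : ℤ, ‖EuclideanSpace.single (0 : Fin 2) (((1 + (κ : ℝ) ^ 2) ^ (-(r / 2)) : ℝ) : ℂ)‖ =
      (1 + (κ : ℝ) ^ 2) ^ (-(r / 2)) := fun κ => by
    rw [PiLp.norm_single, Complex.norm_real, Real.norm_of_nonneg (by positivity)]
  -- The inverse weights are square summable because 2r > 1. They are placed in the first component
  -- so that they live in the same ℓ² space as the coefficients of u.
  have hwm : Memℓp (fun κ : ℤ =>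
      EuclideanSpace.single (0 : Fin 2) (((1 + (κ : ℝ) ^ 2) ^ (-(r / 2)) : ℝ) : ℂ)) 2 := by
    rw [memℓp_gen_iff (by norm_num)]
    convert summable_weight_neg hr using 2 with κ
    rw [hn, ← Real.rpow_mul (by positivity)]
    congr 1
    simp
  let W : lp (fun _ : ℤ => EuclideanSpace ℂ (Fin 2)) 2 := ⟨_, hwm⟩
  have hsum : ∀ (u : Hper L r) (i : Fin 2), (Summable fun κ => ‖fcoef u κ i‖) ∧
      ∑' κ, ‖fcoef u κ i‖ ≤ ‖W‖ * ‖u‖ := by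
    intro u i
    have h := lp.tsum_mul_le_mul_norm (p := 2) (q := 2) (by norm_num; exact .two_two) W (Hper.toEll2 L r u)
    have hle : ∀ κ, ‖fcoef u κ i‖ ≤ ‖W κ‖ * ‖Hper.toEll2 L r u κ‖ := by
      intro κ
      have h1 := u.weight_mul_norm_fcoef_le κ i
      have h2 : ‖W κ‖ = ((1 + (κ : ℝ) ^ 2) ^ (r / 2))⁻¹ := by
        rw [← Real.rpow_neg (by positivity)]
        exact hn κ
      rw [h2, ← div_eq_inv_mul, le_div_iff₀' (by positivity)]
      exact h1
    have hs := Summable.of_nonneg_of_le (fun _ => norm_nonneg _) hle h.1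
    exact ⟨hs, (hs.tsum_le_tsum hle h.1).trans h.2⟩
  have hcomp : ∀ (u : Hper L r) (i : Fin 2), ∀ᵐ x, ‖u x i‖ ≤ ‖W‖ * ‖u‖ := by
    intro u i
    have hm : MemLp (fun x => ((u x i : ℝ) : ℂ)) 2 AddCircle.haarAddCircle :=
      memLp_haarAddCircle_iff.2 ((EuclideanSpace.proj (𝕜 := ℝ) i).comp_memLp' u.memLp).ofReal
    obtain ⟨hs, hle⟩ := hsum u i
    have hnorm : ∀ κ : ℤ, ‖fcoef u κ i • fourier (T := L) κ‖ = ‖fcoef u κ i‖ := fun κ => by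
      rw [norm_smul, fourier_norm, mul_one]
    have hsC : Summable fun κ : ℤ => fcoef u κ i • fourier (T := L) κ :=
      Summable.of_norm (by simpa only [hnorm] using hs)
    -- The Fourier series converges absolutely to a continuous g, which agrees with the component of
    -- u almost everywhere since both have the same series in L².
    obtain ⟨g, hg⟩ := hsC
    have hgn : ‖g‖ ≤ ‖W‖ * ‖u‖ := by
      rw [← hg.tsum_eq]
      refine (norm_tsum_le_tsum_norm (by simpa only [hnorm] using hs)).trans ?_
      simpa only [hnorm] using hle
    have h1 := hg.mapL (ContinuousMap.toLp 2 AddCircle.haarAddCircle ℂ)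
    have h2 := hasSum_fourier_series_L2 (hm.toLp _)
    have heq : ContinuousMap.toLp 2 AddCircle.haarAddCircle ℂ g = hm.toLp _ := by
      refine h1.unique ?_
      convert h2 using 2 with κ
      rw [map_smul, fourierCoeff_congr_ae hm.coeFn_toLp]
      rfl
    have hae : ∀ᵐ x ∂(AddCircle.haarAddCircle : Measure (AddCircle L)), ‖u x i‖ ≤ ‖W‖ * ‖u‖ := by
      filter_upwards [hm.coeFn_toLp, ContinuousMap.coeFn_toLp (p := 2) (𝕜 := ℂ)
        AddCircle.haarAddCircle g] with x hx hx'
      rw [heq, hx] at hx'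
      have := (g.norm_coe_le_norm x).trans hgn
      rw [← hx', Complex.norm_real] at this
      exact this
    exact Measure.ae_smul_measure hae (ENNReal.ofReal L)
  refine ⟨2 * ‖W‖, by positivity, fun u => ?_⟩
  filter_upwards [hcomp u 0, hcomp u 1] with x h0 h1
  refine le_of_sq_le_sq ?_ (by positivity)
  rw [EuclideanSpace.norm_sq_eq, Fin.sum_univ_two]
  have h0' : ‖u x 0‖ ^ 2 ≤ (‖W‖ * ‖u‖) ^ 2 := by gcongr
  have h1' : ‖u x 1‖ ^ 2 ≤ (‖W‖ * ‖u‖) ^ 2 := by gcongr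
  nlinarith [sq_nonneg (‖W‖ * ‖u‖)]

end SobolevSpace

/-! ### Translations, differentiability of the orbit, and the nearest orbit point -/

section Translation

lemma fourier_eval_add {L : ℝ} (κ : ℤ) (x y : AddCircle L) :
    fourier κ (x + y) = fourier κ x * fourier κ y := by
  rw [fourier_apply, fourier_apply, fourier_apply, ← Circle.coe_mul, ← AddCircle.toCircle_add,
    zsmul_add]

variable {L : ℝ} [Fact (0 < L)] {r : ℝ}

lemma translate_coeFn (y : ℝ) (u : Hper L r) :
    (translate y u : AddCircle L → Plane) =ᵐ[volume] fun x => u (x + (y : AddCircle L)) :=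
  Lp.coeFn_compMeasurePreserving u.toL2 (measurePreserving_add_right volume (y : AddCircle L))

lemma fcoef_translate_Hper (y : ℝ) (u : Hper L r) (κ : ℤ) (i : Fin 2) :
    fcoef (translate y u) κ i = fourier κ (y : AddCircle L) * fcoef u κ i := by
  rw [fcoef_congr (translate_coeFn y u), fcoef_translate]

lemma translate_sub (y : ℝ) (u v : Hper L r) :
    translate y (u - v) = translate y u - translate y v := by
  refine Hper.ext_fcoef fun κ i => ?_
  rw [Hper.fcoef_sub, fcoef_translate_Hper, fcoef_translate_Hper, fcoef_translate_Hper,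
    Hper.fcoef_sub, mul_sub]

lemma translate_translate (y z : ℝ) (u : Hper L r) :
    translate y (translate z u) = translate (y + z) u := by
  refine Hper.ext_fcoef fun κ i => ?_
  rw [fcoef_translate_Hper, fcoef_translate_Hper, fcoef_translate_Hper, AddCircle.coe_add,
    fourier_eval_add, mul_assoc]

lemma translate_zero (u : Hper L r) : translate 0 u = u := by
  refine Hper.ext_fcoef fun κ i => ?_
  rw [fcoef_translate_Hper, AddCircle.coe_zero, fourier_eval_zero, one_mul]

lemma translate_add_period (y : ℝ) (u : Hper L r) : translate (y + L) u = translate y u := by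
  refine Hper.ext_fcoef fun κ i => ?_
  rw [fcoef_translate_Hper, fcoef_translate_Hper, AddCircle.coe_add_period]

lemma Hper.norm_le_of_fcoef_le {u v : Hper L r} {C : ℝ} (hC : 0 ≤ C)
    (h : ∀ κ i, ‖fcoef u κ i‖ ≤ C * ‖fcoef v κ i‖) : ‖u‖ ≤ C * ‖v‖ := by
  refine le_of_sq_le_sq ?_ (by positivity)
  rw [mul_pow, Hper.norm_sq, Hper.norm_sq, ← tsum_mul_left]
  refine u.summable_norm_sq.tsum_le_tsum (fun κ => ?_) (v.summable_norm_sq.mul_left _)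
  rw [mul_left_comm]
  gcongr
  rw [Finset.mul_sum]
  refine Finset.sum_le_sum fun i _ => ?_
  rw [← mul_pow]
  gcongr
  exact h κ i

lemma norm_translate (y : ℝ) (u : Hper L r) : ‖translate y u‖ = ‖u‖ := by
  have hle : ∀ (y : ℝ) (u : Hper L r), ‖translate y u‖ ≤ ‖u‖ := fun y u => by
    simpa using Hper.norm_le_of_fcoef_le zero_le_one (u := translate y u) (v := u) fun κ i => by
      rw [fcoef_translate_Hper, norm_mul, fourier_apply, Circle.norm_coe]
  refine le_antisymm (hle y u) ?_
  have h := hle (-y) (translate y u)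
  rwa [translate_translate, neg_add_cancel, translate_zero] at h

lemma norm_sub_translate (y : ℝ) (u v : Hper L r) :
    ‖u - translate y v‖ = ‖translate (-y) u - v‖ := by
  rw [← norm_translate (-y) (u - translate y v), translate_sub, translate_translate,
    neg_add_cancel, translate_zero]

/-- The Fourier coefficients of the derivative. -/
lemma SmoothPer.fcoef_deriv_eq (f : SmoothPer L) (κ : ℤ) (i : Fin 2) :
    fcoef f.deriv κ i = 2 * Real.pi * Complex.I * κ / L * fcoef f κ i := by
  have hL : (0 : ℝ) < L := Fact.out
  have hd : ∀ x : ℝ, HasDerivAt (fun x : ℝ => ((f (x : AddCircle L) i : ℝ) : ℂ))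
      ((f.deriv (x : AddCircle L) i : ℝ) : ℂ) x := fun x =>
    ((EuclideanSpace.proj (𝕜 := ℝ) i).hasFDerivAt.comp_hasDerivAt x (f.hasDerivAt x)).ofReal_comp
  have hcont : ∀ g : SmoothPer L, Continuous fun x : ℝ => ((g (x : AddCircle L) i : ℝ) : ℂ) :=
    fun g => Complex.continuous_ofReal.comp
      ((EuclideanSpace.proj (𝕜 := ℝ) i).continuous.comp g.smooth.continuous)
  have hfc : Continuous fun x : ℝ => fourier (-κ) (x : AddCircle L) :=
    (fourier (-κ)).continuous.comp (AddCircle.continuous_mk' L)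
  have hprod : ∀ x : ℝ, HasDerivAt
      (fun x : ℝ => fourier (-κ) (x : AddCircle L) * ((f (x : AddCircle L) i : ℝ) : ℂ))
      (-2 * Real.pi * Complex.I * κ / L * (fourier (-κ) (x : AddCircle L) •
          ((f (x : AddCircle L) i : ℝ) : ℂ)) +
        fourier (-κ) (x : AddCircle L) • ((f.deriv (x : AddCircle L) i : ℝ) : ℂ)) x := fun x => by
    refine ((hasDerivAt_fourier_neg L κ x).mul (hd x)).congr_deriv ?_
    simp only [smul_eq_mul]
    ring
  have hi1 : IntervalIntegrable (fun x : ℝ => fourier (-κ) (x : AddCircle L) •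
      ((f (x : AddCircle L) i : ℝ) : ℂ)) volume 0 (0 + L) :=
    (hfc.smul (hcont f)).intervalIntegrable _ _
  have hi2 : IntervalIntegrable (fun x : ℝ => fourier (-κ) (x : AddCircle L) •
      ((f.deriv (x : AddCircle L) i : ℝ) : ℂ)) volume 0 (0 + L) :=
    (hfc.smul (hcont f.deriv)).intervalIntegrable _ _
  have h := intervalIntegral.integral_eq_sub_of_hasDerivAt (fun x _ => hprod x)
    ((hi1.const_mul _).add hi2)
  rw [intervalIntegral.integral_add (hi1.const_mul _) hi2, intervalIntegral.integral_const_mul,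
    AddCircle.coe_add_period, sub_self] at h
  rw [fcoef, fcoef, fourierCoeff_eq_intervalIntegral _ _ 0, fourierCoeff_eq_intervalIntegral _ _ 0,
    eq_neg_of_add_eq_zero_right h, Complex.real_smul, Complex.real_smul]
  ring

/-- Valid for all real t: Taylor's bound for |t| ≤ 1, and 1 + 1 + |t| ≤ 3t² otherwise. -/
lemma norm_exp_mul_I_sub_le (t : ℝ) :
    ‖Complex.exp (t * Complex.I) - 1 - t * Complex.I‖ ≤ 3 * t ^ 2 := by
  have hn : ‖(t : ℂ) * Complex.I‖ = |t| := by simp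
  rcases le_total |t| 1 with h | h
  · have := Complex.norm_exp_sub_one_sub_id_le (x := t * Complex.I) (by rw [hn]; exact h)
    rw [hn, sq_abs] at this
    nlinarith [sq_nonneg t]
  · have h1 : ‖Complex.exp (t * Complex.I)‖ = 1 := Complex.norm_exp_ofReal_mul_I t
    have h2 := norm_sub_le (Complex.exp (t * Complex.I) - 1) (t * Complex.I)
    have h3 := norm_sub_le (Complex.exp (t * Complex.I)) 1
    rw [hn] at h2
    rw [h1, norm_one] at h3
    nlinarith [sq_abs t]

lemma SmoothPer.fcoef_toHper (f : SmoothPer L) (r : ℝ) : fcoef (f.toHper r) = fcoef f :=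
  fcoef_congr (f.coeFn_toHper r)

/-- Frequency by frequency, translation multiplies by e^{iθ} with θ = 2πκh/L, and θ²|f̂(κ)| is h²
times the coefficient of f''. Smoothness of f pays for the quadratic remainder. -/
lemma SmoothPer.norm_translate_sub_le (f : SmoothPer L) (h : ℝ) :
    ‖translate h (f.toHper r) - f.toHper r - h • f.deriv.toHper r‖ ≤
      3 * h ^ 2 * ‖f.deriv.deriv.toHper r‖ := by
  have hL : (0 : ℝ) < L := Fact.out
  refine Hper.norm_le_of_fcoef_le (by positivity) fun κ i => ?_
  have e1 : (2 * Real.pi * Complex.I * κ * h / L : ℂ) =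
      ((2 * Real.pi * κ * h / L : ℝ) : ℂ) * Complex.I := by
    push_cast
    ring
  have e2 : fcoef (translate h (f.toHper r) - f.toHper r - h • f.deriv.toHper r : Hper L r) κ i =
      (Complex.exp (((2 * Real.pi * κ * h / L : ℝ) : ℂ) * Complex.I) - 1 -
        ((2 * Real.pi * κ * h / L : ℝ) : ℂ) * Complex.I) * fcoef f κ i := by
    rw [Hper.fcoef_sub, Hper.fcoef_sub, Hper.fcoef_smul, fcoef_translate_Hper, fcoef_toHper,
      fcoef_toHper, fcoef_deriv_eq, fourier_coe_apply, ← e1]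
    ring
  have e3 : ‖fcoef f.deriv.deriv κ i‖ = (2 * Real.pi * κ / L) ^ 2 * ‖fcoef f κ i‖ := by
    rw [fcoef_deriv_eq, fcoef_deriv_eq, ← mul_assoc, norm_mul, ← pow_two, norm_pow]
    congr 1
    rw [norm_div, norm_mul, norm_mul, norm_mul, Complex.norm_I, Complex.norm_intCast,
      Complex.norm_real, Complex.norm_real, Real.norm_of_nonneg hL.le,
      Real.norm_of_nonneg Real.pi_pos.le, Complex.norm_ofNat, div_pow, div_pow, mul_pow, mul_pow,
      sq_abs]
    ring
  rw [e2, norm_mul, fcoef_toHper, e3]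
  calc _ ≤ (3 * (2 * Real.pi * κ * h / L) ^ 2) * ‖fcoef f κ i‖ := by
        gcongr
        exact norm_exp_mul_I_sub_le _
    _ = _ := by ring

lemma SmoothPer.hasDerivAt_translate (f : SmoothPer L) (r : ℝ) :
    HasDerivAt (fun h : ℝ => translate h (f.toHper r)) (f.deriv.toHper r) 0 := by
  rw [hasDerivAt_iff_isLittleO]
  simp only [translate_zero, sub_zero]
  refine Asymptotics.IsBigO.trans_isLittleO (g := fun h : ℝ => h ^ 2) ?_ ?_
  · refine Asymptotics.IsBigO.of_bound (3 * ‖f.deriv.deriv.toHper r‖)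
      (Eventually.of_forall fun h => (f.norm_translate_sub_le h).trans (le_of_eq ?_))
    rw [Real.norm_of_nonneg (sq_nonneg h)]
    ring
  · exact Asymptotics.isLittleO_pow_id one_lt_two

/-- Translations form a group of isometries, so continuity at 0 propagates to every point. -/
lemma SmoothPer.continuous_translate (f : SmoothPer L) (r : ℝ) :
    Continuous fun h : ℝ => translate h (f.toHper r) := by
  rw [continuous_iff_continuousAt]
  intro y
  have h0 := (f.hasDerivAt_translate r).continuousAt.tendsto
  have h1 : Tendsto (fun h : ℝ => h - y) (𝓝 y) (𝓝 0) := by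
    simpa using (continuous_sub_right y).tendsto y
  have h2 := h0.comp h1
  rw [tendsto_iff_norm_sub_tendsto_zero] at h2
  rw [ContinuousAt, tendsto_iff_norm_sub_tendsto_zero]
  refine h2.congr fun h => ?_
  rw [Function.comp, translate_zero, ← norm_translate y, translate_sub, translate_translate,
    add_sub_cancel]

lemma rho_le (u v : Hper L r) (y : ℝ) : rho u v ≤ ‖u - translate y v‖ :=
  ciInf_le ⟨0, by rintro _ ⟨y, rfl⟩; exact norm_nonneg _⟩ y

lemma continuous_rho (v : Hper L r) : Continuous fun u => rho u v := by
  refine (LipschitzWith.of_le_add fun u w => ?_ : LipschitzWith 1 fun u => rho u v).continuous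
  rw [← sub_le_iff_le_add]
  refine le_ciInf fun y => ?_
  rw [sub_le_iff_le_add, dist_eq_norm]
  refine (rho_le u v y).trans ?_
  have := norm_add_le (w - translate y v) (u - w)
  rwa [sub_add_sub_comm, add_comm w u, add_sub_add_right_eq_sub] at this

/-- The distance to the orbit of a smooth function is attained, and the difference is
orthogonal to the direction of translations. -/
lemma SmoothPer.exists_rho_eq (f : SmoothPer L) (u : Hper L r) :
    ∃ y : ℝ, rho u (f.toHper r) = ‖translate y u - f.toHper r‖ ∧
      inner ℝ (f.deriv.toHper r) (translate y u - f.toHper r) = 0 := by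
  have hL : (0 : ℝ) < L := Fact.out
  have hper : Function.Periodic (fun y : ℝ => ‖u - translate y (f.toHper r)‖) L := fun y => by
    change ‖u - translate (y + L) (f.toHper r)‖ = _
    rw [translate_add_period]
  have hcont : Continuous fun y : ℝ => ‖u - translate y (f.toHper r)‖ :=
    (continuous_const.sub (f.continuous_translate r)).norm
  -- By periodicity the distance function has compact range, so its infimum is attained.
  obtain ⟨_, ⟨y, rfl⟩, hy⟩ := (hper.compact_of_continuous hL.ne' hcont).exists_isLeast
    (range_nonempty _)
  have hmin : ∀ z, ‖u - translate y (f.toHper r)‖ ≤ ‖u - translate z (f.toHper r)‖ := fun z =>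
    hy ⟨z, rfl⟩
  -- The sign changes because the translation is moved from f to u.
  refine ⟨-y, ?_, ?_⟩
  · rw [← norm_sub_translate]
    exact le_antisymm (rho_le _ _ _) (le_ciInf hmin)
  · set v := translate (-y) u
    -- The squared distance is stationary at the minimiser; its derivative along the orbit is -2
    -- times the inner product with f'.
    have hd := ((f.hasDerivAt_translate r).const_sub v).norm_sq
    have hloc : IsLocalMin (fun h : ℝ => ‖v - translate h (f.toHper r)‖ ^ 2) 0 := by
      refine Eventually.of_forall fun h => ?_
      have h1 := hmin (y + h)
      rw [norm_sub_translate y, norm_sub_translate (y + h), neg_add_rev, ← translate_translate,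
        ← norm_sub_translate h] at h1
      simp only [translate_zero]
      gcongr
    have h0 := hloc.hasDerivAt_eq_zero hd
    rw [translate_zero, inner_neg_right] at h0
    rw [real_inner_comm]
    linarith

end Translation

/-! ### Consequences of ellipticity of the symbol -/

section Symbol

variable {m : ℤ → Matrix (Fin 2) (Fin 2) ℝ} {s : ℝ}

lemma IsSymbol.exists_quadratic_bounds (hm : IsSymbol m s) : ∃ c₁ c₂ : ℝ, 0 < c₁ ∧ 0 < c₂ ∧
    ∀ (κ : ℤ) (x y : ℝ),
      c₁ * |(κ : ℝ)| ^ s * (x ^ 2 + y ^ 2) ≤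
        m κ 0 0 * x ^ 2 + 2 * m κ 0 1 * (x * y) + m κ 1 1 * y ^ 2 ∧
      m κ 0 0 * x ^ 2 + 2 * m κ 0 1 * (x * y) + m κ 1 1 * y ^ 2 ≤
        c₂ * |(κ : ℝ)| ^ s * (x ^ 2 + y ^ 2) := by
  obtain ⟨c₁, c₂, h1, h2, hb⟩ := hm.elliptic
  refine ⟨c₁, c₂, h1, h2, fun κ x y => ?_⟩
  have hsym : m κ 1 0 = m κ 0 1 := (hm.symm κ).apply 0 1
  rcases eq_or_ne (!₂[x, y] : Plane) 0 with h0 | h0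
  · have hx : x = 0 := congrArg (fun w : Plane => w 0) h0
    have hy : y = 0 := congrArg (fun w : Plane => w 1) h0
    simp [hx, hy]
  · have hn : 0 < ‖(!₂[x, y] : Plane)‖ := norm_pos_iff.2 h0
    have hsq : ‖(!₂[x, y] : Plane)‖ ^ 2 = x ^ 2 + y ^ 2 := by
      rw [EuclideanSpace.norm_sq_eq, Fin.sum_univ_two]
      simp
    have h := hb κ (‖(!₂[x, y] : Plane)‖⁻¹ • !₂[x, y])
      (by rw [norm_smul, norm_inv, norm_norm, inv_mul_cancel₀ hn.ne'])
    set t := ‖(!₂[x, y] : Plane)‖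
    have e : ∑ i, ∑ j, m κ i j * (t⁻¹ • !₂[x, y] : Plane) j * (t⁻¹ • !₂[x, y] : Plane) i =
        (m κ 0 0 * x ^ 2 + 2 * m κ 0 1 * (x * y) + m κ 1 1 * y ^ 2) / t ^ 2 := by
      simp only [Fin.sum_univ_two, PiLp.smul_apply, smul_eq_mul, hsym, Matrix.cons_val_zero,
        Matrix.cons_val_one]
      field_simp
      ring
    rw [e, le_div_iff₀ (by positivity), div_le_iff₀ (by positivity)] at h
    rwa [← hsq]

lemma abs_rpow_le_weight (hs : 0 ≤ s) (κ : ℤ) :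
    |(κ : ℝ)| ^ s ≤ (1 + (κ : ℝ) ^ 2) ^ (s / 2) := by
  have e : |(κ : ℝ)| ^ s = ((κ : ℝ) ^ 2) ^ (s / 2) := by
    rw [← sq_abs, ← Real.rpow_natCast, ← Real.rpow_mul (abs_nonneg _)]
    congr 1
    push_cast
    ring
  rw [e]
  gcongr
  linarith

/-- The summand 1 covers κ = 0, where |κ|^s vanishes; it becomes the L² term in Gårding's
inequality. -/
lemma weight_le_abs_rpow (hs : 0 < s) (κ : ℤ) :
    (1 + (κ : ℝ) ^ 2) ^ (s / 2) ≤ 2 ^ (s / 2) * |(κ : ℝ)| ^ s + 1 := by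
  rcases eq_or_ne κ 0 with rfl | hκ
  · simp [Real.zero_rpow hs.ne']
  · have h1 : (1 : ℝ) ≤ (κ : ℝ) ^ 2 := by
      rw [← sq_abs]
      have : (1 : ℝ) ≤ |(κ : ℝ)| := by exact_mod_cast Int.one_le_abs hκ
      nlinarith
    have e : |(κ : ℝ)| ^ s = ((κ : ℝ) ^ 2) ^ (s / 2) := by
      rw [← sq_abs, ← Real.rpow_natCast, ← Real.rpow_mul (abs_nonneg _)]
      congr 1
      push_cast
      ring
    rw [e, ← Real.mul_rpow (by norm_num) (by positivity)]
    have : (1 + (κ : ℝ) ^ 2) ^ (s / 2) ≤ (2 * (κ : ℝ) ^ 2) ^ (s / 2) := by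
      gcongr
      linarith
    linarith

lemma IsSymbol.symbolBound (hs : 0 ≤ s) (hm : IsSymbol m s) :
    ∃ C, SymbolBound (s / 2) m C := by
  obtain ⟨c₁, c₂, h1, h2, hb⟩ := hm.exists_quadratic_bounds
  refine ⟨c₂, fun κ i j => ?_⟩
  have hsym : m κ 1 0 = m κ 0 1 := (hm.symm κ).apply 0 1
  have hP : 0 ≤ c₁ * |(κ : ℝ)| ^ s := by positivity
  have hle : c₂ * |(κ : ℝ)| ^ s ≤ c₂ * (1 + (κ : ℝ) ^ 2) ^ (s / 2) := by
    gcongr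
    exact abs_rpow_le_weight hs κ
  refine le_trans ?_ hle
  -- The entries of a symmetric 2×2 matrix are controlled by its quadratic form at (1,0), (0,1),
  -- (1,1) and (1,-1).
  have ha := hb κ 1 0
  have hb' := hb κ 0 1
  have hc := hb κ 1 1
  have hd := hb κ 1 (-1)
  fin_cases i <;> fin_cases j <;> simp only [Fin.zero_eta, Fin.mk_one, hsym] <;> rw [abs_le] <;>
    constructor <;> linarith

variable {L : ℝ} [Fact (0 < L)]

/-- For a symmetric real matrix the real and imaginary parts decouple, so the bounds for real
vectors apply to complex coefficients. -/
lemma symbolTerm_self_eq (hm : IsSymbol m s) (f : AddCircle L → Plane) (κ : ℤ) :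
    symbolTerm m f f κ =
      (m κ 0 0 * (fcoef f κ 0).re ^ 2 + 2 * m κ 0 1 * ((fcoef f κ 0).re * (fcoef f κ 1).re) +
        m κ 1 1 * (fcoef f κ 1).re ^ 2) +
      (m κ 0 0 * (fcoef f κ 0).im ^ 2 + 2 * m κ 0 1 * ((fcoef f κ 0).im * (fcoef f κ 1).im) +
        m κ 1 1 * (fcoef f κ 1).im ^ 2) := by
  have hsym : m κ 1 0 = m κ 0 1 := (hm.symm κ).apply 0 1
  simp only [symbolTerm, Fin.sum_univ_two, hsym, Complex.mul_re, Complex.conj_re, Complex.conj_im]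
  ring

lemma IsSymbol.exists_symbolTerm_lower_bound (hm : IsSymbol m s) (L : ℝ) [Fact (0 < L)] :
    ∃ c₁ : ℝ, 0 < c₁ ∧ ∀ (f : AddCircle L → Plane) (κ : ℤ),
      c₁ * |(κ : ℝ)| ^ s * ∑ i, ‖fcoef f κ i‖ ^ 2 ≤ symbolTerm m f f κ := by
  obtain ⟨c₁, c₂, h1, h2, hb⟩ := hm.exists_quadratic_bounds
  refine ⟨c₁, h1, fun f κ => ?_⟩
  rw [symbolTerm_self_eq hm, Fin.sum_univ_two, ← Complex.normSq_eq_norm_sq,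
    ← Complex.normSq_eq_norm_sq, Complex.normSq_apply, Complex.normSq_apply]
  have h3 := (hb κ (fcoef f κ 0).re (fcoef f κ 1).re).1
  have h4 := (hb κ (fcoef f κ 0).im (fcoef f κ 1).im).1
  linarith

/-- If `𝓜 f = g` then `⟨𝓜 f, w⟩ = ∫ ⟨g, w⟩`. -/
lemma IsDispersion.dispersionForm_eq {f g w : AddCircle L → Plane} (h : IsDispersion m f g)
    (hg : MemLp g 2) (hw : MemLp w 2) : dispersionForm m f w = ∫ x, inner ℝ (g x) (w x) := by
  have hL : (0 : ℝ) < L := Fact.out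
  have hp := hasSum_fcoef_mul_conj hg hw
  rw [← mul_inv_cancel_left₀ hL.ne' (∫ x, inner ℝ (g x) (w x)), ← hp.tsum_eq, dispersionForm]
  congr 2
  funext κ
  refine Finset.sum_congr rfl fun i _ => ?_
  rw [h, Finset.sum_mul, Complex.re_sum]
  refine Finset.sum_congr rfl fun j _ => ?_
  rw [mul_assoc, Complex.re_ofReal_mul]

/-- The weak form of `𝓜 f = g`, tested with trigonometric monomials, implies the strong form. -/
lemma isDispersion_of_mode (hm : IsSymbol m s) {f g : AddCircle L → Plane} (hg : MemLp g 2)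
    (h : ∀ κ b, dispersionForm m f (mode L κ b) = ∫ x, inner ℝ (g x) (mode L κ b x)) :
    IsDispersion m f g := by
  have hL : (0 : ℝ) < L := Fact.out
  intro κ
  -- The test coefficient is the defect in the equation at frequency κ, so the weak identity says
  -- that its norm vanishes.
  set b : Fin 2 → ℂ := fun i => ∑ j, (m κ i j : ℂ) * fcoef f κ j - fcoef g κ i
  have h1 := h κ b
  have h2 := (hasSum_symbolTerm_mode hm.even f κ b).tsum_eq
  have h3 := (hasSum_symbolTerm_mode (weight_neg 0) g κ b)
  have h4 := hasSum_fcoef_mul_conj hg (mode L κ b).memLp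
  have e0 : ∀ (g w : AddCircle L → Plane), symbolTerm (weight 0) g w =
      fun κ => ∑ i, (fcoef g κ i * starRingEnd ℂ (fcoef w κ i)).re := fun g w => by
    funext κ
    rw [symbolTerm_weight, Real.rpow_zero, one_mul]
  rw [e0] at h3
  have h5 := h4.unique h3
  have h6 : dispersionForm m f (mode L κ b) = L * ∑' κ', symbolTerm m f (mode L κ b) κ' := rfl
  have h7 : ∑ i, ∑ j, m κ i j * (fcoef f κ j * starRingEnd ℂ (b i)).re =
      ∑ i, (fcoef g κ i * starRingEnd ℂ (b i)).re := by
    have e1 : ∑ i, ∑ j, weight 0 κ i j * (fcoef g κ j * starRingEnd ℂ (b i)).re =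
        ∑ i, (fcoef g κ i * starRingEnd ℂ (b i)).re := by
      simp [weight, Matrix.one_apply]
    rw [← e1, ← h5, ← h1, h6, h2, inv_mul_cancel_left₀ hL.ne']
  have h8 : ∑ i, ‖b i‖ ^ 2 = 0 := by
    have e2 : ∀ i, ‖b i‖ ^ 2 = (∑ j, m κ i j * (fcoef f κ j * starRingEnd ℂ (b i)).re) -
        (fcoef g κ i * starRingEnd ℂ (b i)).re := by
      intro i
      rw [← Complex.normSq_eq_norm_sq, ← Complex.ofReal_re (Complex.normSq (b i)),
        ← Complex.mul_conj]
      change ((∑ j, (m κ i j : ℂ) * fcoef f κ j - fcoef g κ i) * starRingEnd ℂ (b i)).re = _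
      simp only [sub_mul, Complex.sub_re, Finset.sum_mul, Complex.re_sum, mul_assoc,
        Complex.re_ofReal_mul]
    rw [Finset.sum_congr rfl fun i _ => e2 i, Finset.sum_sub_distrib, h7, sub_self]
  intro i
  rw [Finset.sum_eq_zero_iff_of_nonneg fun _ _ => sq_nonneg _] at h8
  have h9 : b i = 0 := by simpa using h8 i (Finset.mem_univ i)
  exact (sub_eq_zero.1 h9).symm

/-- Elliptic regularity: if `𝓜 f ∈ L²` then `f ∈ H^s`. -/
lemma IsDispersion.inSobolev (hs : 0 < s) (hm : IsSymbol m s) {f g : AddCircle L → Plane}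
    (h : IsDispersion m f g) (hf : MemLp f 2) (hg : MemLp g 2) : InSobolev s f := by
  obtain ⟨c₁, hc, hlow⟩ := hm.exists_symbolTerm_lower_bound L
  have hsum := ((hasSum_norm_fcoef_sq hg).summable.mul_left (2 * (2 ^ (s / 2)) ^ 2 / c₁ ^ 2)).add
    ((hasSum_norm_fcoef_sq hf).summable.mul_left 2)
  refine Summable.of_nonneg_of_le (fun κ => by positivity) (fun κ => ?_) hsum
  set V := ∑ i, ‖fcoef f κ i‖ ^ 2
  set G := ∑ i, ‖fcoef g κ i‖ ^ 2
  set p := |(κ : ℝ)| ^ s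
  have hp : 0 ≤ p := by positivity
  have hV : 0 ≤ V := Finset.sum_nonneg fun _ _ => sq_nonneg _
  have hG : 0 ≤ G := Finset.sum_nonneg fun _ _ => sq_nonneg _
  have h1 := hlow f κ
  have h2 : symbolTerm m f f κ = ∑ i, (fcoef g κ i * starRingEnd ℂ (fcoef f κ i)).re := by
    refine Finset.sum_congr rfl fun i _ => ?_
    rw [h, Finset.sum_mul, Complex.re_sum]
    refine Finset.sum_congr rfl fun j _ => ?_
    rw [mul_assoc, Complex.re_ofReal_mul]
  -- Young's inequality with weight c₁p. Combined with the elliptic lower bound, half of the left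
  -- side absorbs (c₁p)²V and leaves (c₁p)²V ≤ G.
  have h3 : 2 * (c₁ * p) * symbolTerm m f f κ ≤ G + (c₁ * p) ^ 2 * V := by
    rw [h2, Finset.mul_sum, Finset.mul_sum, ← Finset.sum_add_distrib]
    refine Finset.sum_le_sum fun i _ => ?_
    have h4 : (fcoef g κ i * starRingEnd ℂ (fcoef f κ i)).re ≤ ‖fcoef g κ i‖ * ‖fcoef f κ i‖ := by
      refine (Complex.re_le_norm _).trans ?_
      rw [norm_mul, RCLike.norm_conj]
    have h5 : 0 ≤ c₁ * p := by positivity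
    nlinarith [sq_nonneg (‖fcoef g κ i‖ - c₁ * p * ‖fcoef f κ i‖)]
  have h4 : (c₁ * p) ^ 2 * V ≤ G := by
    have : 2 * (c₁ * p) * (c₁ * p * V) ≤ 2 * (c₁ * p) * symbolTerm m f f κ := by gcongr
    nlinarith
  have h5 : (1 + (κ : ℝ) ^ 2) ^ s ≤ 2 * (2 ^ (s / 2)) ^ 2 * p ^ 2 + 2 := by
    have e : (1 + (κ : ℝ) ^ 2) ^ s = ((1 + (κ : ℝ) ^ 2) ^ (s / 2)) ^ 2 := by
      rw [← Real.rpow_natCast ((1 + (κ : ℝ) ^ 2) ^ (s / 2)) 2, ← Real.rpow_mul (by positivity)]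
      norm_num
    rw [e]
    have h6 := weight_le_abs_rpow hs κ
    have h7 : (0 : ℝ) ≤ (1 + (κ : ℝ) ^ 2) ^ (s / 2) := by positivity
    calc ((1 + (κ : ℝ) ^ 2) ^ (s / 2)) ^ 2 ≤ (2 ^ (s / 2) * p + 1) ^ 2 := by gcongr
      _ ≤ _ := by nlinarith [sq_nonneg (2 ^ (s / 2) * p - 1)]
  calc (1 + (κ : ℝ) ^ 2) ^ s * V ≤ (2 * (2 ^ (s / 2)) ^ 2 * p ^ 2 + 2) * V := by gcongr
    _ = 2 * (2 ^ (s / 2)) ^ 2 / c₁ ^ 2 * ((c₁ * p) ^ 2 * V) + 2 * V := by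
      field_simp
    _ ≤ _ := by gcongr

end Symbol

/-! ### The Hessian of R and its symmetry -/

section Hessian

variable {R : Plane → ℝ}

lemma contDiff_gradient (hR : ContDiff ℝ 2 R) : ContDiff ℝ 1 (gradient R) :=
  (InnerProductSpace.toDual ℝ Plane).symm.contDiff.comp (hR.fderiv_right (by norm_num))

lemma continuous_hessian (hR : ContDiff ℝ 2 R) : Continuous (hessian R) :=
  (contDiff_gradient hR).continuous_fderiv (by simp)

lemma inner_gradient (R : Plane → ℝ) (p w : Plane) : inner ℝ (gradient R p) w = fderiv ℝ R p w := by
  rw [gradient, InnerProductSpace.toDual_symm_apply]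

/-- Links the derivative of the gradient to the second Fréchet derivative, the object for which
Taylor's estimate and symmetry are available. -/
lemma inner_hessian (hR : ContDiff ℝ 2 R) (p v w : Plane) :
    inner ℝ (hessian R p v) w = fderiv ℝ (fderiv ℝ R) p v w := by
  have hd : DifferentiableAt ℝ (gradient R) p := (contDiff_gradient hR).differentiable (by simp) p
  have h1 : HasFDerivAt (fun q => inner ℝ (gradient R q) w)
      ((innerSL ℝ w).comp (hessian R p)) p := by
    have := (innerSL ℝ w).hasFDerivAt.comp p hd.hasFDerivAt
    refine this.congr_of_eventuallyEq (Eventually.of_forall fun q => ?_)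
    simp
  have hd2 : DifferentiableAt ℝ (fderiv ℝ R) p :=
    (hR.fderiv_right (m := 1) (by norm_num)).differentiable (by simp) p
  have h2 : HasFDerivAt (fun q => fderiv ℝ R q w) ((fderiv ℝ (fderiv ℝ R) p).flip w) p := by
    simpa using hd2.hasFDerivAt.clm_apply (hasFDerivAt_const w p)
  simp only [inner_gradient] at h1
  have := congrArg (fun T : Plane →L[ℝ] ℝ => T v) (h1.unique h2)
  simpa [real_inner_comm] using this

lemma inner_hessian_comm (hR : ContDiff ℝ 2 R) (p v w : Plane) :
    inner ℝ (hessian R p v) w = inner ℝ (hessian R p w) v := by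
  rw [inner_hessian hR, inner_hessian hR]
  exact (hR.contDiffAt (x := p)).isSymmSndFDerivAt (by simp) v w

end Hessian

/-! ### The form of the linearized operator: weak spectral theory, Gårding, coercivity -/

section Linearization

variable {L : ℝ} [Fact (0 < L)] {R : Plane → ℝ} {m : ℤ → Matrix (Fin 2) (Fin 2) ℝ} {s : ℝ}

lemma memLp_top_hessian (hR : ContDiff ℝ 2 R) (φ : SmoothPer L) :
    MemLp (fun x => hessian R (φ x)) ⊤ (volume : Measure (AddCircle L)) := by
  have hc : Continuous fun x => hessian R (φ x) := (continuous_hessian hR).comp φ.continuous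
  obtain ⟨C, hC⟩ := isCompact_univ.exists_bound_of_continuousOn hc.continuousOn
  exact memLp_top_of_bound hc.aestronglyMeasurable C (Eventually.of_forall fun x => hC x (mem_univ x))

/-- Multiplication by `Hess R(φ)` on `L² × L²`. -/
def hessianL2 (hR : ContDiff ℝ 2 R) (φ : SmoothPer L) : L2per L →L[ℝ] L2per L :=
  (ContinuousLinearMap.id ℝ (Plane →L[ℝ] Plane)).holderL volume ⊤ 2 2 ((memLp_top_hessian hR φ).toLp _)

lemma coeFn_hessianL2 (hR : ContDiff ℝ 2 R) (φ : SmoothPer L) (f : L2per L) :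
    hessianL2 hR φ f =ᵐ[volume] fun x => hessian R (φ x) (f x) := by
  have h := ContinuousLinearMap.coeFn_holder (r := 2) (ContinuousLinearMap.id ℝ (Plane →L[ℝ] Plane))
    ((memLp_top_hessian hR φ).toLp _) f
  filter_upwards [h, (memLp_top_hessian hR φ).coeFn_toLp] with x h1 h2
  rw [h2] at h1
  exact h1

/-- The `L²` inner product as a bounded form on `H^r × H^r`. -/
def massForm (L : ℝ) [Fact (0 < L)] {r : ℝ} (hr : 0 ≤ r) : Hper L r →L[ℝ] Hper L r →L[ℝ] ℝ :=
  (innerSL ℝ (E := L2per L)).bilinearComp (Hper.toL2L L hr) (Hper.toL2L L hr)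

lemma massForm_apply {r : ℝ} (hr : 0 ≤ r) (u v : Hper L r) :
    massForm L hr u v = inner ℝ u.toL2 v.toL2 := rfl

lemma massForm_eq_integral {r : ℝ} (hr : 0 ≤ r) (u v : Hper L r) :
    massForm L hr u v = ∫ x, inner ℝ (u x) (v x) := L2.inner_def _ _

lemma massForm_comm {r : ℝ} (hr : 0 ≤ r) (u v : Hper L r) :
    massForm L hr u v = massForm L hr v u := by
  rw [massForm_apply, massForm_apply, real_inner_comm]

lemma massForm_pos {r : ℝ} (hr : 0 ≤ r) (u : Hper L r) (hu : u ≠ 0) : 0 < massForm L hr u u := by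
  have : u.toL2 ≠ 0 := fun h => hu (Subtype.ext h)
  rw [massForm_apply]
  exact real_inner_self_pos.2 this

/-- The form `(u,v) ↦ ∫ ⟨Hess R(φ) u, v⟩` on `H^r × H^r`. -/
def hessianForm {r : ℝ} (hr : 0 ≤ r) (hR : ContDiff ℝ 2 R) (φ : SmoothPer L) :
    Hper L r →L[ℝ] Hper L r →L[ℝ] ℝ :=
  (innerSL ℝ (E := L2per L)).bilinearComp ((hessianL2 hR φ).comp (Hper.toL2L L hr))
    (Hper.toL2L L hr)

lemma hessianForm_apply {r : ℝ} (hr : 0 ≤ r) (hR : ContDiff ℝ 2 R) (φ : SmoothPer L)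
    (u v : Hper L r) : hessianForm hr hR φ u v = inner ℝ (hessianL2 hR φ u.toL2) v.toL2 := rfl

lemma hessianForm_eq_integral {r : ℝ} (hr : 0 ≤ r) (hR : ContDiff ℝ 2 R) (φ : SmoothPer L)
    (u v : Hper L r) : hessianForm hr hR φ u v = ∫ x, inner ℝ (hessian R (φ x) (u x)) (v x) := by
  rw [hessianForm_apply, L2.inner_def]
  refine integral_congr_ae ?_
  filter_upwards [coeFn_hessianL2 hR φ u.toL2] with x hx
  rw [hx]

lemma hessianForm_comm {r : ℝ} (hr : 0 ≤ r) (hR : ContDiff ℝ 2 R) (φ : SmoothPer L)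
    (u v : Hper L r) : hessianForm hr hR φ u v = hessianForm hr hR φ v u := by
  rw [hessianForm_eq_integral, hessianForm_eq_integral]
  simp only [inner_hessian_comm hR _ (u _)]

lemma hessianForm_self_le {r : ℝ} (hr : 0 ≤ r) (hR : ContDiff ℝ 2 R) (φ : SmoothPer L)
    (u : Hper L r) : hessianForm hr hR φ u u ≤ ‖hessianL2 hR φ‖ * massForm L hr u u := by
  rw [hessianForm_apply, massForm_apply, real_inner_self_eq_norm_sq, pow_two, ← mul_assoc]
  refine (real_inner_le_norm _ _).trans ?_
  gcongr
  exact (hessianL2 hR φ).le_opNorm _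

/-- The linearized operator as a bounded form on the energy space. -/
def linearizedForm {C : ℝ} (hs : 0 ≤ s / 2) (hm : SymbolBound (s / 2) m C) (hR : ContDiff ℝ 2 R) (c : ℝ)
    (φ : SmoothPer L) : Hper L (s / 2) →L[ℝ] Hper L (s / 2) →L[ℝ] ℝ :=
  L • symbolForm L hm + c • massForm L hs - hessianForm hs hR φ

lemma linearizedForm_apply {C : ℝ} (hs : 0 ≤ s / 2) (hm : SymbolBound (s / 2) m C)
    (hR : ContDiff ℝ 2 R) (c : ℝ) (φ : SmoothPer L) (u v : Hper L (s / 2)) :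
    linearizedForm hs hm hR c φ u v =
      dispersionForm m u v + c * massForm L hs u v - hessianForm hs hR φ u v := rfl

lemma linearizedForm_eq_linForm {C : ℝ} (hs : 0 ≤ s / 2) (hm : SymbolBound (s / 2) m C)
    (hR : ContDiff ℝ 2 R) (c : ℝ) (φ : SmoothPer L) (u v : Hper L (s / 2)) :
    linearizedForm hs hm hR c φ u v = linForm R m c φ u v := by
  rw [linearizedForm_apply, massForm_eq_integral, hessianForm_eq_integral, linForm]

lemma linearizedForm_comm {C : ℝ} (hs : 0 ≤ s / 2) (hm : SymbolBound (s / 2) m C)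
    (hsym : ∀ κ, (m κ).IsSymm) (hR : ContDiff ℝ 2 R) (c : ℝ) (φ : SmoothPer L)
    (u v : Hper L (s / 2)) :
    linearizedForm hs hm hR c φ u v = linearizedForm hs hm hR c φ v u := by
  have h : dispersionForm m u v = dispersionForm m v u := by
    change L * symbolForm L hm u v = L * symbolForm L hm v u
    rw [symbolForm_comm hm hsym]
  rw [linearizedForm_apply, linearizedForm_apply, h, massForm_comm, hessianForm_comm]

/-- The function `μ f - c f + Hess R(φ) f` in the eigenvalue equation. -/
lemma eigen_rhs_ae (hR : ContDiff ℝ 2 R) (φ : SmoothPer L) (μ c : ℝ) (f : L2per L) :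
    (μ • f - c • f + hessianL2 hR φ f : L2per L) =ᵐ[volume]
      fun x => μ • f x - c • f x + hessian R (φ x) (f x) := by
  filter_upwards [Lp.coeFn_add (μ • f - c • f) (hessianL2 hR φ f), Lp.coeFn_sub (μ • f) (c • f),
    Lp.coeFn_smul μ f, Lp.coeFn_smul c f, coeFn_hessianL2 hR φ f] with x h1 h2 h3 h4 h5
  rw [h1, Pi.add_apply, h2, Pi.sub_apply, h3, h4, h5]
  rfl

lemma integral_eigen_rhs (hR : ContDiff ℝ 2 R) (φ : SmoothPer L) (μ c : ℝ) (f w : L2per L) :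
    ∫ x, inner ℝ (μ • f x - c • f x + hessian R (φ x) (f x)) (w x) =
      μ * inner ℝ f w - c * inner ℝ f w + inner ℝ (hessianL2 hR φ f) w := by
  rw [← inner_smul_left_eq_smul (𝕜 := ℝ) f w μ |>.trans (smul_eq_mul _ _),
    ← inner_smul_left_eq_smul (𝕜 := ℝ) f w c |>.trans (smul_eq_mul _ _), ← inner_sub_left,
    ← inner_add_left, L2.inner_def]
  refine integral_congr_ae ?_
  filter_upwards [eigen_rhs_ae hR φ μ c f] with x hx
  rw [hx]

lemma memLp_eigen_rhs (hR : ContDiff ℝ 2 R) (φ : SmoothPer L) (μ c : ℝ) (f : L2per L) :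
    MemLp (fun x => μ • f x - c • f x + hessian R (φ x) (f x)) 2 :=
  (memLp_congr_ae (eigen_rhs_ae hR φ μ c f)).1 (Lp.memLp _)

/-- Eigenfunctions satisfy the weak eigenvalue equation. -/
lemma SatisfiesEigen.weak {C : ℝ} (hs : 0 ≤ s / 2) (hm : SymbolBound (s / 2) m C)
    (hR : ContDiff ℝ 2 R) {c μ : ℝ} {φ : SmoothPer L} {u : Hper L (s / 2)}
    (h : SatisfiesEigen R m s c φ μ u.toL2) (w : Hper L (s / 2)) :
    linearizedForm hs hm hR c φ u w = μ * massForm L hs u w := by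
  have h1 := h.2.dispersionForm_eq (memLp_eigen_rhs hR φ μ c u.toL2) w.memLp
  rw [integral_eigen_rhs hR] at h1
  rw [linearizedForm_apply, h1, massForm_apply, hessianForm_apply]
  ring

/-- Weak eigenfunctions are eigenfunctions. -/
lemma satisfiesEigen_of_weak {C : ℝ} (hs : 0 < s) (hsym : IsSymbol m s)
    (hm : SymbolBound (s / 2) m C) (hR : ContDiff ℝ 2 R) {c μ : ℝ} {φ : SmoothPer L}
    {u : Hper L (s / 2)}
    (h : ∀ w, linearizedForm (half_pos hs).le hm hR c φ u w = μ * massForm L (half_pos hs).le u w) :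
    SatisfiesEigen R m s c φ μ u.toL2 := by
  have hd : IsDispersion m u fun x => μ • u x - c • u x + hessian R (φ x) (u x) := by
    refine isDispersion_of_mode hsym (memLp_eigen_rhs hR φ μ c u.toL2) fun κ b => ?_
    have h1 := h ((mode L κ b).toHper (s / 2))
    rw [linearizedForm_apply, massForm_apply, hessianForm_apply] at h1
    have h2 := integral_eigen_rhs hR φ μ c u.toL2 ((mode L κ b).toHper (s / 2)).toL2
    have hae := (mode L κ b).coeFn_toHper (s / 2)
    have h3 : dispersionForm m u ((mode L κ b).toHper (s / 2)) = dispersionForm m u (mode L κ b) := by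
      rw [dispersionForm, dispersionForm, SmoothPer.fcoef_toHper]
    have h4 : ∫ x, inner ℝ (μ • u x - c • u x + hessian R (φ x) (u x))
        ((mode L κ b).toHper (s / 2) x) =
        ∫ x, inner ℝ (μ • u x - c • u x + hessian R (φ x) (u x)) (mode L κ b x) := by
      refine integral_congr_ae ?_
      filter_upwards [hae] with x hx
      rw [hx]
    rw [← h3, ← h4, h2]
    linarith
  exact ⟨hd.inSobolev hs hsym u.memLp (memLp_eigen_rhs hR φ μ c u.toL2), hd⟩

/-- A Fourier coefficient as a bounded functional. -/
def fcoefL (L : ℝ) [Fact (0 < L)] {r : ℝ} (hr : 0 ≤ r) (κ : ℤ) (i : Fin 2) : Hper L r →L[ℝ] ℂ :=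
  LinearMap.mkContinuous
    { toFun := fun u => fcoef u κ i
      map_add' := fun u v => Hper.fcoef_add u v κ i
      map_smul' := fun t u => by simpa using Hper.fcoef_smul t u κ i } 1 (fun u => by
    have h1 := u.weight_mul_norm_fcoef_le κ i
    have h2 : (1 : ℝ) ≤ (1 + (κ : ℝ) ^ 2) ^ (r / 2) :=
      Real.one_le_rpow (by nlinarith [sq_nonneg (κ : ℝ)]) (by linarith)
    have h3 := lp.norm_apply_le_norm (by norm_num) (Hper.toEll2 L r u) κ
    rw [one_mul]
    calc ‖fcoef u κ i‖ ≤ (1 + (κ : ℝ) ^ 2) ^ (r / 2) * ‖fcoef u κ i‖ :=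
          le_mul_of_one_le_left (norm_nonneg _) h2
      _ ≤ _ := h1.trans h3)

lemma summable_norm_fcoef_sq (u : L2per L) : Summable fun κ : ℤ => ∑ i, ‖fcoef u κ i‖ ^ 2 :=
  (hasSum_norm_fcoef_sq (Lp.memLp u)).summable

lemma massForm_self_eq {r : ℝ} (hr : 0 ≤ r) (u : Hper L r) :
    massForm L hr u u = L * ∑' κ : ℤ, ∑ i, ‖fcoef u κ i‖ ^ 2 := by
  have hL : (0 : ℝ) < L := Fact.out
  rw [massForm_eq_integral, (hasSum_norm_fcoef_sq u.memLp).tsum_eq, mul_inv_cancel_left₀ hL.ne']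

/-- Ellipticity controls the H^{s/2} norm up to an L² term, while c and Hess R(φ) act boundedly on
L² and only enlarge `K`. -/
lemma linearizedForm_lower_bound {C : ℝ} (hs : 0 < s) (hsym : IsSymbol m s)
    (hm : SymbolBound (s / 2) m C) (hR : ContDiff ℝ 2 R) (c : ℝ) (φ : SmoothPer L) :
    ∃ β K : ℝ, 0 < β ∧ 0 ≤ K ∧ ∀ u : Hper L (s / 2),
      β * ‖u‖ ^ 2 - K * ∑' κ : ℤ, ∑ i, ‖fcoef u κ i‖ ^ 2 ≤
        linearizedForm (half_pos hs).le hm hR c φ u u := by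
  have hL : (0 : ℝ) < L := Fact.out
  obtain ⟨c₁, hc, hlow⟩ := hsym.exists_symbolTerm_lower_bound L
  set β := L * c₁ * (2 ^ (s / 2))⁻¹ with hβ
  have hβ0 : 0 < β := by positivity
  refine ⟨β, β + (|c| + ‖hessianL2 hR φ‖) * L, hβ0, by positivity, fun u => ?_⟩
  have h1 : β * ‖u‖ ^ 2 - β * ∑' κ : ℤ, ∑ i, ‖fcoef u κ i‖ ^ 2 ≤ dispersionForm m u u := by
    change _ ≤ L * ∑' κ, symbolTerm m u u κ
    rw [Hper.norm_sq, ← tsum_mul_left, ← tsum_mul_left, ← tsum_mul_left,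
      ← (u.summable_norm_sq.mul_left β).tsum_sub ((summable_norm_fcoef_sq u.toL2).mul_left β)]
    refine Summable.tsum_le_tsum (fun κ => ?_) ((u.summable_norm_sq.mul_left β).sub
      ((summable_norm_fcoef_sq u.toL2).mul_left β)) ((hm.summable_symbolTerm u u).mul_left L)
    have h2 := hlow u κ
    have h3 := weight_le_abs_rpow hs κ
    have hV : 0 ≤ ∑ i, ‖fcoef u κ i‖ ^ 2 := Finset.sum_nonneg fun _ _ => sq_nonneg _
    set V := ∑ i, ‖fcoef u κ i‖ ^ 2
    calc β * ((1 + (κ : ℝ) ^ 2) ^ (s / 2) * V) - β * V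
        ≤ β * ((2 ^ (s / 2) * |(κ : ℝ)| ^ s + 1) * V) - β * V := by gcongr
      _ = L * (c₁ * |(κ : ℝ)| ^ s * V) := by
          rw [hβ]
          field_simp
          ring
      _ ≤ _ := by gcongr
  have h2 := hessianForm_self_le (half_pos hs).le hR φ u
  have h3 : 0 ≤ massForm L (half_pos hs).le u u := by
    rw [massForm_apply]
    exact real_inner_self_nonneg
  have h4 := neg_abs_le c
  rw [linearizedForm_apply]
  have h5 := massForm_self_eq (half_pos hs).le u
  have h6 : (β + (|c| + ‖hessianL2 hR φ‖) * L) * ∑' κ : ℤ, ∑ i, ‖fcoef u κ i‖ ^ 2 =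
      β * ∑' κ : ℤ, ∑ i, ‖fcoef u κ i‖ ^ 2 +
        (|c| + ‖hessianL2 hR φ‖) * massForm L (half_pos hs).le u u := by
    rw [h5]
    ring
  rw [h6]
  nlinarith

lemma exists_weight_ge (hs : 0 < s) (K : ℝ) :
    ∃ F : Finset ℤ, ∀ κ ∉ F, K ≤ (1 + (κ : ℝ) ^ 2) ^ (s / 2) := by
  obtain ⟨N, hN⟩ := exists_nat_ge (|K| ^ s⁻¹)
  refine ⟨Finset.Icc (-N) N, fun κ hκ => ?_⟩
  have h1 : (N : ℝ) ≤ |(κ : ℝ)| := by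
    have h : (N : ℤ) < |κ| := by
      rw [Finset.mem_Icc, ← abs_le] at hκ
      exact not_le.1 hκ
    exact_mod_cast h.le
  refine le_trans ?_ (abs_rpow_le_weight hs.le κ)
  calc K ≤ |K| := le_abs_self K
    _ = (|K| ^ s⁻¹) ^ s := (Real.rpow_inv_rpow (abs_nonneg K) hs.ne').symm
    _ ≤ |(κ : ℝ)| ^ s := by
      gcongr
      exact hN.trans h1

/-- Gårding's inequality, modulo finitely many Fourier modes. -/
lemma linearizedForm_garding {C : ℝ} (hs : 0 < s) (hsym : IsSymbol m s)
    (hm : SymbolBound (s / 2) m C) (hR : ContDiff ℝ 2 R) (c : ℝ) (φ : SmoothPer L) :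
    ∃ (F : Finset ℤ) (π : Hper L (s / 2) →L[ℝ] (F → Fin 2 → ℂ)) (α D : ℝ), 0 < α ∧ 0 ≤ D ∧
      ∀ u, α * ‖u‖ ^ 2 - D * ‖π u‖ ^ 2 ≤ linearizedForm (half_pos hs).le hm hR c φ u u := by
  obtain ⟨β, K, hβ, hK, hlow⟩ := linearizedForm_lower_bound (L := L) hs hsym hm hR c φ
  -- Off F the weight is at least 2K/β, so half of the coercive term absorbs the L² term; only the
  -- modes in F remain.
  obtain ⟨F, hF⟩ := exists_weight_ge hs (2 * K / β)
  set π : Hper L (s / 2) →L[ℝ] (F → Fin 2 → ℂ) := ContinuousLinearMap.pi fun κ =>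
    ContinuousLinearMap.pi fun i => fcoefL L (half_pos hs).le κ i
  -- F.card modes, each with two components bounded by the sup norm of π u.
  refine ⟨F, π, β / 2, K * (F.card * 2), half_pos hβ, by positivity, fun u => ?_⟩
  refine le_trans ?_ (hlow u)
  have hπ : ∀ κ ∈ F, ∑ i, ‖fcoef u κ i‖ ^ 2 ≤ 2 * ‖π u‖ ^ 2 := by
    intro κ hκ
    have h1 : ∀ i, ‖fcoef u κ i‖ ^ 2 ≤ ‖π u‖ ^ 2 := fun i => by
      gcongr
      exact (norm_le_pi_norm (π u ⟨κ, hκ⟩) i).trans (norm_le_pi_norm (π u) ⟨κ, hκ⟩)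
    rw [Fin.sum_univ_two]
    linarith [h1 0, h1 1]
  have hsplit : K * ∑' κ : ℤ, ∑ i, ‖fcoef u κ i‖ ^ 2 ≤
      β / 2 * ‖u‖ ^ 2 + K * ∑ κ ∈ F, ∑ i, ‖fcoef u κ i‖ ^ 2 := by
    have hfin : HasSum (fun κ : ℤ => if κ ∈ F then ∑ i, ‖fcoef u κ i‖ ^ 2 else 0)
        (∑ κ ∈ F, ∑ i, ‖fcoef u κ i‖ ^ 2) := by
      have := hasSum_sum_of_ne_finset_zero (L := SummationFilter.unconditional ℤ) (s := F)
        (f := fun κ : ℤ => if κ ∈ F then ∑ i, ‖fcoef u κ i‖ ^ 2 else 0) (fun κ hκ => if_neg hκ)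
      rwa [Finset.sum_congr rfl fun κ hκ => if_pos hκ] at this
    rw [Hper.norm_sq, ← hfin.tsum_eq, ← tsum_mul_left, ← tsum_mul_left, ← tsum_mul_left,
      ← (u.summable_norm_sq.mul_left _).tsum_add (hfin.summable.mul_left K)]
    refine Summable.tsum_le_tsum (fun κ => ?_) ((summable_norm_fcoef_sq u.toL2).mul_left K)
      ((u.summable_norm_sq.mul_left _).add (hfin.summable.mul_left K))
    have hV : 0 ≤ ∑ i, ‖fcoef u κ i‖ ^ 2 := Finset.sum_nonneg fun _ _ => sq_nonneg _
    set V := ∑ i, ‖fcoef u κ i‖ ^ 2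
    split_ifs with h
    · have : 0 ≤ β / 2 * ((1 + (κ : ℝ) ^ 2) ^ (s / 2) * V) := by positivity
      linarith
    · have h1 := hF κ h
      rw [div_le_iff₀ hβ] at h1
      rw [mul_zero, add_zero, ← mul_assoc]
      gcongr
      linarith
  have hsum : ∑ κ ∈ F, ∑ i, ‖fcoef u κ i‖ ^ 2 ≤ F.card * (2 * ‖π u‖ ^ 2) := by
    rw [← nsmul_eq_mul]
    exact Finset.sum_le_card_nsmul _ _ _ hπ
  have := mul_le_mul_of_nonneg_left hsum hK
  linarith

lemma inSobolev_mono {r r' : ℝ} (h : r ≤ r') {f : AddCircle L → Plane} (hf : InSobolev r' f) :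
    InSobolev r f := by
  refine Summable.of_nonneg_of_le (fun κ => by positivity) (fun κ => ?_) hf
  gcongr
  nlinarith [sq_nonneg (κ : ℝ)]

/-- Coercivity of the penalized second variation, transversally to the orbit. -/
lemma exists_linForm_coercive {C : ℝ} (hs : 0 < s) (hsym : IsSymbol m s)
    (hm : SymbolBound (s / 2) m C) (hR : ContDiff ℝ 2 R) {c : ℝ} {φ : SmoothPer L}
    (hspec : SpectralCondition R m s c φ) {Φ : Hper L (s / 2)} (hΦ : linForm R m c φ Φ Φ < 0) :
    ∃ N δ : ℝ, 0 < δ ∧ ∀ v : Hper L (s / 2), inner ℝ (φ.deriv.toHper (s / 2)) v = 0 →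
      δ * ‖v‖ ^ 2 ≤ linearizedForm (half_pos hs).le hm hR c φ v v +
        N * (linearizedForm (half_pos hs).le hm hR c φ Φ v) ^ 2 := by
  have hL : (0 : ℝ) < L := Fact.out
  have hs2 := (half_pos hs).le
  have := Hper.completeSpace (L := L) hs2
  obtain ⟨F, π, α, D, hα, hD, hG⟩ := linearizedForm_garding (L := L) hs hsym hm hR c φ
  obtain ⟨β, K, hβ, hK, hlow⟩ := linearizedForm_lower_bound (L := L) hs hsym hm hR c φ
  obtain ⟨⟨μ₀, -, ⟨χ, hχ0, hχ, hχ1⟩, huniq⟩, hψ0, -, hψ1⟩ := hspec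
  let X : Hper L (s / 2) := ⟨χ, inSobolev_mono (half_le_self hs.le) hχ.1⟩
  have hψ : φ.deriv.toHper (s / 2) ≠ 0 := fun h => hψ0 (congrArg Hper.toL2 h)
  refine exists_coercive_penalization (linearizedForm hs2 hm hR c φ) (massForm L hs2)
    (linearizedForm_comm hs2 hm hsym.symm hR c φ) (massForm_comm hs2) (massForm_pos hs2) π hα hD hG
    -- The mass form is L times the sum of squared coefficients.
    (K := K / L) (fun v => ?_) (μ₀ := μ₀) (χ := X) (fun h => hχ0 (congrArg Hper.toL2 h))
    (fun w => SatisfiesEigen.weak (u := X) hs2 hm hR hχ w) (fun μ hμ v hv hw => ?_)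
    -- The transversality functional is the inner product of the energy space with φ', which is the
    -- orthogonality produced by the nearest orbit point.
    (ψ := φ.deriv.toHper (s / 2)) (fun v hv => ?_) ?_ (innerSL ℝ (φ.deriv.toHper (s / 2))) ?_
  · have h1 := hlow v
    have h2 : -(K / L) * massForm L hs2 v v = -(K * ∑' κ : ℤ, ∑ i, ‖fcoef v κ i‖ ^ 2) := by
      rw [massForm_self_eq]
      field_simp
    rw [h2]
    have : 0 ≤ β * ‖v‖ ^ 2 := by positivity
    linarith
  -- Elliptic regularity turns the weak eigenvector into one in H^s, where the spectral hypothesis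
  -- is stated.
  · have he := satisfiesEigen_of_weak hs hsym hm hR hw
    have hμ0 := huniq μ hμ v.toL2 (fun h => hv (Subtype.ext h)) he
    rw [hμ0] at he
    obtain ⟨a, ha⟩ := hχ1 _ he
    exact ⟨a, Subtype.ext ha⟩
  · obtain ⟨a, ha⟩ := hψ1 _ (satisfiesEigen_of_weak (μ := 0) hs hsym hm hR fun w => by rw [hv, zero_mul])
    exact ⟨a, Subtype.ext ha⟩
  · rwa [linearizedForm_eq_linForm]
  · rw [innerSL_apply_apply]
    exact (real_inner_self_pos.2 hψ).ne'

end Linearization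

/-! ### Quadratic lower bound for the penalized functional, and the continuity argument -/

section Lyapunov

variable {X : Type*} [NormedAddCommGroup X] [NormedSpace ℝ X]

/-- `G(p + v) = G(p) + ½ B(v,v) + o(‖v‖²)`. -/
def HasCriticalExpansion (G : X → ℝ) (B : X →L[ℝ] X →L[ℝ] ℝ) (p : X) : Prop :=
  ∀ ε > 0, ∃ δ > 0, ∀ v, ‖v‖ < δ → |G (p + v) - G p - 1 / 2 * B v v| ≤ ε * ‖v‖ ^ 2

lemma HasCriticalExpansion.continuousAt {G : X → ℝ} {B : X →L[ℝ] X →L[ℝ] ℝ} {p : X}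
    (h : HasCriticalExpansion G B p) : ContinuousAt G p := by
  obtain ⟨δ, hδ, hb⟩ := h 1 one_pos
  have hc : Tendsto (fun x => (1 + ‖B‖) * ‖x - p‖ ^ 2) (𝓝 p) (𝓝 0) := by
    have : Continuous fun x => (1 + ‖B‖) * ‖x - p‖ ^ 2 := by fun_prop
    simpa using this.tendsto p
  rw [ContinuousAt, tendsto_iff_norm_sub_tendsto_zero]
  refine squeeze_zero' (Eventually.of_forall fun _ => norm_nonneg _) ?_ hc
  filter_upwards [Metric.ball_mem_nhds p hδ] with x hx
  have h1 := hb (x - p) (by simpa [dist_eq_norm] using hx)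
  rw [add_sub_cancel] at h1
  have h2 := B.le_opNorm₂ (x - p) (x - p)
  rw [Real.norm_eq_abs] at h2 ⊢
  have h3 : 0 ≤ ‖B‖ * ‖x - p‖ * ‖x - p‖ := by positivity
  have h4 := abs_add_le (G x - G p - 1 / 2 * B (x - p) (x - p)) (1 / 2 * B (x - p) (x - p))
  rw [sub_add_cancel, abs_mul, abs_of_pos (by norm_num : (0 : ℝ) < 1 / 2)] at h4
  nlinarith

/-- A coercive penalized second variation makes `p` a strict local minimum of the penalized
functional, quadratically, transversally to a symmetry direction. -/
lemma HasCriticalExpansion.exists_quadratic_lower_bound {G Q : X → ℝ} {B : X →L[ℝ] X →L[ℝ] ℝ}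
    {p : X} (hG : HasCriticalExpansion G B p) {q : X →L[ℝ] ℝ} (hQ : HasFDerivAt Q q p)
    {S : Set X} {N δ : ℝ} (hδ : 0 < δ) (hco : ∀ v ∈ S, δ * ‖v‖ ^ 2 ≤ B v v + N * q v ^ 2) :
    ∃ η > 0, ∀ v ∈ S, ‖v‖ < η →
      δ / 4 * ‖v‖ ^ 2 ≤ G (p + v) - G p + N / 2 * (Q (p + v) - Q p) ^ 2 := by
  -- Error budget: the second variation contributes δ/2, and the remainders of G and of the penalty
  -- each cost δ/8, leaving δ/4.
  obtain ⟨η₁, hη₁, h1⟩ := hG (δ / 8) (by positivity)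
  set ε := min 1 (δ / (4 * (|N| + 1) * (2 * ‖q‖ + 1))) with hε
  have hε0 : 0 < ε := by positivity
  have hε1 : ε ≤ 1 := min_le_left _ _
  have hε2 : ε * (4 * (|N| + 1) * (2 * ‖q‖ + 1)) ≤ δ :=
    (le_div_iff₀ (by positivity)).1 (min_le_right _ _)
  obtain ⟨η₂, hη₂, h2⟩ := Metric.eventually_nhds_iff.1 (hQ.isLittleO.def hε0)
  refine ⟨min η₁ η₂, by positivity, fun v hv hn => ?_⟩
  have h3 := h1 v (hn.trans_le (min_le_left _ _))
  have h4 := h2 (y := p + v) (by simpa [dist_eq_norm] using hn.trans_le (min_le_right _ _))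
  rw [add_sub_cancel_left, Real.norm_eq_abs] at h4
  have h5 := hco v hv
  have h6 := q.le_opNorm v
  rw [Real.norm_eq_abs] at h6
  set x := Q (p + v) - Q p
  set y := q v
  -- The increment of Q is squared, so a first order expansion with error ε‖v‖ already gives a
  -- second order one.
  have h7 : |x ^ 2 - y ^ 2| ≤ ε * (2 * ‖q‖ + 1) * ‖v‖ ^ 2 := by
    have e : x ^ 2 - y ^ 2 = (x - y) * ((x - y) + 2 * y) := by ring
    rw [e, abs_mul]
    have h8 : |(x - y) + 2 * y| ≤ (2 * ‖q‖ + 1) * ‖v‖ := by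
      refine (abs_add_le _ _).trans ?_
      rw [abs_mul, abs_two]
      nlinarith [norm_nonneg v]
    calc |x - y| * |(x - y) + 2 * y| ≤ (ε * ‖v‖) * ((2 * ‖q‖ + 1) * ‖v‖) := by gcongr
      _ = _ := by ring
  have h8 : |N * (x ^ 2 - y ^ 2)| ≤ δ / 4 * ‖v‖ ^ 2 := by
    rw [abs_mul]
    calc |N| * |x ^ 2 - y ^ 2| ≤ (|N| + 1) * (ε * (2 * ‖q‖ + 1) * ‖v‖ ^ 2) := by
          gcongr
          linarith
      _ = ε * (4 * (|N| + 1) * (2 * ‖q‖ + 1)) / 4 * ‖v‖ ^ 2 := by ring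
      _ ≤ δ / 4 * ‖v‖ ^ 2 := by gcongr
  have h9 := abs_le.1 h8
  have h10 := abs_le.1 h3
  nlinarith [h9.1, h10.1]

/-- A continuous function that starts below `ε` and never equals `ε` stays below `ε`. -/
lemma forall_lt_of_forall_ne {ρ : ℝ → ℝ} (hρ : ContinuousOn ρ (Ici 0)) {ε : ℝ} (h0 : ρ 0 < ε)
    (hne : ∀ t, 0 ≤ t → ρ t ≠ ε) : ∀ t, 0 ≤ t → ρ t < ε := by
  intro t ht
  by_contra! hge
  obtain ⟨τ, hτ, he⟩ := intermediate_value_Icc ht (hρ.mono Icc_subset_Ici_self)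
    (⟨h0.le, hge⟩ : ε ∈ Icc (ρ 0) (ρ t))
  exact hne τ hτ.1 he

end Lyapunov

/-! ### Second order expansion of u ↦ ∫R(u) in the energy space -/

section Nonlinearity

variable {L : ℝ} [Fact (0 < L)] {R : Plane → ℝ} {r : ℝ}

lemma memLp_gradient (hR : ContDiff ℝ 2 R) (φ : SmoothPer L) :
    MemLp (fun x => gradient R (φ x)) 2 (volume : Measure (AddCircle L)) := by
  have hc : Continuous fun x => gradient R (φ x) :=
    (contDiff_gradient hR).continuous.comp φ.continuous
  obtain ⟨C, hC⟩ := isCompact_univ.exists_bound_of_continuousOn hc.continuousOn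
  exact MemLp.of_bound hc.aestronglyMeasurable C (Eventually.of_forall fun x => hC x (mem_univ x))

/-- The functional `v ↦ ∫ ⟨∇R(φ), v⟩`. -/
def gradientFunctional (hr : 0 ≤ r) (hR : ContDiff ℝ 2 R) (φ : SmoothPer L) : Hper L r →L[ℝ] ℝ :=
  (innerSL ℝ ((memLp_gradient hR φ).toLp _)).comp (Hper.toL2L L hr)

lemma gradientFunctional_apply (hr : 0 ≤ r) (hR : ContDiff ℝ 2 R) (φ : SmoothPer L)
    (v : Hper L r) :
    gradientFunctional hr hR φ v = ∫ x, inner ℝ (gradient R (φ x)) (v x) := by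
  change inner ℝ ((memLp_gradient hR φ).toLp _) v.toL2 = _
  rw [L2.inner_def]
  refine integral_congr_ae ?_
  filter_upwards [(memLp_gradient hR φ).coeFn_toLp] with x hx
  rw [hx]

/-- Second order Taylor expansion of `∫ R(u)`, for perturbations small in `L^∞`. -/
lemma exists_taylor_of_small_sup (hr : 0 ≤ r) (hR : ContDiff ℝ 2 R) (φ : SmoothPer L) {ε : ℝ}
    (hε : 0 < ε) : ∃ δ > 0, ∀ v : Hper L r, (∀ᵐ x, ‖v x‖ < δ) →
      |(∫ x, R ((φ.toHper r + v : Hper L r) x)) - (∫ x, R (φ.toHper r x)) -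
        gradientFunctional hr hR φ v - 1 / 2 * hessianForm hr hR φ v v| ≤ ε * massForm L hr v v := by
  obtain ⟨δ, hδ, hb⟩ := ContDiff.taylor_two_uniform hR (isCompact_range φ.continuous) hε
  refine ⟨δ, hδ, fun v hv => ?_⟩
  have hRc : Continuous R := hR.continuous
  have i0 : Integrable fun x => R (φ.toHper r x) := by
    have hc : Continuous fun x => R (φ x) := hRc.comp φ.continuous
    refine (hc.integrable_of_hasCompactSupport (HasCompactSupport.of_compactSpace _)).congr ?_
    filter_upwards [φ.coeFn_toHper r] with x hx
    rw [hx]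
  have i1 : Integrable fun x => inner ℝ (gradient R (φ x)) (v x) := by
    refine (L2.integrable_inner ((memLp_gradient hR φ).toLp _) v.toL2 (𝕜 := ℝ)).congr ?_
    filter_upwards [(memLp_gradient hR φ).coeFn_toLp] with x hx
    rw [hx]
  have i2 : Integrable fun x => inner ℝ (hessian R (φ x) (v x)) (v x) := by
    refine (L2.integrable_inner (hessianL2 hR φ v.toL2) v.toL2 (𝕜 := ℝ)).congr ?_
    filter_upwards [coeFn_hessianL2 hR φ v.toL2] with x hx
    rw [hx]
  have i3 : Integrable fun x => inner ℝ (v x) (v x) := L2.integrable_inner v.toL2 v.toL2 (𝕜 := ℝ)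
  set g : AddCircle L → ℝ := fun x => R ((φ.toHper r + v : Hper L r) x) - R (φ.toHper r x) -
    inner ℝ (gradient R (φ x)) (v x) - 1 / 2 * inner ℝ (hessian R (φ x) (v x)) (v x) with hg
  have hgle : ∀ᵐ x, ‖g x‖ ≤ ε * inner ℝ (v x) (v x) := by
    filter_upwards [hv, φ.coeFn_toHper r, Hper.coeFn_add (φ.toHper r) v] with x h1 h2 h3
    have h4 := hb (φ x) (mem_range_self x) (v x) h1
    rw [← inner_gradient, ← inner_hessian hR] at h4
    rw [hg, real_inner_self_eq_norm_sq]
    simp only [h3, Pi.add_apply, h2, Real.norm_eq_abs]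
    exact h4
  have hmeas : AEStronglyMeasurable (fun x => R ((φ.toHper r + v : Hper L r) x)) volume :=
    hRc.comp_aestronglyMeasurable (Lp.aestronglyMeasurable _)
  have ig : Integrable g := by
    refine (i3.const_mul ε).mono' ?_ hgle
    exact ((hmeas.sub i0.1).sub i1.1).sub (i2.const_mul _).1
  have iR : Integrable fun x => R ((φ.toHper r + v : Hper L r) x) := by
    refine (((ig.add (i2.const_mul (1 / 2))).add i1).add i0).congr (Eventually.of_forall fun x => ?_)
    simp only [Pi.add_apply, hg]
    ring
  have hint : ∫ x, g x = (∫ x, R ((φ.toHper r + v : Hper L r) x)) - (∫ x, R (φ.toHper r x)) -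
      gradientFunctional hr hR φ v - 1 / 2 * hessianForm hr hR φ v v := by
    refine (integral_sub ((iR.sub i0).sub i1) (i2.const_mul (1 / 2))).trans ?_
    rw [integral_const_mul, gradientFunctional_apply, hessianForm_eq_integral]
    congr 1
    refine (integral_sub (iR.sub i0) i1).trans ?_
    congr 1
    exact integral_sub iR i0
  rw [← hint, massForm_eq_integral, ← integral_const_mul]
  exact norm_integral_le_of_norm_le (i3.const_mul ε) hgle

/-- Uniqueness of second order expansions along a ray; it serves to compare the abstract Taylor
expansion with the pointwise one. -/
lemma eq_zero_of_abs_linear_add_quadratic_le {a b : ℝ}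
    (h : ∀ ε > 0, ∃ δ > 0, ∀ t, 0 < t → t < δ → |t * a + t ^ 2 * b| ≤ ε * t ^ 2) :
    a = 0 ∧ b = 0 := by
  have ha : a = 0 := by
    by_contra hne
    obtain ⟨δ, hδ, hb⟩ := h 1 one_pos
    have hpos : 0 < |a| := abs_pos.2 hne
    set t := min (δ / 2) (|a| / (2 * (|b| + 1)))
    have ht : 0 < t := by positivity
    have ht1 : t < δ := (min_le_left _ _).trans_lt (by linarith)
    have ht2 : t * (2 * (|b| + 1)) ≤ |a| := (le_div_iff₀ (by positivity)).1 (min_le_right _ _)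
    have h1 := hb t ht ht1
    have h2 := abs_sub_abs_le_abs_sub (t * a) (-(t ^ 2 * b))
    rw [sub_neg_eq_add, abs_neg, abs_mul, abs_mul, abs_of_pos ht, abs_of_pos (pow_pos ht 2)] at h2
    have h3 : t * |a| ≤ t * (t * (|b| + 1)) := by nlinarith
    have h4 := le_of_mul_le_mul_left h3 ht
    linarith
  refine ⟨ha, ?_⟩
  by_contra hne
  have hpos : 0 < |b| := abs_pos.2 hne
  obtain ⟨δ, hδ, hb⟩ := h (|b| / 2) (by positivity)
  have h1 := hb (δ / 2) (by positivity) (by linarith)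
  rw [ha, mul_zero, zero_add, abs_mul, abs_of_pos (by positivity : (0 : ℝ) < (δ / 2) ^ 2)] at h1
  have h2 : 0 < (δ / 2) ^ 2 := by positivity
  nlinarith

lemma massForm_self_le (hr : 0 ≤ r) (v : Hper L r) :
    massForm L hr v v ≤ ‖Hper.toL2L L hr‖ ^ 2 * ‖v‖ ^ 2 := by
  rw [massForm_apply, real_inner_self_eq_norm_sq, ← mul_pow]
  have := (Hper.toL2L L hr).le_opNorm v
  rw [Hper.toL2L_apply] at this
  gcongr

/-- Second order Taylor expansion of `u ↦ ∫ R(u)` at `φ` in the energy space. -/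
lemma exists_taylor_nonlinearity (hr : 0 ≤ r) (hR : ContDiff ℝ 2 R) (φ : SmoothPer L)
    (hreg : 2 * r ≤ 1 → ContDiffAt ℝ 2 (fun u : Hper L r => ∫ x, R (u x)) (φ.toHper r)) {ε : ℝ}
    (hε : 0 < ε) : ∃ δ > 0, ∀ v : Hper L r, ‖v‖ < δ →
      |(∫ x, R ((φ.toHper r + v : Hper L r) x)) - (∫ x, R (φ.toHper r x)) -
        gradientFunctional hr hR φ v - 1 / 2 * hessianForm hr hR φ v v| ≤ ε * ‖v‖ ^ 2 := by
  set P := ‖Hper.toL2L L hr‖ ^ 2 with hP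
  have hP0 : 0 ≤ P := sq_nonneg _
  rcases le_or_gt (2 * r) 1 with hs | hs
  · set f : Hper L r → ℝ := fun u => ∫ x, R (u x) with hf
    have hcd := hreg hs
    set p := φ.toHper r
    -- For bounded v the perturbation tv becomes small in L^∞ as t → 0, so the pointwise expansion
    -- and the one from the C² hypothesis both hold along the ray and must coincide.
    have key : ∀ v ∈ essBounded L r, fderiv ℝ f p v - gradientFunctional hr hR φ v = 0 ∧
        1 / 2 * fderiv ℝ (fderiv ℝ f) p v v - 1 / 2 * hessianForm hr hR φ v v = 0 := by
      rintro v ⟨M, hM⟩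
      refine eq_zero_of_abs_linear_add_quadratic_le fun ε' hε' => ?_
      obtain ⟨δ₁, hδ₁, h1⟩ := ContDiffAt.taylor_two hcd (ε := ε' / (2 * (‖v‖ ^ 2 + 1))) (by positivity)
      obtain ⟨δ₂, hδ₂, h2⟩ := exists_taylor_of_small_sup hr hR φ
        (ε := ε' / (2 * (massForm L hr v v + 1)))
        (by
          have : 0 ≤ massForm L hr v v := by
            rw [massForm_apply]
            exact real_inner_self_nonneg
          positivity)
      refine ⟨min (δ₁ / (‖v‖ + 1)) (δ₂ / (|M| + 1)), by positivity, fun t ht htδ => ?_⟩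
      have ht1 : t * (‖v‖ + 1) < δ₁ := (lt_div_iff₀ (by positivity)).1 (htδ.trans_le (min_le_left _ _))
      have ht2 : t * (|M| + 1) < δ₂ := (lt_div_iff₀ (by positivity)).1 (htδ.trans_le (min_le_right _ _))
      have h3 := h1 (t • v) (by
        rw [norm_smul, Real.norm_of_nonneg ht.le]
        linarith)
      have h4 := h2 (t • v) (by
        filter_upwards [hM, Hper.coeFn_smul t v] with x hx hx'
        rw [hx', Pi.smul_apply, norm_smul, Real.norm_of_nonneg ht.le]
        calc t * ‖v x‖ ≤ t * (|M| + 1) := by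
              gcongr
              linarith [le_abs_self M]
          _ < δ₂ := ht2)
      have hm0 : 0 ≤ massForm L hr v v := by
        rw [massForm_apply]
        exact real_inner_self_nonneg
      simp only [map_smul, smul_apply, smul_eq_mul, norm_smul, mul_pow,
        Real.norm_of_nonneg ht.le] at h3 h4
      have e3 : ε' / (2 * (‖v‖ ^ 2 + 1)) * (t ^ 2 * ‖v‖ ^ 2) ≤ ε' / 2 * t ^ 2 := by
        rw [div_mul_eq_mul_div, div_le_iff₀ (by positivity)]
        have : 0 ≤ ε' * t ^ 2 := by positivity
        nlinarith
      have e4 : ε' / (2 * (massForm L hr v v + 1)) * (t * (t * massForm L hr v v)) ≤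
          ε' / 2 * t ^ 2 := by
        rw [div_mul_eq_mul_div, div_le_iff₀ (by positivity)]
        have : 0 ≤ ε' * t ^ 2 := by positivity
        nlinarith
      have h3' := abs_le.1 (h3.trans e3)
      have h4' := abs_le.1 (h4.trans e4)
      rw [abs_le]
      constructor <;> linarith [h3'.1, h3'.2, h4'.1, h4'.2]
    -- Both sides are continuous on H^r, so density removes the boundedness restriction.
    have hd := dense_essBounded (L := L) hr
    have e1 : (fun v => fderiv ℝ f p v) = fun v => gradientFunctional hr hR φ v :=
      Continuous.ext_on hd (fderiv ℝ f p).continuous (gradientFunctional hr hR φ).continuous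
        fun v hv => sub_eq_zero.1 (key v hv).1
    have e2 : (fun v => fderiv ℝ (fderiv ℝ f) p v v) = fun v => hessianForm hr hR φ v v :=
      Continuous.ext_on hd ((fderiv ℝ (fderiv ℝ f) p).continuous.clm_apply continuous_id)
        ((hessianForm hr hR φ).continuous.clm_apply continuous_id)
        fun v hv => by linarith [(key v hv).2]
    obtain ⟨δ, hδ, h⟩ := ContDiffAt.taylor_two hcd hε
    refine ⟨δ, hδ, fun v hv => ?_⟩
    have h1 := h v hv
    rw [congrFun e1 v, congrFun e2 v] at h1
    exact h1
  -- For 2r > 1, smallness in H^r implies smallness in L^∞ and the pointwise expansion applies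
  -- directly.
  · obtain ⟨M, hM0, hM⟩ := exists_sup_norm_le (L := L) hs
    obtain ⟨δ, hδ, h⟩ := exists_taylor_of_small_sup hr hR φ (ε := ε / (P + 1)) (by positivity)
    refine ⟨δ / (M + 1), by positivity, fun v hv => ?_⟩
    rw [lt_div_iff₀ (by positivity)] at hv
    refine (h v ?_).trans ?_
    · filter_upwards [hM v] with x hx
      nlinarith [norm_nonneg v]
    · calc ε / (P + 1) * massForm L hr v v ≤ ε / (P + 1) * (P * ‖v‖ ^ 2) := by
            gcongr
            exact massForm_self_le hr v
        _ ≤ ε * ‖v‖ ^ 2 := by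
          rw [div_mul_eq_mul_div, div_le_iff₀ (by positivity)]
          have : 0 ≤ ε * ‖v‖ ^ 2 := by positivity
          nlinarith

end Nonlinearity

/-! ### The action functional: invariance, conservation, criticality at the wave -/

section AugmentedEnergy

/-- The constant function `A`. -/
def constPer (L : ℝ) (A : Plane) : SmoothPer L where
  toFun _ := A
  smooth := contDiff_const

lemma constPer_deriv {L : ℝ} (A : Plane) (x : AddCircle L) : (constPer L A).deriv x = 0 := by
  change deriv (fun _ : ℝ => A) 0 = 0
  simp

variable {L : ℝ} [Fact (0 < L)] {R : Plane → ℝ} {m : ℤ → Matrix (Fin 2) (Fin 2) ℝ} {s : ℝ}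

/-- The mean functional `u ↦ ∫ ⟨u, A⟩`. -/
def meanFunctional (A : Plane) (u : AddCircle L → Plane) : ℝ := ∫ x, inner ℝ (u x) A

/-- The action functional `E + cF + ∫ ⟨u, A⟩`, of which the wave is a critical point. -/
def action (R : Plane → ℝ) (m : ℤ → Matrix (Fin 2) (Fin 2) ℝ) (c : ℝ) (A : Plane)
    (u : AddCircle L → Plane) : ℝ :=
  energy R m u + c * momentum u + meanFunctional A u

lemma integral_translate (g : Plane → ℝ) {r : ℝ} (y : ℝ) (u : Hper L r) :
    ∫ x, g (translate y u x) = ∫ x, g (u x) := by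
  rw [← integral_add_right_eq_self (fun x => g (u x)) (y : AddCircle L)]
  refine integral_congr_ae ?_
  filter_upwards [translate_coeFn y u] with x hx
  rw [hx]

lemma dispersionForm_translate (m : ℤ → Matrix (Fin 2) (Fin 2) ℝ) {r : ℝ} (y : ℝ)
    (u : Hper L r) : dispersionForm m (translate y u) (translate y u) = dispersionForm m u u := by
  unfold dispersionForm
  congr 2
  funext κ
  refine Finset.sum_congr rfl fun i _ => Finset.sum_congr rfl fun j _ => ?_
  have h : fourier κ (y : AddCircle L) * starRingEnd ℂ (fourier κ (y : AddCircle L)) = 1 := by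
    rw [Complex.mul_conj, Complex.normSq_eq_norm_sq, fourier_apply, Circle.norm_coe]
    simp
  rw [fcoef_translate_Hper, fcoef_translate_Hper, map_mul, mul_mul_mul_comm, h, one_mul]

lemma action_translate (c : ℝ) (A : Plane) {r : ℝ} (y : ℝ) (u : Hper L r) :
    action R m c A (translate y u) = action R m c A u := by
  unfold action energy momentum meanFunctional
  rw [dispersionForm_translate, integral_translate R, integral_translate fun p => inner ℝ p p,
    integral_translate fun p => inner ℝ p A]

/-- The mean of a solution is conserved. -/
lemma IsGlobalSolution.meanFunctional_eq {u : ℝ → Hper L (s / 2)} (hu : IsGlobalSolution R m u)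
    (A : Plane) {t : ℝ} (ht : 0 ≤ t) : meanFunctional A (u t) = meanFunctional A (u 0) := by
  -- A constant test function has zero derivative, so the flux term disappears.
  have h := hu.weak (constPer L A) t ht
  have h0 : ∀ κ i, fcoef ((constPer L A).deriv : AddCircle L → Plane) κ i = 0 := fun κ i => by
    simp [fcoef, fourierCoeff, constPer_deriv]
  simp only [dispersionForm, h0, constPer_deriv] at h
  simp only [map_zero, mul_zero, Complex.zero_re, Finset.sum_const_zero, tsum_zero, inner_zero_right,
    integral_zero, sub_self, intervalIntegral.integral_zero] at h
  exact sub_eq_zero.1 h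

lemma action_conserved (S : GlobalFlow R m L s) (hE : S.Conserves fun u => energy R m u)
    (hF : S.Conserves fun u => momentum u) (c : ℝ) (A : Plane) :
    S.Conserves fun u => action R m c A u := by
  intro u₀ t ht
  have h := (S.solution u₀).meanFunctional_eq A ht
  rw [S.initial] at h
  have h1 := hE u₀ t ht
  have h2 := hF u₀ t ht
  simp only at h1 h2 ⊢
  rw [action, action, h, h1, h2]

/-- The wave is a critical point of the action, with second variation the linearized operator. -/
lemma IsTravellingWave.hasCriticalExpansion {C : ℝ} (hs : 0 < s) (hsym : IsSymbol m s)
    (hm : SymbolBound (s / 2) m C) (hR : ContDiff ℝ 2 R) {c : ℝ} {A : Plane} {φ : SmoothPer L}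
    (hwave : IsTravellingWave R m c A φ)
    (hreg : s ≤ 1 → ContDiffAt ℝ 2 (fun u : Hper L (s / 2) => ∫ x, R (u x)) (φ.toHper (s / 2))) :
    HasCriticalExpansion (fun u : Hper L (s / 2) => action R m c A u)
      (linearizedForm (half_pos hs).le hm hR c φ) (φ.toHper (s / 2)) := by
  intro ε hε
  set hs2 := (half_pos hs).le
  obtain ⟨δ, hδ, h⟩ := exists_taylor_nonlinearity hs2 hR φ (fun h => hreg (by linarith)) hε
  refine ⟨δ, hδ, fun v hv => ?_⟩
  have h1 := h v hv
  set p := φ.toHper (s / 2)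
  have hp : (p : AddCircle L → Plane) =ᵐ[volume] φ := φ.coeFn_toHper (s / 2)
  have hE : ∀ u : Hper L (s / 2), action R m c A u = 1 / 2 * (L * symbolForm L hm u u) -
      (∫ x, R (u x)) + c * (1 / 2 * massForm L hs2 u u) +
      massForm L hs2 u ((constPer L A).toHper (s / 2)) := by
    intro u
    have e : massForm L hs2 u ((constPer L A).toHper (s / 2)) = meanFunctional A u := by
      rw [massForm_eq_integral]
      refine integral_congr_ae ?_
      filter_upwards [(constPer L A).coeFn_toHper (s / 2)] with x hx
      rw [hx]
      rfl
    rw [e, massForm_eq_integral]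
    rfl
  -- The travelling wave equation tested with v: the first order terms of the action at φ cancel.
  have hcrit : L * symbolForm L hm p v + c * massForm L hs2 p v +
      massForm L hs2 v ((constPer L A).toHper (s / 2)) = gradientFunctional hs2 hR φ v := by
    set g := (memLp_gradient hR φ).toLp _ - c • p.toL2 - ((constPer L A).toHper (s / 2)).toL2 with hgdef
    have hg : (g : AddCircle L → Plane) =ᵐ[volume] fun x => gradient R (φ x) - c • φ x - A := by
      filter_upwards [Lp.coeFn_sub ((memLp_gradient hR φ).toLp _ - c • p.toL2)
        ((constPer L A).toHper (s / 2)).toL2, Lp.coeFn_sub ((memLp_gradient hR φ).toLp _) (c • p.toL2),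
        Lp.coeFn_smul c p.toL2, hp, (memLp_gradient hR φ).coeFn_toLp,
        (constPer L A).coeFn_toHper (s / 2)] with x h1 h2 h3 h4 h5 h6
      rw [h1, Pi.sub_apply, h2, Pi.sub_apply, h3, Pi.smul_apply, h4, h5, h6]
      rfl
    have hd := hwave.dispersionForm_eq ((memLp_congr_ae hg).1 (Lp.memLp g)) v.memLp
    have e1 : dispersionForm m φ v = L * symbolForm L hm p v := by
      rw [dispersionForm, ← SmoothPer.fcoef_toHper φ (s / 2)]
      rfl
    have e2 : ∫ x, inner ℝ (gradient R (φ x) - c • φ x - A) (v x) = inner ℝ g v.toL2 := by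
      rw [L2.inner_def]
      refine integral_congr_ae ?_
      filter_upwards [hg] with x hx
      rw [hx]
    rw [e1, e2, hgdef, inner_sub_left, inner_sub_left, real_inner_smul_left] at hd
    have e3 : gradientFunctional hs2 hR φ v = inner ℝ ((memLp_gradient hR φ).toLp _) v.toL2 := rfl
    rw [hd, e3, massForm_apply, massForm_apply,
      real_inner_comm ((constPer L A).toHper (s / 2)).toL2 v.toL2]
    ring
  have hB : linearizedForm hs2 hm hR c φ v v =
      L * symbolForm L hm v v + c * massForm L hs2 v v - hessianForm hs2 hR φ v v := rfl
  have hsymm := symbolForm_comm hm hsym.symm p v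
  have hmc := massForm_comm hs2 p v
  -- Apart from ∫R the action is a quadratic plus a linear functional, so its remainder is exactly
  -- minus the Taylor remainder of ∫R.
  have e : action R m c A (p + v : Hper L (s / 2)) - action R m c A p -
      1 / 2 * linearizedForm hs2 hm hR c φ v v = -((∫ x, R ((p + v : Hper L (s / 2)) x)) -
        (∫ x, R (p x)) - gradientFunctional hs2 hR φ v - 1 / 2 * hessianForm hs2 hR φ v v) := by
    rw [hE, hE, hB, ← hcrit]
    simp only [map_add, add_apply]
    rw [← hsymm, ← hmc]
    ring
  simp only
  rw [e, abs_neg]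
  exact h1

end AugmentedEnergy

/-! ### From a Lyapunov functional to orbital stability -/

section Stability

variable {L : ℝ} [Fact (0 < L)] {R : Plane → ℝ} {m : ℤ → Matrix (Fin 2) (Fin 2) ℝ} {s : ℝ}

/-- A translation invariant conserved functional that is continuous at `φ` and bounded below by the
squared distance near `φ`, transversally to the orbit, yields orbital stability. -/
lemma GlobalFlow.orbitallyStable_of_lyapunov (S : GlobalFlow R m L s) (φ : SmoothPer L)
    {V : Hper L (s / 2) → ℝ} (hV : S.Conserves V) (hinv : ∀ y u, V (translate y u) = V u)
    (hcont : ContinuousAt V (φ.toHper (s / 2))) {a η : ℝ} (ha : 0 < a) (hη : 0 < η)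
    (hlow : ∀ v, inner ℝ (φ.deriv.toHper (s / 2)) v = 0 → ‖v‖ < η →
      a * ‖v‖ ^ 2 ≤ V (φ.toHper (s / 2) + v) - V (φ.toHper (s / 2))) :
    S.OrbitallyStable (φ.toHper (s / 2)) := by
  intro ε hε
  set p := φ.toHper (s / 2)
  -- The cap η/2 keeps the sphere of radius ε' inside the region where the lower bound holds.
  set ε' := min ε (η / 2)
  have hε' : 0 < ε' := by positivity
  have hε'η : ε' < η := (min_le_right _ _).trans_lt (half_lt_self hη)
  obtain ⟨δ, hδ, hd⟩ := Metric.continuousAt_iff.1 hcont (a * ε' ^ 2) (by positivity)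
  refine ⟨min δ ε', by positivity, fun u₀ hu₀ => ⟨S.solution u₀, S.initial u₀, fun t ht => ?_⟩⟩
  have h0 := hd (x := u₀) (by
    rw [dist_eq_norm]
    exact hu₀.trans_le (min_le_left _ _))
  rw [Real.dist_eq] at h0
  refine lt_of_lt_of_le ?_ (min_le_left ε (η / 2))
  refine forall_lt_of_forall_ne (ρ := fun t => rho (S.toFun t u₀) p)
    ((continuous_rho p).comp_continuousOn (S.solution u₀).continuousOn) ?_ (fun τ hτ he => ?_) t ht
  · simp only [S.initial]
    have := rho_le u₀ p 0
    rw [translate_zero] at this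
    exact this.trans_lt (hu₀.trans_le (min_le_right _ _))
  -- At a time when the distance equals ε', the lower bound gives V(u₀) - V(φ) ≥ aε'², whereas
  -- continuity at φ made this difference smaller than aε'².
  · obtain ⟨y, hy, horth⟩ := φ.exists_rho_eq (S.toFun τ u₀)
    have hn : ‖translate y (S.toFun τ u₀) - p‖ = ε' := hy.symm.trans he
    have h1 := hlow _ horth (hn.trans_lt hε'η)
    rw [add_sub_cancel, hinv, hV u₀ τ hτ, hn] at h1
    linarith [le_abs_self (V u₀ - V p)]

end Stability

end DispersiveSystem

end

theorem theorem1p1 (L : ℝ) [Fact (0 < L)] (s : ℝ) (hs : 0 < s)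
    (m : ℤ → Matrix (Fin 2) (Fin 2) ℝ) (hm : DispersiveSystem.IsSymbol m s)
    (R : DispersiveSystem.Plane → ℝ) (hR : ContDiff ℝ 2 R)
    -- for `s ≤ 1` the energy is well defined on the energy space and of class `C²` near `φ`
    (φ : DispersiveSystem.SmoothPer L)
    (hint : s ≤ 1 → ∀ u : DispersiveSystem.Hper L (s / 2), MeasureTheory.Integrable fun x => R (u x))
    (hreg : s ≤ 1 → ContDiffAt ℝ 2
      (fun u : DispersiveSystem.Hper L (s / 2) => ∫ x, R (u x)) (φ.toHper (s / 2)))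
    -- the flow, and conservation of energy and momentum
    (S : DispersiveSystem.GlobalFlow R m L s)
    (hE : S.Conserves fun u => DispersiveSystem.energy R m u)
    (hF : S.Conserves fun u => DispersiveSystem.momentum u)
    -- the wave, with minimal period `L`, and the spectral assumption
    (c : ℝ) (A : DispersiveSystem.Plane)
    (hwave : DispersiveSystem.IsTravellingWave R m c A φ)
    (hmin : ∀ p : ℝ, 0 < p → p < L → ∃ x : AddCircle L, φ (x + (p : AddCircle L)) ≠ φ x)
    (hspec : DispersiveSystem.SpectralCondition R m s c φ)
    -- the function `Φ` and the conserved functional `Q`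
    (Φ : DispersiveSystem.Hper L (s / 2))
    (hneg : DispersiveSystem.linForm R m c φ Φ Φ < 0)
    (horth : DispersiveSystem.linForm R m c φ Φ φ.deriv = 0)
    (Q : DispersiveSystem.Hper L (s / 2) → ℝ) (hQ : S.Conserves Q)
    (hQinv : ∀ (y : ℝ) (u : DispersiveSystem.Hper L (s / 2)),
      Q (DispersiveSystem.translate y u) = Q u)
    (hQdiff : DifferentiableAt ℝ Q (φ.toHper (s / 2)))
    (hQder : ∀ v : DispersiveSystem.Hper L (s / 2),
      fderiv ℝ Q (φ.toHper (s / 2)) v = DispersiveSystem.linForm R m c φ Φ v) :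
    S.OrbitallyStable (φ.toHper (s / 2)) := by
  obtain ⟨C, hC⟩ := hm.symbolBound hs.le
  obtain ⟨N, δ, hδ, hco⟩ := DispersiveSystem.exists_linForm_coercive hs hm hC hR hspec hneg
  have hG := hwave.hasCriticalExpansion hs hm hC hR hreg
  have hfd : HasFDerivAt Q (DispersiveSystem.linearizedForm (half_pos hs).le hC hR c φ Φ)
      (φ.toHper (s / 2)) := by
    refine hQdiff.hasFDerivAt.congr_fderiv (ContinuousLinearMap.ext fun v => ?_)
    rw [hQder, DispersiveSystem.linearizedForm_eq_linForm]
  obtain ⟨η, hη, hlow⟩ := hG.exists_quadratic_lower_bound hfd hδ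
    (S := {v | inner ℝ (φ.deriv.toHper (s / 2)) v = 0}) hco
  refine S.orbitallyStable_of_lyapunov φ
    -- The penalty is centred at Q(φ), so it vanishes at the wave and contributes N B(Φ,v)² to the
    -- second variation.
    (V := fun u => DispersiveSystem.action R m c A u + N / 2 * (Q u - Q (φ.toHper (s / 2))) ^ 2)
    (fun u₀ t ht => ?_) (fun y u => ?_) ?_ (a := δ / 4) (by positivity) hη (fun v hv hn => ?_)
  · have h1 := DispersiveSystem.action_conserved S hE hF c A u₀ t ht
    simp only at h1 ⊢
    rw [h1, hQ u₀ t ht]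
  · simp only [DispersiveSystem.action_translate, hQinv]
  · exact hG.continuousAt.add
      (continuousAt_const.mul ((hQdiff.continuousAt.sub continuousAt_const).pow 2))
  · have h := hlow v hv hn
    simp only [sub_self]
    linarith
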